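/- For $\mathbf{u}\in\mathbb{R}^3$ let $|\mathbf{u}|_{Cyg}=\big((u_1^2+u_2^2)^2+u_3^2\big)^{1/4}$ be the Cygan-Korányi norm, let $\mathcal{B}=\{\mathbf{u}\in\mathbb{R}^3:|\mathbf{u}|_{Cyg}\le 1\}$, and for $x>0$ put $$N_1(x)=\#\{\mathbf{z}\in\mathbb{Z}^3:|\mathbf{z}|_{Cyg}\le x\},\qquad \mathcal{E}_1(x)=N_1(x)-\mathrm{vol}(\mathcal{B})\,x^4 ,$$ where $\mathrm{vol}$ is the Euclidean volume. Let $r_2(m)=\#\{(a,b)\in\mathbb{Z}^2:a^2+b^2=m\}$, let $\psi(t)=t-[t]-\tfrac12$ with $[t]=\max\{m\in\mathbb{Z}:m\le t\}$, and for $Y>0$ let $$T(Y)=\sum_{0\le m\le Y}r_2(m)\,\psi\big((Y^2-m^2)^{1/2}\big).$$ Then there is an absolute constant $X_0>0$ such that for every $\epsilon>0$, all $X\ge X_0$ and all $X\le x\le 2X$, $$\frac{\mathcal{E}_1(x)}{x^2}=-\frac{\sqrt2}{\pi}\sum_{1\le m\le X^2}\frac{r_2(m)}{m}\cos\big(2\pi\sqrt{m}\,x\big)-2x^{-2}T(x^2)+O_\epsilon\big(X^{-1+\epsilon}\big),$$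 where the implied constant depends only on $\epsilon$. -/

import Mathlib

namespace CyganKoranyi

/-- The Cygan-Korányi norm on `ℝ³`: `|u| = ((u₁² + u₂²)² + u₃²)^{1/4}`. -/
noncomputable def cygNorm (u : Fin 3 → ℝ) : ℝ :=
  (((u 0) ^ 2 + (u 1) ^ 2) ^ 2 + (u 2) ^ 2) ^ (1 / 4 : ℝ)

/-- The closed unit ball of the Cygan-Korányi norm. -/
def unitBall : Set (Fin 3 → ℝ) := {u | cygNorm u ≤ 1}

/-- The number of integer points `z ∈ ℤ³` whose Cygan-Korányi norm is at most `x`. -/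
noncomputable def N1 (x : ℝ) : ℕ :=
  Set.ncard {z : Fin 3 → ℤ | cygNorm (fun i => (z i : ℝ)) ≤ x}

/-- The error term `N₁(x) - vol(B) x⁴`, where `vol` is Lebesgue measure on `ℝ³`. -/
noncomputable def E1 (x : ℝ) : ℝ :=
  (N1 x : ℝ) - (MeasureTheory.volume unitBall).toReal * x ^ 4

/-- The number of pairs `(a, b) ∈ ℤ²` with `a² + b² = m`. -/
noncomputable def r2 (m : ℕ) : ℕ :=
  Set.ncard {p : ℤ × ℤ | p.1 ^ 2 + p.2 ^ 2 = (m : ℤ)}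

/-- The sawtooth function `ψ(t) = t - [t] - 1/2`. -/
noncomputable def psi (t : ℝ) : ℝ := t - (⌊t⌋ : ℝ) - 1 / 2

/-- `T(Y) = ∑_{0 ≤ m ≤ Y} r₂(m) ψ((Y² - m²)^{1/2})`. -/
noncomputable def T (Y : ℝ) : ℝ :=
  ∑ m ∈ Finset.Icc 0 ⌊Y⌋₊, (r2 m : ℝ) * psi (Real.sqrt (Y ^ 2 - (m : ℝ) ^ 2))

end CyganKoranyi

/-! Counting along vertical lines and replacing each floor by the sawtooth turns N₁(x) + 2T(x²) into
the sum of 2√(x⁴ - n²), n = |z|², over z ∈ ℤ² with n ≤ x² (`N1_add_two_mul_T`). The rest is planar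
Poisson summation for this radial function.

Its singularity is at the circle n = x². Freezing √(x² + n) at its value √2·x there gives 2√(x⁴ -
n²) = 2√2·x·√(x² - n) - x²·h(n/x²), with h = `smootherProfile` (`two_mul_sqrt_eq`). Since h vanishes
to order 3/2 at the boundary, its transform is O(r⁻³), and Poisson summation leaves only O(x)
(`exists_sum_smootherProfile_le`). The zero frequencies of the two pieces combine to the volume of
the ball (`volume_unitBall_eq`).

The transform of √(x² - |z|²) is elementary (`radialFourier_sqrt`). Its leading part
-x·cos(2πrx)/(2πr²) produces the cosine sum, but the dual series is not absolutely convergent. So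
the profile is averaged over the radii x + ρ, |ρ| ≤ 1, against (1 - |ρ|)·sin(2πXρ)/(πρ). The cosine
transform of this kernel is close to a constant κ for r < X and to 0 for r > X
(`abs_kernelHat_sub_le`), which cuts the dual sum at m = X².

Two errors arise. On the dual side the imperfect cut costs x times the sum of r₂(m)/(m(1 + |√m -
X|)) (`exists_tsum_r2_weight_le`). On the lattice side averaging changes each term, and two
integrations by parts bound the change (`abs_smoothingError_le`, `exists_sum_smoothingError_le`).
Both totals are O(X^ε) by the divisor-type bound r₂(m) ≪ m^δ, which follows from factorization in
ℤ[i]. As κ is bounded below, it can be divided out (`exists_sum_sqrt_sub_le`); the factor 2√2·x/x²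
then gives the error X^(-1+ε). -/

namespace CyganKoranyi

open MeasureTheory Set UnitAddTorus

/-! ### Poisson summation on ℤ^d for compactly supported functions -/

section Poisson

variable {d : Type*} [Fintype d]

/-- The embedding of the integer lattice. -/
def intVec (z : d → ℤ) : d → ℝ := fun i => (z i : ℝ)

theorem finite_intVec_mem {K : Set (d → ℝ)} (hK : IsCompact K) :
    {z : d → ℤ | intVec z ∈ K}.Finite := by
  obtain ⟨R, hR⟩ := hK.isBounded.subset_closedBall 0
  refine (isCompact_closedBall (0 : d → ℤ) R).finite_of_discrete.subset ?_
  intro z hz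
  have h := hR hz
  simp only [Metric.mem_closedBall, dist_zero_right] at h ⊢
  refine le_trans (le_of_eq ?_) h
  simp only [Pi.norm_def, intVec]
  congr 1
  
/-- Such a z lies in the difference set of the support and `K`, which is compact. This makes every
periodization below a locally finite sum. -/
theorem isCompact_finite_translates {f : (d → ℝ) → ℂ} (hc : HasCompactSupport f)
    {K : Set (d → ℝ)} (hK : IsCompact K) :
    {z : d → ℤ | ∃ x ∈ K, f (x + intVec z) ≠ 0}.Finite := by
  have hcomp : IsCompact ((fun p : (d → ℝ) × (d → ℝ) => p.1 - p.2) '' (tsupport f ×ˢ K)) :=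
    (hc.isCompact.prod hK).image (by fun_prop)
  refine (finite_intVec_mem hcomp).subset ?_
  rintro z ⟨x, hx, hf⟩
  exact ⟨(x + intVec z, x), ⟨subset_closure hf, hx⟩, by simp⟩

/-- The sum of the translates of a compactly supported function by the integer lattice. -/
noncomputable def periodize (f : (d → ℝ) → ℂ) (x : d → ℝ) : ℂ := ∑' z : d → ℤ, f (x + intVec z)

theorem continuous_periodize {f : (d → ℝ) → ℂ} (hf : Continuous f) (hc : HasCompactSupport f) :
    Continuous (periodize f) := by
  rw [continuous_iff_continuousAt]
  intro x
  set K := Metric.closedBall x 1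
  have hfin := isCompact_finite_translates hc (isCompact_closedBall x 1)
  have : ∀ y ∈ K, periodize f y = ∑ z ∈ hfin.toFinset, f (y + intVec z) := by
    intro y hy
    refine tsum_eq_sum fun z hz => ?_
    by_contra h
    exact hz (hfin.mem_toFinset.2 ⟨y, hy, h⟩)
  have hcont : ContinuousAt (fun y => ∑ z ∈ hfin.toFinset, f (y + intVec z)) x := by
    apply Continuous.continuousAt
    fun_prop
  refine hcont.congr ?_
  filter_upwards [Metric.closedBall_mem_nhds x one_pos] with y hy
  exact (this y hy).symm

omit [Fintype d] in
theorem periodize_add (f : (d → ℝ) → ℂ) (x : d → ℝ) (w : d → ℤ) :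
    periodize f (x + intVec w) = periodize f x := by
  unfold periodize
  rw [← (Equiv.addLeft w).tsum_eq (fun z => f (x + intVec z))]
  refine tsum_congr fun z => ?_
  congr 1
  ext i
  simp [intVec, add_assoc]

omit [Fintype d] in
theorem isOpenQuotientMap_toTorus :
    IsOpenQuotientMap (fun (x : d → ℝ) => (fun i => (x i : UnitAddCircle))) :=
  IsOpenQuotientMap.piMap (fun _ => QuotientAddGroup.isOpenQuotientMap_mk)

/-- The periodization is invariant under ℤ^d, so it factors through the quotient map onto the torus,
where Fourier series are available. -/
theorem exists_torus_lift {f : (d → ℝ) → ℂ} (hf : Continuous f) (hc : HasCompactSupport f) :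
    ∃ F : C(UnitAddTorus d, ℂ), ∀ x : d → ℝ, F (fun i => (x i : UnitAddCircle)) = periodize f x := by
  let π : C(d → ℝ, UnitAddTorus d) :=
    ⟨fun x => (fun i => (x i : UnitAddCircle)), isOpenQuotientMap_toTorus.continuous⟩
  have hπ : Topology.IsQuotientMap π := isOpenQuotientMap_toTorus.isQuotientMap
  have hfac : Function.FactorsThrough (⟨periodize f, continuous_periodize hf hc⟩ : C(d → ℝ, ℂ)) π := by
    intro x y hxy
    have : ∀ i, ∃ n : ℤ, y i = x i + n := by
      intro i
      have h := congrFun hxy i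
      have h' : ((y i - x i : ℝ) : UnitAddCircle) = 0 := by
        rw [AddCircle.coe_sub, sub_eq_zero]
        exact h.symm
      obtain ⟨n, hn⟩ := (AddCircle.coe_eq_zero_iff 1).1 h'
      refine ⟨n, ?_⟩
      simp only [zsmul_eq_mul, mul_one] at hn
      linarith
    choose w hw using this
    have : y = x + intVec w := funext hw
    simp [this, periodize_add]
  exact ⟨hπ.lift _ hfac, fun x => congrFun (congrArg DFunLike.coe (hπ.lift_comp _ hfac)) x⟩

theorem integral_eq_tsum_cells {g : (d → ℝ) → ℂ} (hg : Integrable g) :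
    HasSum (fun z : d → ℤ => ∫ x in {x : d → ℝ | ∀ i, x i ∈ Ioc (0 : ℝ) (0 + 1)}, g (x + intVec z))
      (∫ x, g x) := by
  have hmeas : ∀ z : d → ℤ, MeasurableSet {x : d → ℝ | ∀ i, x i ∈ Ioc (z i : ℝ) (z i + 1)} :=
    fun z => MeasurableSet.univ_pi' (fun i => measurableSet_Ioc)
  have hdisj : Pairwise (Function.onFun Disjoint
      fun z : d → ℤ => {x : d → ℝ | ∀ i, x i ∈ Ioc (z i : ℝ) (z i + 1)}) := by
    intro z w hzw
    refine Set.disjoint_left.2 fun x hx hy => hzw (funext fun i => ?_)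
    have h1 := hx i
    have h2 := hy i
    have h3 : z i < w i + 1 := by exact_mod_cast h1.1.trans_le h2.2
    have h4 : w i < z i + 1 := by exact_mod_cast h2.1.trans_le h1.2
    omega
  have hun : ⋃ z : d → ℤ, {x : d → ℝ | ∀ i, x i ∈ Ioc (z i : ℝ) (z i + 1)} = univ := by
    -- The cells are open on the left and closed on the right, so the corner is ⌈xᵢ⌉ - 1 and not
    -- ⌊xᵢ⌋.
    refine eq_univ_of_forall fun x => mem_iUnion.2 ⟨fun i => ⌈x i⌉ - 1, fun i => ?_⟩
    push_cast
    exact ⟨by linarith [Int.ceil_lt_add_one (x i)], by linarith [Int.le_ceil (x i)]⟩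
  have h := hasSum_integral_iUnion hmeas hdisj (f := g) (μ := volume) (by rw [hun]; exact hg.integrableOn)
  rw [hun, Measure.restrict_univ] at h
  have key : (fun z : d → ℤ => ∫ x in {x : d → ℝ | ∀ i, x i ∈ Ioc (0 : ℝ) (0 + 1)}, g (x + intVec z)) =
      fun z : d → ℤ => ∫ x in {x : d → ℝ | ∀ i, x i ∈ Ioc (z i : ℝ) (z i + 1)}, g x := by
    funext z
    have hmp := measurePreserving_add_right (volume : Measure (d → ℝ)) (intVec z)
    rw [← hmp.setIntegral_preimage_emb (measurableEmbedding_addRight _) g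
      {x : d → ℝ | ∀ i, x i ∈ Ioc (z i : ℝ) (z i + 1)}]
    congr 2
    ext x
    simp only [mem_ofPred_eq, mem_preimage, Pi.add_apply, intVec, mem_Ioc]
    refine forall_congr' fun i => ?_
    constructor <;> rintro ⟨h1, h2⟩ <;> constructor <;> linarith
  rw [key]
  exact h

/-- Unfolding: the character has period ℤ^d, so integrating it against the sum of translates over
one cell is the same as integrating it against `f` over all of ℝ^d. -/
theorem mFourierCoeff_lift {f : (d → ℝ) → ℂ} (hf : Continuous f) (hc : HasCompactSupport f)
    {F : C(UnitAddTorus d, ℂ)} (hF : ∀ x : d → ℝ, F (fun i => (x i : UnitAddCircle)) = periodize f x)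
    (n : d → ℤ) :
    mFourierCoeff F n = ∫ x : d → ℝ, Complex.exp (-(2 * Real.pi * ∑ i, (n i : ℝ) * x i : ℝ) * Complex.I) * f x := by
  rw [mFourierCoeff_eq_integral F n 0]
  set e : (d → ℝ) → ℂ :=
    fun x => Complex.exp (-(2 * Real.pi * ∑ i, (n i : ℝ) * x i : ℝ) * Complex.I) with he
  have hecont : Continuous e := by fun_prop
  have hchar : ∀ x : d → ℝ, mFourier (-n) (fun i => (x i : UnitAddCircle)) = e x := by
    intro x
    simp only [mFourier, ContinuousMap.coe_mk, fourier_coe_apply, he, Pi.neg_apply]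
    rw [← Complex.exp_sum]
    congr 1
    push_cast
    rw [Finset.mul_sum, ← Finset.sum_neg_distrib, Finset.sum_mul]
    refine Finset.sum_congr rfl fun i _ => ?_
    ring
  have hper : ∀ (x : d → ℝ) (z : d → ℤ), e (x + intVec z) = e x := by
    intro x z
    simp only [he]
    rw [Complex.exp_eq_exp_iff_exists_int]
    refine ⟨-∑ i, n i * z i, ?_⟩
    simp only [Pi.add_apply, intVec, mul_add, Finset.sum_add_distrib]
    push_cast
    ring
  have hfin := isCompact_finite_translates hc (isCompact_univ_pi fun _ : d => isCompact_Icc (a := (0:ℝ)) (b := 1))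
  have hg : Integrable (fun x => e x * f x) :=
    (hecont.mul hf).integrable_of_hasCompactSupport hc.mul_left
  have hsum := integral_eq_tsum_cells hg
  rw [← hsum.tsum_eq, tsum_eq_sum (s := hfin.toFinset)]
  · rw [← integral_finsetSum]
    · refine setIntegral_congr_fun (MeasurableSet.univ_pi' fun i => measurableSet_Ioc) ?_
      intro x hx
      simp only [hchar, hF, smul_eq_mul, hper, ← Finset.mul_sum]
      congr 1
      refine tsum_eq_sum fun z hz => ?_
      by_contra h
      exact hz (hfin.mem_toFinset.2 ⟨x, fun i _ => ⟨(hx i).1.le, by simpa using (hx i).2⟩, h⟩)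
    · intro z _
      exact ((hg.comp_add_right (intVec z))).integrableOn
  · intro z hz
    refine setIntegral_eq_zero_of_forall_eq_zero fun x hx => ?_
    by_contra h
    exact hz (hfin.mem_toFinset.2 ⟨x, fun i _ => ⟨(hx i).1.le, by simpa using (hx i).2⟩, right_ne_zero_of_mul h⟩)

/-- A continuous function on the torus with summable Fourier coefficients is the pointwise sum of
its Fourier series; this is evaluated at the origin. -/
theorem tsum_intVec_eq {f : (d → ℝ) → ℂ} (hf : Continuous f) (hc : HasCompactSupport f)
    (hs : Summable fun n : d → ℤ =>
      ∫ x : d → ℝ, Complex.exp (-(2 * Real.pi * ∑ i, (n i : ℝ) * x i : ℝ) * Complex.I) * f x) :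
    HasSum (fun n : d → ℤ =>
      ∫ x : d → ℝ, Complex.exp (-(2 * Real.pi * ∑ i, (n i : ℝ) * x i : ℝ) * Complex.I) * f x) (∑' z : d → ℤ, f (intVec z)) := by
  obtain ⟨F, hF⟩ := exists_torus_lift hf hc
  simp_rw [← mFourierCoeff_lift hf hc hF] at hs ⊢
  have h := hasSum_mFourier_series_apply_of_summable hs (fun i => ((0 : ℝ) : UnitAddCircle))
  rw [hF (fun _ => 0)] at h
  convert h using 1
  · ext n
    simp [mFourier]
  · simp only [periodize]
    refine tsum_congr fun z => ?_
    congr 1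
    ext i
    simp

end Poisson

end CyganKoranyi

namespace CyganKoranyi

open Finset

/-! ### The bound r₂(m) ≪ m^δ through Gaussian integers -/

section RepresentationCount

theorem r2_eq_gaussian (m : ℕ) : r2 m = {z : GaussianInt | z.norm = m}.ncard := by
  unfold r2
  have : {z : GaussianInt | z.norm = m} =
      (fun p : ℤ × ℤ => (⟨p.1, p.2⟩ : GaussianInt)) '' {p : ℤ × ℤ | p.1 ^ 2 + p.2 ^ 2 = (m : ℤ)} := by
    ext z
    simp only [Set.mem_ofPred_eq, Set.mem_image, Prod.exists, Zsqrtd.norm_def]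
    constructor
    · intro h
      exact ⟨z.re, z.im, by linarith [sq z.re, sq z.im], rfl⟩
    · rintro ⟨a, b, h, rfl⟩
      simp only
      linarith [sq a, sq b]
  rw [this, Set.ncard_image_of_injective]
  rintro ⟨a, b⟩ ⟨c, e⟩ h
  simpa [Zsqrtd.ext_iff] using h

theorem finite_sq_add_sq_eq (m : ℕ) : {p : ℤ × ℤ | p.1 ^ 2 + p.2 ^ 2 = (m : ℤ)}.Finite := by
  refine (Set.finite_Icc ((-m : ℤ), (-m : ℤ)) ((m : ℤ), (m : ℤ))).subset ?_
  rintro ⟨a, b⟩ h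
  simp only [Set.mem_ofPred_eq] at h
  have ha : |a| ≤ m := by nlinarith [sq_nonneg b, sq_abs a, abs_nonneg a, sq_nonneg (|a| - 1), Int.le_self_sq |a|]
  have hb : |b| ≤ m := by nlinarith [sq_nonneg a, sq_abs b, abs_nonneg b, Int.le_self_sq |b|]
  rw [abs_le] at ha hb
  exact ⟨⟨ha.1, hb.1⟩, ⟨ha.2, hb.2⟩⟩

theorem finite_gaussian_norm_eq (m : ℕ) : {z : GaussianInt | z.norm = m}.Finite := by
  have h := (finite_sq_add_sq_eq m).image (fun p : ℤ × ℤ => (⟨p.1, p.2⟩ : GaussianInt))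
  refine h.subset fun z hz => ⟨(z.re, z.im), ?_, rfl⟩
  simp only [Set.mem_ofPred_eq, Zsqrtd.norm_def] at hz ⊢
  linarith [sq z.re, sq z.im]

/-- If `m` and `n` are coprime, every Gaussian integer of norm `m * n` is a product of
Gaussian integers of norms `m` and `n`. -/
theorem exists_mul_of_norm_eq_mul {m n : ℕ} (h : m.Coprime n) (hm : m ≠ 0) (hn : n ≠ 0)
    {z : GaussianInt} (hz : z.norm = (m * n : ℕ)) :
    ∃ a b : GaussianInt, a.norm = m ∧ b.norm = n ∧ z = a * b := by
  -- An element divides its own norm, since the norm is z times its conjugate.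
  have hdvd : z ∣ ((m : GaussianInt) * (n : GaussianInt)) := by
    refine ⟨star z, ?_⟩
    rw [← Zsqrtd.norm_eq_mul_conj, hz]
    push_cast
    rfl
  obtain ⟨a, b, ha, hb, rfl⟩ := exists_dvd_and_dvd_of_dvd_mul hdvd
  have hna : a.norm.natAbs ∣ m * m := by
    have := map_dvd Zsqrtd.normMonoidHom ha
    change Zsqrtd.norm _ ∣ Zsqrtd.norm _ at this
    rw [Zsqrtd.norm_natCast] at this
    simpa [Int.natAbs_mul] using Int.natAbs_dvd_natAbs.2 this
  have hnb : b.norm.natAbs ∣ n * n := by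
    have := map_dvd Zsqrtd.normMonoidHom hb
    change Zsqrtd.norm _ ∣ Zsqrtd.norm _ at this
    rw [Zsqrtd.norm_natCast] at this
    simpa [Int.natAbs_mul] using Int.natAbs_dvd_natAbs.2 this
  have hprod : a.norm.natAbs * b.norm.natAbs = m * n := by
    rw [← Int.natAbs_mul, ← Zsqrtd.norm_mul, hz, Int.natAbs_natCast]
  -- N(a) divides m², hence is coprime to n; as it also divides mn, it divides m. The same applies
  -- to b, and N(a)N(b) = mn then forces both equalities.
  have ham : a.norm.natAbs ∣ m := by
    refine Nat.Coprime.dvd_of_dvd_mul_right (k := a.norm.natAbs) (n := n) ?_ (hprod ▸ dvd_mul_right _ _)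
    exact Nat.Coprime.coprime_dvd_left hna (h.mul_left h)
  have hbn : b.norm.natAbs ∣ n := by
    refine Nat.Coprime.dvd_of_dvd_mul_left (k := b.norm.natAbs) (m := m) ?_ (hprod ▸ dvd_mul_left _ _)
    exact Nat.Coprime.coprime_dvd_left hnb (h.symm.mul_left h.symm)
  have h1 := Nat.le_of_dvd (Nat.pos_of_ne_zero hm) ham
  have h2 := Nat.le_of_dvd (Nat.pos_of_ne_zero hn) hbn
  have h3 : a.norm.natAbs = m := by
    by_contra hne
    have : a.norm.natAbs < m := lt_of_le_of_ne h1 hne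
    exact absurd hprod (Nat.mul_lt_mul_of_lt_of_le this h2 (Nat.pos_of_ne_zero hn)).ne
  have h4 : b.norm.natAbs = n := by
    rw [h3] at hprod
    exact Nat.eq_of_mul_eq_mul_left (Nat.pos_of_ne_zero hm) hprod
  refine ⟨a, b, ?_, ?_, rfl⟩
  · rw [← GaussianInt.abs_natCast_norm, h3]
  · rw [← GaussianInt.abs_natCast_norm, h4]

/-- Multiplication of pairs covers all elements of norm mn. Pairs differing by units are
overcounted, which does no harm to an upper bound. -/
theorem r2_mul_le {m n : ℕ} (h : m.Coprime n) (hm : m ≠ 0) (hn : n ≠ 0) :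
    r2 (m * n) ≤ r2 m * r2 n := by
  simp only [r2_eq_gaussian]
  have hsub : {z : GaussianInt | z.norm = (m * n : ℕ)} ⊆
      (fun p : GaussianInt × GaussianInt => p.1 * p.2) ''
        ({z : GaussianInt | z.norm = m} ×ˢ {z : GaussianInt | z.norm = n}) := by
    intro z hz
    obtain ⟨a, b, ha, hb, rfl⟩ := exists_mul_of_norm_eq_mul h hm hn hz
    exact ⟨(a, b), ⟨ha, hb⟩, rfl⟩
  have hfin := (finite_gaussian_norm_eq m).prod (finite_gaussian_norm_eq n)
  calc _ ≤ _ := Set.ncard_le_ncard hsub (hfin.image _)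
    _ ≤ _ := Set.ncard_image_le hfin
    _ = _ := Set.ncard_prod

theorem prime_of_norm_eq_prime {p : ℕ} (hp : p.Prime) {w : GaussianInt} (hw : w.norm = p) :
    Prime w := by
  rw [← irreducible_iff_prime]
  refine ⟨fun hu => ?_, fun {x y} hxy => ?_⟩
  · have := Zsqrtd.norm_eq_one_iff.2 hu
    rw [hw, Int.natAbs_natCast] at this
    exact hp.one_lt.ne' this
  · have h : x.norm.natAbs * y.norm.natAbs = p := by
      rw [← Int.natAbs_mul, ← Zsqrtd.norm_mul, ← hxy, hw, Int.natAbs_natCast]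
    rcases (Nat.prime_mul_iff.1 (h ▸ hp)) with h | h
    · exact Or.inr (Zsqrtd.norm_eq_one_iff.1 h.2)
    · exact Or.inl (Zsqrtd.norm_eq_one_iff.1 h.2)

/-- A rational prime is, in the Gaussian integers, either prime or a product of two primes. -/
theorem natCast_prime_or_eq_mul {p : ℕ} (hp : p.Prime) :
    Prime (p : GaussianInt) ∨ ∃ a b : GaussianInt, Prime a ∧ Prime b ∧ (p : GaussianInt) = a * b := by
  have := Fact.mk hp
  by_cases hirr : Irreducible (p : GaussianInt)
  · exact Or.inl (irreducible_iff_prime.1 hirr)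
  · obtain ⟨a, b, hab⟩ := GaussianInt.sq_add_sq_of_nat_prime_of_not_irreducible p hirr
    have hab' : (a : ℤ) * a + b * b = p := by
      exact_mod_cast (by nlinarith [hab] : a * a + b * b = p)
    refine Or.inr ⟨⟨a, b⟩, ⟨a, -b⟩, prime_of_norm_eq_prime hp ?_, prime_of_norm_eq_prime hp ?_, ?_⟩
    · simp only [Zsqrtd.norm_def]; linarith
    · simp only [Zsqrtd.norm_def]; linarith
    · ext
      · simp only [Zsqrtd.re_mul, Zsqrtd.re_natCast]; linarith
      · simp only [Zsqrtd.im_mul, Zsqrtd.im_natCast]; ring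

/-- The prime p has at most two Gaussian prime factors, so a divisor of p^a is fixed by a unit and
two exponents. For inert p the second factor is taken to be 1. -/
theorem dvd_natCast_pow_form {p : ℕ} (hp : p.Prime) (a : ℕ) :
    ∃ w₁ w₂ : GaussianInt, ∀ z : GaussianInt, z ∣ (p : GaussianInt) ^ a →
      ∃ u : GaussianInt, IsUnit u ∧ ∃ i ≤ a, ∃ j ≤ a, z = u * (w₁ ^ i * w₂ ^ j) := by
  rcases natCast_prime_or_eq_mul hp with h | ⟨x, y, hx, hy, hxy⟩
  · refine ⟨p, 1, fun z hz => ?_⟩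
    obtain ⟨i, hi, u, hu⟩ := (dvd_prime_pow h a).1 hz
    refine ⟨↑u⁻¹, Units.isUnit _, i, hi, 0, Nat.zero_le _, ?_⟩
    rw [← hu]
    simp [mul_comm]
  · refine ⟨x, y, fun z hz => ?_⟩
    rw [hxy, mul_pow] at hz
    obtain ⟨s, t, hs, ht, rfl⟩ := exists_dvd_and_dvd_of_dvd_mul hz
    obtain ⟨i, hi, u, hu⟩ := (dvd_prime_pow hx a).1 hs
    obtain ⟨j, hj, v, hv⟩ := (dvd_prime_pow hy a).1 ht
    refine ⟨↑(u⁻¹ * v⁻¹), Units.isUnit _, i, hi, j, hj, ?_⟩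
    rw [← hu, ← hv]
    have : (↑(u⁻¹ * v⁻¹) : GaussianInt) * (s * ↑u * (t * ↑v)) =
        (↑u⁻¹ * ↑u) * (↑v⁻¹ * ↑v) * (s * t) := by push_cast; ring
    rw [this]; simp

/-- Elements of norm p^a divide p^a, so they are counted by a unit (there are `r2 1` of them) and
two exponents at most a. -/
theorem r2_prime_pow_le {p : ℕ} (hp : p.Prime) (a : ℕ) : r2 (p ^ a) ≤ r2 1 * (a + 1) ^ 2 := by
  obtain ⟨w₁, w₂, hw⟩ := dvd_natCast_pow_form hp a
  simp only [r2_eq_gaussian]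
  have hsub : {z : GaussianInt | z.norm = (p ^ a : ℕ)} ⊆
      (fun q : GaussianInt × (ℕ × ℕ) => q.1 * (w₁ ^ q.2.1 * w₂ ^ q.2.2)) ''
        ({z : GaussianInt | z.norm = (1 : ℕ)} ×ˢ
          ((↑(range (a + 1)) : Set ℕ) ×ˢ (↑(range (a + 1)) : Set ℕ))) := by
    intro z hz
    have hdvd : z ∣ (p : GaussianInt) ^ a := by
      refine ⟨star z, ?_⟩
      rw [← Zsqrtd.norm_eq_mul_conj, hz]
      push_cast
      rfl
    obtain ⟨u, hu, i, hi, j, hj, rfl⟩ := hw z hdvd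
    refine ⟨(u, (i, j)), ⟨?_, ?_, ?_⟩, rfl⟩
    · have := Zsqrtd.norm_eq_one_iff.2 hu
      simp only [Set.mem_ofPred_eq]
      rw [← GaussianInt.abs_natCast_norm, this]
    · simpa using hi
    · simpa using hj
  have hfin := (finite_gaussian_norm_eq 1).prod
    ((range (a + 1)).finite_toSet.prod (range (a + 1)).finite_toSet)
  calc _ ≤ _ := Set.ncard_le_ncard hsub (hfin.image _)
    _ ≤ _ := Set.ncard_image_le hfin
    _ = _ := by rw [Set.ncard_prod, Set.ncard_prod, Set.ncard_coe_finset, card_range]; ring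

theorem one_le_r2_one : 1 ≤ r2 1 := by
  exact Nat.succ_le_of_lt ((Set.ncard_pos (finite_sq_add_sq_eq 1)).2 ⟨(1, 0), by simp⟩)

theorem succ_sq_le_rpow {η : ℝ} (hη : 0 < η) :
    ∃ B : ℝ, 1 ≤ B ∧ ∀ a : ℕ, ((a : ℝ) + 1) ^ 2 ≤ B * (2 : ℝ) ^ (a * η) := by
  -- With this t one has 2^(aη) = exp(at)², and exp(at) ≥ 1 + at ≥ c(a + 1) for c = min(1, t).
  set t := η * Real.log 2 / 2 with ht
  have htpos : 0 < t := by have := Real.log_pos one_lt_two; positivity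
  set c := min 1 t with hc
  have hcpos : 0 < c := lt_min one_pos htpos
  refine ⟨1 / c ^ 2, ?_, fun a => ?_⟩
  · rw [le_div_iff₀ (by positivity)]
    have : c ≤ 1 := min_le_left _ _
    nlinarith
  · have h1 : (2 : ℝ) ^ (a * η) = Real.exp (a * t) ^ 2 := by
      rw [Real.rpow_def_of_pos two_pos, ← Real.exp_nat_mul]
      congr 1
      rw [ht]; push_cast; ring
    have h2 : a * t + 1 ≤ Real.exp (a * t) := Real.add_one_le_exp _
    have h3 : c * (a + 1) ≤ a * t + 1 := by
      have h4 : c ≤ 1 := min_le_left _ _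
      have h5 : c ≤ t := min_le_right _ _
      have : (0 : ℝ) ≤ a := Nat.cast_nonneg a
      nlinarith
    rw [h1, div_mul_eq_mul_div, one_mul, le_div_iff₀ (by positivity), ← mul_pow]
    have : (0 : ℝ) ≤ a := Nat.cast_nonneg a
    have h6 : ((a : ℝ) + 1) * c ≤ Real.exp (a * t) := by linarith
    exact pow_le_pow_left₀ (by positivity) h6 2

/-- The bound `r₂(m) ≪ m^δ`. -/
theorem exists_r2_le_rpow {δ : ℝ} (hδ : 0 < δ) :
    ∃ C : ℝ, 0 < C ∧ ∀ m : ℕ, 1 ≤ m → (r2 m : ℝ) ≤ C * (m : ℝ) ^ δ := by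
  obtain ⟨B₀, hB₀, hB⟩ := succ_sq_le_rpow hδ
  set c : ℝ := (r2 1 : ℝ) with hc
  have hc1 : 1 ≤ c := by rw [hc]; exact_mod_cast one_le_r2_one
  -- Beyond P one has 4c ≤ p^δ, which absorbs c(a + 1)² ≤ (4c)^a entirely. Only the boundedly many
  -- primes up to P cost a factor B.
  obtain ⟨P, hP⟩ := exists_nat_ge ((4 * c) ^ (1 / δ))
  have hPp : ∀ p : ℕ, P < p → 4 * c ≤ (p : ℝ) ^ δ := by
    intro p hp
    calc 4 * c = ((4 * c) ^ (1 / δ)) ^ δ := by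
          rw [← Real.rpow_mul (by positivity), one_div_mul_cancel hδ.ne', Real.rpow_one]
      _ ≤ (p : ℝ) ^ δ := by
          apply Real.rpow_le_rpow (by positivity) _ hδ.le
          exact hP.trans (by exact_mod_cast hp.le)
  set B : ℝ := c * B₀ with hBdef
  have hB1 : 1 ≤ B := one_le_mul_of_one_le_of_one_le hc1 hB₀
  have hprime : ∀ (p a : ℕ), p.Prime → (r2 (p ^ a) : ℝ) ≤ c * ((a : ℝ) + 1) ^ 2 := by
    intro p a hp
    rw [hc]; exact_mod_cast r2_prime_pow_le hp a
  have hsmall : ∀ (p a : ℕ), p.Prime → (r2 (p ^ a) : ℝ) ≤ B * ((p ^ a : ℕ) : ℝ) ^ δ := by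
    intro p a hp
    refine (hprime p a hp).trans ?_
    rw [hBdef, mul_assoc]
    refine mul_le_mul_of_nonneg_left ((hB a).trans ?_) (by positivity)
    refine mul_le_mul_of_nonneg_left ?_ (by positivity)
    rw [Real.rpow_mul two_pos.le]
    refine Real.rpow_le_rpow (by positivity) ?_ hδ.le
    push_cast
    rw [Real.rpow_natCast]
    exact pow_le_pow_left₀ two_pos.le (by exact_mod_cast hp.two_le) a
  have hlarge : ∀ (p a : ℕ), p.Prime → 0 < a → P < p → (r2 (p ^ a) : ℝ) ≤ ((p ^ a : ℕ) : ℝ) ^ δ := by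
    intro p a hp ha hPlt
    refine (hprime p a hp).trans ?_
    have h4 : ∀ a : ℕ, ((a : ℝ) + 1) ^ 2 ≤ 4 ^ a := by
      intro a
      induction a with
      | zero => norm_num
      | succ k ih =>
        rw [pow_succ (4 : ℝ)]
        push_cast
        have : (0 : ℝ) ≤ k := Nat.cast_nonneg k
        nlinarith
    have hca : c ≤ c ^ a := le_self_pow₀ hc1 ha.ne'
    calc c * ((a : ℝ) + 1) ^ 2 ≤ c ^ a * 4 ^ a := by
          exact mul_le_mul hca (h4 a) (by positivity) (by positivity)
      _ = (4 * c) ^ a := by rw [mul_pow, mul_comm]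
      _ ≤ ((p : ℝ) ^ δ) ^ a := pow_le_pow_left₀ (by positivity) (hPp p hPlt) a
      _ = ((p ^ a : ℕ) : ℝ) ^ δ := by
          push_cast
          rw [← Real.rpow_natCast, ← Real.rpow_natCast, ← Real.rpow_mul (by positivity),
            ← Real.rpow_mul (by positivity), mul_comm]
  -- The value m = 1 is left out: it has no prime factor, so the right side would be 1, while r₂(1)
  -- counts the units.
  have main : ∀ m : ℕ, 1 < m →
      (r2 m : ℝ) ≤ B ^ (#{p ∈ m.primeFactors | p ≤ P}) * (m : ℝ) ^ δ := by
    intro m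
    induction m using Nat.recOnPosPrimePosCoprime with
    | zero => intro h; omega
    | one => intro h; omega
    | prime_pow p n hp hn =>
      intro _
      rw [Nat.primeFactors_prime_pow hn.ne' hp]
      by_cases hpP : p ≤ P
      · rw [filter_singleton, if_pos hpP, card_singleton, pow_one]
        exact hsmall p n hp
      · rw [filter_singleton, if_neg hpP, card_empty, pow_zero, one_mul]
        exact hlarge p n hp hn (not_le.1 hpP)
    | coprime a b ha hb hab iha ihb =>
      intro _
      rw [hab.primeFactors_mul, filter_union, card_union_of_disjoint, pow_add]
      · have h1 : (r2 (a * b) : ℝ) ≤ r2 a * r2 b := by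
          exact_mod_cast r2_mul_le hab (by omega) (by omega)
        refine h1.trans ((mul_le_mul (iha ha) (ihb hb) (by positivity) (by positivity)).trans ?_)
        push_cast
        rw [Real.mul_rpow (by positivity) (by positivity)]
        exact le_of_eq (by ring)
      · exact disjoint_filter_filter hab.disjoint_primeFactors
  refine ⟨c * B ^ (P + 1), by positivity, fun m hm => ?_⟩
  rcases hm.eq_or_lt with rfl | hm
  · have : (1 : ℝ) ≤ B ^ (P + 1) := one_le_pow₀ hB1
    simp only [Nat.cast_one, Real.one_rpow, mul_one]
    exact le_mul_of_one_le_right (by positivity) this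
  · refine (main m hm).trans (mul_le_mul_of_nonneg_right ?_ (by positivity))
    have hcard : #{p ∈ m.primeFactors | p ≤ P} ≤ P + 1 := by
      refine (card_le_card (t := range (P + 1)) fun p hp => ?_).trans (card_range _).le
      rw [mem_filter] at hp
      exact mem_range.2 (by omega)
    calc B ^ _ ≤ B ^ (P + 1) := pow_le_pow_right₀ hB1 hcard
      _ ≤ c * B ^ (P + 1) := le_mul_of_one_le_left (by positivity) hc1

end RepresentationCount

end CyganKoranyi

namespace CyganKoranyi

open MeasureTheory Set FourierTransform

/-! ### Grouping ℤ² by squared length -/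

section LatticeGrouping

/-- The squared length of an integer vector in the plane. -/
def normSqNat (n : Fin 2 → ℤ) : ℕ := (n 0 ^ 2 + n 1 ^ 2).toNat

theorem normSqNat_cast (n : Fin 2 → ℤ) : (normSqNat n : ℝ) = (n 0 : ℝ) ^ 2 + (n 1 : ℝ) ^ 2 := by
  have h : ((normSqNat n : ℤ)) = n 0 ^ 2 + n 1 ^ 2 := Int.toNat_of_nonneg (by positivity)
  exact_mod_cast h

/-- The integer vectors of squared length `m`, as pairs of integers. -/
def fiberNormSqNatEquiv (m : ℕ) :
    {n : Fin 2 → ℤ // normSqNat n = m} ≃ {p : ℤ × ℤ | p.1 ^ 2 + p.2 ^ 2 = (m : ℤ)} :=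
  (finTwoArrowEquiv ℤ).subtypeEquiv fun n => by
    simp only [normSqNat, finTwoArrowEquiv_apply]
    show _ ↔ n 0 ^ 2 + n 1 ^ 2 = (m : ℤ)
    have : 0 ≤ n 0 ^ 2 + n 1 ^ 2 := by positivity
    omega

theorem card_fiber_normSqNat (m : ℕ) : Nat.card {n : Fin 2 → ℤ // normSqNat n = m} = r2 m := by
  rw [r2, ← Nat.card_coe_set_eq]
  exact Nat.card_congr (fiberNormSqNatEquiv m)

theorem finite_fiber_normSqNat (m : ℕ) : Finite {n : Fin 2 → ℤ // normSqNat n = m} := by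
  have : Finite {p : ℤ × ℤ | p.1 ^ 2 + p.2 ^ 2 = (m : ℤ)} := finite_sq_add_sq_eq m
  exact Finite.of_equiv _ (fiberNormSqNatEquiv m).symm

/-- The circle of squared radius m carries r₂(m) lattice points, and absolute convergence permits
summation circle by circle. -/
theorem hasSum_comp_normSqNat {φ : ℕ → ℂ} (h : Summable fun m => (r2 m : ℝ) * ‖φ m‖) :
    HasSum (fun n => φ (normSqNat n)) (∑' m, (r2 m : ℂ) * φ m) := by
  have hfib : ∀ (m : ℕ) {E : Type} [NormedAddCommGroup E] [NormedSpace ℝ E] (c : E),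
      HasSum (fun _ : {n : Fin 2 → ℤ // normSqNat n = m} => c) (r2 m • c) := by
    intro m E _ _ c
    have := finite_fiber_normSqNat m
    have := Fintype.ofFinite {n : Fin 2 → ℤ // normSqNat n = m}
    have h := hasSum_fintype (fun _ : {n : Fin 2 → ℤ // normSqNat n = m} => c)
    rwa [Finset.sum_const, Finset.card_univ, ← Nat.card_eq_fintype_card, card_fiber_normSqNat] at h
  rw [← (Equiv.sigmaFiberEquiv normSqNat).hasSum_iff]
  have hval : ((fun n => φ (normSqNat n)) ∘ (Equiv.sigmaFiberEquiv normSqNat)) =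
      fun q : (Σ m, {n : Fin 2 → ℤ // normSqNat n = m}) => φ q.1 := by
    funext ⟨m, n, hn⟩
    simp [hn]
  rw [hval]
  have hnorm : Summable fun q : (Σ m, {n : Fin 2 → ℤ // normSqNat n = m}) => ‖φ q.1‖ := by
    rw [summable_sigma_of_nonneg fun _ => norm_nonneg _]
    refine ⟨fun m => (hfib m ‖φ m‖).summable, ?_⟩
    refine h.congr fun m => ?_
    rw [(hfib m ‖φ m‖).tsum_eq, nsmul_eq_mul]
  have hs : Summable fun m => (r2 m : ℂ) * φ m := by
    refine Summable.of_norm (h.congr fun m => ?_)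
    rw [norm_mul, Complex.norm_natCast]
  refine HasSum.sigma_of_hasSum hs.hasSum (fun m => ?_) hnorm.of_norm
  simpa [nsmul_eq_mul] using hfib m (φ m)

end LatticeGrouping

/-! ### Fourier transforms of radial functions and radial Poisson summation -/

section RadialFourier

/-- The Fourier transform of the radial function `z ↦ G (|z|²)` on the plane, as a function of
the modulus of the frequency. -/
noncomputable def radialFourier (G : ℝ → ℝ) (r : ℝ) : ℝ :=
  ∫ s : ℝ, (∫ u : ℝ, G (s ^ 2 + u ^ 2)) * Real.cos (2 * Real.pi * r * s)

variable {G : ℝ → ℝ} {R : ℝ}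

theorem hasCompactSupport_radial (hR : ∀ t, R ≤ t → G t = 0) :
    HasCompactSupport (fun p : ℝ × ℝ => G (p.1 ^ 2 + p.2 ^ 2)) := by
  refine HasCompactSupport.of_support_subset_isCompact
    ((isCompact_Icc (a := -(|R| + 1)) (b := |R| + 1)).prod (isCompact_Icc (a := -(|R| + 1)) (b := |R| + 1))) ?_
  rintro ⟨s, u⟩ h
  have h' : s ^ 2 + u ^ 2 < R := by
    by_contra hc
    exact h (hR _ (not_lt.1 hc))
  have h0 : R ≤ |R| := le_abs_self R
  have hp : 0 ≤ |R| := abs_nonneg R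
  have h1 : |s| ≤ |R| + 1 := abs_le_of_sq_le_sq (by nlinarith [sq_nonneg u]) (by linarith)
  have h2 : |u| ≤ |R| + 1 := abs_le_of_sq_le_sq (by nlinarith [sq_nonneg s]) (by linarith)
  exact ⟨abs_le.1 h1, abs_le.1 h2⟩

theorem integrable_radial (hG : Continuous G) (hR : ∀ t, R ≤ t → G t = 0) :
    Integrable (fun p : ℝ × ℝ => G (p.1 ^ 2 + p.2 ^ 2)) :=
  (by fun_prop : Continuous _).integrable_of_hasCompactSupport (hasCompactSupport_radial hR)

/-- The planar function with radial profile `G`. -/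
noncomputable def radial (G : ℝ → ℝ) (z : ℂ) : ℂ := (G (Complex.normSq z) : ℂ)

/-- At a real frequency the phase depends on the real coordinate alone, so Fubini integrates out the
other one first; the sine part is odd and vanishes. -/
theorem fourier_radial_real (hG : Continuous G) (hR : ∀ t, R ≤ t → G t = 0) (r : ℝ) :
    𝓕 (radial G) (r : ℂ) = (radialFourier G r : ℂ) := by
  have hint := integrable_radial hG hR
  rw [Real.fourier_eq']
  rw [← Complex.volume_preserving_equiv_real_prod.symm.integral_comp
    Complex.measurableEquivRealProd.symm.measurableEmbedding]
  have hval : ∀ p : ℝ × ℝ, Complex.exp (↑(-2 * Real.pi * inner ℝ (Complex.measurableEquivRealProd.symm p) (r : ℂ)) * Complex.I) •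
      radial G (Complex.measurableEquivRealProd.symm p) =
      Complex.exp (((-2 * Real.pi * r * p.1 : ℝ) : ℂ) * Complex.I) * ((G (p.1 ^ 2 + p.2 ^ 2) : ℝ) : ℂ) := by
    rintro ⟨s, u⟩
    have : Complex.measurableEquivRealProd.symm (s, u) = ⟨s, u⟩ := rfl
    rw [this, smul_eq_mul]
    congr 2
    · congr 2
      simp [Complex.inner]
      ring
    · simp [radial, Complex.normSq_apply, sq]
  simp_rw [hval]
  have hint2 : Integrable (fun p : ℝ × ℝ => Complex.exp (((-2 * Real.pi * r * p.1 : ℝ) : ℂ) * Complex.I) *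
      ((G (p.1 ^ 2 + p.2 ^ 2) : ℝ) : ℂ)) := by
    refine hint.ofReal.bdd_mul (c := 1) (by fun_prop) (Filter.Eventually.of_forall fun p => ?_)
    rw [Complex.norm_exp_ofReal_mul_I]
  rw [show (volume : Measure (ℝ × ℝ)) = volume.prod volume from rfl] at hint2 hint ⊢
  rw [integral_prod _ hint2]
  set P : ℝ → ℝ := fun s => ∫ u, G (s ^ 2 + u ^ 2) with hP
  have hPint : Integrable P := hint.integral_prod_left
  have hinner : ∀ s : ℝ, ∫ u : ℝ, Complex.exp (((-2 * Real.pi * r * s : ℝ) : ℂ) * Complex.I) *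
      ((G (s ^ 2 + u ^ 2) : ℝ) : ℂ) = ((P s * Real.cos (2 * Real.pi * r * s) : ℝ) : ℂ) +
        ((-(P s * Real.sin (2 * Real.pi * r * s)) : ℝ) : ℂ) * Complex.I := by
    intro s
    rw [integral_const_mul, integral_complex_ofReal, Complex.exp_mul_I]
    rw [← Complex.ofReal_cos, ← Complex.ofReal_sin]
    have e : -2 * Real.pi * r * s = -(2 * Real.pi * r * s) := by ring
    rw [e, Real.cos_neg, Real.sin_neg, hP]
    push_cast
    ring
  simp only [hinner]
  have hc : Integrable (fun s => P s * Real.cos (2 * Real.pi * r * s)) :=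
    hPint.mul_bdd (c := 1) (by fun_prop) (Filter.Eventually.of_forall fun s => Real.abs_cos_le_one _)
  have hsn : Integrable (fun s => -(P s * Real.sin (2 * Real.pi * r * s))) :=
    (hPint.mul_bdd (c := 1) (by fun_prop) (Filter.Eventually.of_forall fun s => Real.abs_sin_le_one _)).neg
  rw [integral_add hc.ofReal (hsn.ofReal.mul_const _), integral_mul_const, integral_complex_ofReal,
    integral_complex_ofReal]
  have hodd : ∫ s, -(P s * Real.sin (2 * Real.pi * r * s)) = 0 := by
    have h := integral_neg_eq_self (fun s => -(P s * Real.sin (2 * Real.pi * r * s))) volume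
    have h2 : ∀ s, -(P (-s) * Real.sin (2 * Real.pi * r * -s)) = -(-(P s * Real.sin (2 * Real.pi * r * s))) := by
      intro s
      simp only [hP, mul_neg, Real.sin_neg, neg_sq]
    simp only [h2] at h
    rw [integral_neg] at h
    linarith
  rw [hodd]
  simp [radialFourier, hP]

/-- The function is rotation invariant, and the rotation by w/‖w‖ carries the real frequency ‖w‖ to
w. -/
theorem fourier_radial (hG : Continuous G) (hR : ∀ t, R ≤ t → G t = 0) (w : ℂ) :
    𝓕 (radial G) w = (radialFourier G ‖w‖ : ℂ) := by
  rw [← fourier_radial_real hG hR]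
  rcases eq_or_ne w 0 with rfl | hw
  · simp
  · set u : Circle := ⟨w / ‖w‖, by simp [Submonoid.unitSphere, hw]⟩ with hu
    have h := Real.fourier_comp_linearIsometry (rotation u) (radial G) ((‖w‖ : ℝ) : ℂ)
    have h1 : radial G ∘ rotation u = radial G := by
      funext z
      simp [radial, Complex.normSq_mul, rotation_apply]
    rw [h1] at h
    rw [h, rotation_apply, hu]
    have : (‖w‖ : ℂ) ≠ 0 := by simpa using hw
    field_simp

/-- Poisson summation for radial functions in the plane. -/
theorem radial_poisson (hG : Continuous G) (hR : ∀ t, R ≤ t → G t = 0)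
    (hs : Summable fun m : ℕ => (r2 m : ℝ) * |radialFourier G (√m)|) :
    ∑' m : ℕ, (r2 m : ℝ) * G m = ∑' m : ℕ, (r2 m : ℝ) * radialFourier G (√m) := by
  set f : (Fin 2 → ℝ) → ℂ := fun x => (G (x 0 ^ 2 + x 1 ^ 2) : ℂ) with hf
  have hfc : Continuous f := by fun_prop
  have hcs : HasCompactSupport f := by
    have h1 : HasCompactSupport (fun x : Fin 2 → ℝ => G (x 0 ^ 2 + x 1 ^ 2)) :=
      (hasCompactSupport_radial hR).comp_homeomorph Homeomorph.finTwoArrow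
    exact h1.comp_left (g := fun t : ℝ => (t : ℂ)) Complex.ofReal_zero
  have hcoeff : ∀ n : Fin 2 → ℤ,
      ∫ x : Fin 2 → ℝ, Complex.exp (-(2 * Real.pi * ∑ i, (n i : ℝ) * x i : ℝ) * Complex.I) * f x =
        (radialFourier G (√(normSqNat n)) : ℂ) := by
    intro n
    set w : ℂ := ⟨n 0, n 1⟩ with hw
    have hwn : ‖w‖ = √(normSqNat n) := by
      rw [normSqNat_cast, Complex.norm_def, Complex.normSq_apply, sq, sq]
    -- The coordinate plane is identified with ℂ, where the transform was computed.
    rw [← hwn, ← fourier_radial hG hR, Real.fourier_eq',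
      ← Complex.volume_preserving_equiv_pi.symm.integral_comp
        Complex.measurableEquivPi.symm.measurableEmbedding]
    refine integral_congr_ae (Filter.Eventually.of_forall fun x => ?_)
    have hx : Complex.measurableEquivPi.symm x = ⟨x 0, x 1⟩ := by
      apply Complex.ext <;> simp [Complex.measurableEquivPi]
    simp only [hx, smul_eq_mul, radial, Complex.normSq_apply, hf, ← sq]
    congr 2
    simp [Complex.inner, hw, Fin.sum_univ_two]
  have hsummable : Summable fun n : Fin 2 → ℤ => (radialFourier G (√(normSqNat n)) : ℂ) := by
    refine (hasSum_comp_normSqNat (φ := fun m => (radialFourier G (√m) : ℂ)) ?_).summable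
    simpa using hs
  have hP := tsum_intVec_eq hfc hcs (by simpa only [hcoeff] using hsummable)
  simp only [hcoeff] at hP
  have h1 := hasSum_comp_normSqNat (φ := fun m => (radialFourier G (√m) : ℂ)) (by simpa using hs)
  have h2 : HasSum (fun n => ((G (normSqNat n) : ℝ) : ℂ)) (∑' m : ℕ, (r2 m : ℂ) * ((G m : ℝ) : ℂ)) := by
    refine hasSum_comp_normSqNat (φ := fun m => ((G m : ℝ) : ℂ)) ?_
    refine summable_of_ne_finset_zero (s := Finset.range (⌈R⌉₊)) fun m hm => ?_
    rw [hR m (Nat.le_of_ceil_le (by simpa using hm))]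
    simp
  have h3 : (∑' z : Fin 2 → ℤ, f (intVec z)) = ∑' m : ℕ, (r2 m : ℂ) * ((G m : ℝ) : ℂ) := by
    rw [← h2.tsum_eq]
    refine tsum_congr fun z => ?_
    simp only [hf, intVec, normSqNat_cast]
  rw [h3] at hP
  have := hP.unique h1
  exact_mod_cast this

end RadialFourier

end CyganKoranyi

namespace CyganKoranyi

open MeasureTheory Set FourierTransform

/-! ### Explicit transforms of truncated powers -/

section PowerProfile

/-- The truncated power `w₊ ^ α`. -/
noncomputable def truncPow (α w : ℝ) : ℝ := (max w 0) ^ α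

theorem continuous_truncPow {α : ℝ} (hα : 0 < α) : Continuous (truncPow α) :=
  (continuous_id.max continuous_const).rpow_const fun _ => Or.inr hα.le

theorem truncPow_of_nonpos {α w : ℝ} (hα : 0 < α) (hw : w ≤ 0) : truncPow α w = 0 := by
  rw [truncPow, max_eq_right hw, Real.zero_rpow hα.ne']

theorem truncPow_of_nonneg (α : ℝ) {w : ℝ} (hw : 0 ≤ w) : truncPow α w = w ^ α := by
  rw [truncPow, max_eq_left hw]

theorem truncPow_half (w : ℝ) : truncPow (1 / 2) w = √w := by
  rcases le_total 0 w with h | h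
  · rw [truncPow_of_nonneg _ h, Real.sqrt_eq_rpow]
  · rw [truncPow_of_nonpos (by norm_num) h, Real.sqrt_eq_zero_of_nonpos h]

/-- The constant in the integral of a truncated power along a line. -/
noncomputable def truncPowConst (α : ℝ) : ℝ := ∫ v : ℝ, truncPow α (1 - v ^ 2)

/-- The substitution u = √w·v: integration along a line raises the exponent by 1/2. -/
theorem integral_truncPow_sub_sq {α : ℝ} (hα : 0 < α) (w : ℝ) :
    ∫ u : ℝ, truncPow α (w - u ^ 2) = truncPowConst α * truncPow (α + 1 / 2) w := by
  rcases le_or_gt w 0 with hw | hw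
  · rw [truncPow_of_nonpos (by linarith) hw, mul_zero]
    have : ∀ u : ℝ, truncPow α (w - u ^ 2) = 0 := fun u =>
      truncPow_of_nonpos hα (by nlinarith [sq_nonneg u])
    simp [this]
  · have h := Measure.integral_comp_mul_left (fun u : ℝ => truncPow α (w - u ^ 2)) (√w)
    have hsq : √w ^ 2 = w := Real.sq_sqrt hw.le
    have hpos : 0 < √w := Real.sqrt_pos.2 hw
    have h2 : ∀ v : ℝ, truncPow α (w - (√w * v) ^ 2) = w ^ α * truncPow α (1 - v ^ 2) := by
      intro v
      rw [mul_pow, hsq, show w - w * v ^ 2 = w * (1 - v ^ 2) by ring]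
      rw [truncPow, truncPow, ← Real.mul_rpow hw.le (le_max_right _ _)]
      rw [mul_max_of_nonneg _ _ hw.le, mul_zero]
    simp only [h2] at h
    rw [integral_const_mul, abs_of_pos (inv_pos.2 hpos), smul_eq_mul] at h
    rw [truncPow_of_nonneg _ hw.le, Real.rpow_add hw, ← Real.sqrt_eq_rpow, truncPowConst]
    field_simp at h
    linarith

theorem truncPowConst_half : truncPowConst (1 / 2) = Real.pi / 2 := by
  rw [truncPowConst, ← integral_sqrt_one_sub_sq, intervalIntegral.integral_of_le (by norm_num)]
  rw [setIntegral_eq_integral_of_forall_compl_eq_zero]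
  · simp only [truncPow_half]
  · intro x hx
    apply Real.sqrt_eq_zero_of_nonpos
    by_contra h
    have : x ^ 2 < 1 := by linarith
    have := abs_lt.1 ((sq_lt_one_iff_abs_lt_one x).1 this)
    exact hx ⟨this.1, this.2.le⟩

/-- For half-integral α the exponent α + 1/2 is an integer, so the planar transform becomes the
cosine integral of a polynomial and no Bessel function appears. -/
theorem radialFourier_truncPow {α : ℝ} (hα : 0 < α) {t : ℝ} (ht : 0 ≤ t) (r : ℝ) :
    radialFourier (fun n => truncPow α (t ^ 2 - n)) r =
      truncPowConst α * ∫ s in (-t)..t, (t ^ 2 - s ^ 2) ^ (α + 1 / 2) * Real.cos (2 * Real.pi * r * s) := by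
  have h1 : ∀ s : ℝ, ∫ u : ℝ, truncPow α (t ^ 2 - (s ^ 2 + u ^ 2)) =
      truncPowConst α * truncPow (α + 1 / 2) (t ^ 2 - s ^ 2) := by
    intro s
    rw [← integral_truncPow_sub_sq hα]
    simp [sub_sub]
  simp only [radialFourier, h1, mul_assoc]
  rw [integral_const_mul, intervalIntegral.integral_of_le (by linarith)]
  congr 1
  rw [← setIntegral_eq_integral_of_forall_compl_eq_zero (s := Ioc (-t) t)]
  · refine setIntegral_congr_fun measurableSet_Ioc fun s hs => ?_
    rw [truncPow_of_nonneg]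
    nlinarith [hs.1, hs.2]
  · intro s hs
    rw [truncPow_of_nonpos (by linarith), zero_mul]
    by_contra h
    have := abs_lt_of_sq_lt_sq (by linarith : s ^ 2 < t ^ 2) ht
    exact hs ⟨(abs_lt.1 this).1, (abs_lt.1 this).2.le⟩

/-- The explicit planar Fourier transform of `√(t² - |z|²)`. -/
theorem radialFourier_sqrt {t r : ℝ} (ht : 0 ≤ t) (hr : 0 < r) :
    radialFourier (fun n => √(t ^ 2 - n)) r =
      -(t * Real.cos (2 * Real.pi * r * t)) / (2 * Real.pi * r ^ 2) +
        Real.sin (2 * Real.pi * r * t) / (4 * Real.pi ^ 2 * r ^ 3) := by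
  have h := radialFourier_truncPow (α := 1 / 2) (by norm_num) ht r
  simp only [truncPow_half, truncPowConst_half] at h
  rw [h]
  set k := 2 * Real.pi * r with hk
  have hkpos : 0 < k := by have := Real.pi_pos; positivity
  -- The primitive comes from repeated integration by parts; its first term vanishes at s = ±t,
  -- which is why the leading term decays like r⁻².
  have hd : ∀ s : ℝ, HasDerivAt (fun s : ℝ => (t ^ 2 - s ^ 2) * Real.sin (k * s) / k
      - 2 * s * Real.cos (k * s) / k ^ 2 + 2 * Real.sin (k * s) / k ^ 3)
      ((t ^ 2 - s ^ 2) ^ ((1 : ℝ) / 2 + 1 / 2) * Real.cos (k * s)) s := by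
    intro s
    have hks : HasDerivAt (fun s : ℝ => k * s) k s := by simpa using (hasDerivAt_id s).const_mul k
    have hsq : HasDerivAt (fun s : ℝ => t ^ 2 - s ^ 2) (-(2 * s)) s := by
      simpa using (hasDerivAt_pow 2 s).const_sub (t ^ 2)
    have h2 : HasDerivAt (fun s : ℝ => 2 * s) 2 s := by simpa using (hasDerivAt_id s).const_mul (2 : ℝ)
    have := (((hsq.mul hks.sin).div_const k).sub ((h2.mul hks.cos).div_const (k ^ 2))).add
      ((hks.sin.const_mul 2).div_const (k ^ 3))
    refine this.congr_deriv ?_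
    norm_num
    field_simp
    ring
  rw [intervalIntegral.integral_eq_sub_of_hasDerivAt (fun s _ => hd s)]
  · simp only [mul_neg, Real.sin_neg, Real.cos_neg, neg_sq]
    rw [hk]
    have := Real.pi_pos
    field_simp
    ring
  · apply Continuous.intervalIntegrable
    norm_num
    fun_prop

theorem radialFourier_sqrt_zero {t : ℝ} (ht : 0 ≤ t) :
    radialFourier (fun n => √(t ^ 2 - n)) 0 = 2 * Real.pi / 3 * t ^ 3 := by
  have h := radialFourier_truncPow (α := 1 / 2) (by norm_num) ht 0
  simp only [truncPow_half, truncPowConst_half] at h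
  rw [h]
  norm_num
  ring

/-- Integration by parts three times: double zeros at ±1 kill the boundary terms of orders 1/k and
1/k², and what remains carries 1/k³. -/
theorem abs_integral_polynomial_cos_le (p : Polynomial ℝ) (h1 : p.eval 1 = 0) (h2 : p.eval (-1) = 0)
    (h3 : p.derivative.eval 1 = 0) (h4 : p.derivative.eval (-1) = 0) :
    ∃ C : ℝ, 0 ≤ C ∧ ∀ k : ℝ, 0 < k → |∫ s in (-1 : ℝ)..1, p.eval s * Real.cos (k * s)| ≤ C / k ^ 3 := by
  set p2 := p.derivative.derivative
  set p3 := p2.derivative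
  refine ⟨|p2.eval 1| + |p2.eval (-1)| + ∫ s in (-1 : ℝ)..1, |p3.eval s|, ?_, fun k hk => ?_⟩
  · have : 0 ≤ ∫ s in (-1 : ℝ)..1, |p3.eval s| :=
      intervalIntegral.integral_nonneg (by norm_num) fun _ _ => abs_nonneg _
    positivity
  have hd : ∀ s : ℝ, HasDerivAt (fun s : ℝ => p.eval s * Real.sin (k * s) / k
      + p.derivative.eval s * Real.cos (k * s) / k ^ 2 - p2.eval s * Real.sin (k * s) / k ^ 3)
      (p.eval s * Real.cos (k * s) - p3.eval s * Real.sin (k * s) / k ^ 3) s := by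
    intro s
    have hks : HasDerivAt (fun s : ℝ => k * s) k s := by simpa using (hasDerivAt_id s).const_mul k
    have := ((((p.hasDerivAt s).mul hks.sin).div_const k).add
      (((p.derivative.hasDerivAt s).mul hks.cos).div_const (k ^ 2))).sub
      (((p2.hasDerivAt s).mul hks.sin).div_const (k ^ 3))
    refine this.congr_deriv ?_
    field_simp
    ring
  have hi1 : IntervalIntegrable (fun s => p.eval s * Real.cos (k * s)) volume (-1) 1 :=
    (p.continuous.mul (by fun_prop)).intervalIntegrable _ _
  have hi2 : IntervalIntegrable (fun s => p3.eval s * Real.sin (k * s) / k ^ 3) volume (-1) 1 :=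
    ((p3.continuous.mul (by fun_prop)).div_const _).intervalIntegrable _ _
  have hFTC := intervalIntegral.integral_eq_sub_of_hasDerivAt (fun s _ => hd s) (hi1.sub hi2)
  rw [intervalIntegral.integral_sub hi1 hi2] at hFTC
  simp only [h1, h2, h3, h4, mul_one, mul_neg, Real.sin_neg] at hFTC
  have hb : |∫ s in (-1 : ℝ)..1, p3.eval s * Real.sin (k * s) / k ^ 3| ≤
      (∫ s in (-1 : ℝ)..1, |p3.eval s|) / k ^ 3 := by
    rw [← intervalIntegral.integral_div]
    refine (intervalIntegral.abs_integral_le_integral_abs (by norm_num)).trans ?_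
    refine intervalIntegral.integral_mono_on (by norm_num) hi2.abs
      ((p3.continuous.abs.div_const _).intervalIntegrable _ _) fun s _ => ?_
    rw [abs_div, abs_mul, abs_of_pos (pow_pos hk 3)]
    gcongr
    exact mul_le_of_le_one_right (abs_nonneg _) (Real.abs_sin_le_one _)
  have hs1 : |p2.eval 1 * Real.sin k| ≤ |p2.eval 1| := by
    rw [abs_mul]; exact mul_le_of_le_one_right (abs_nonneg _) (Real.abs_sin_le_one _)
  have hs2 : |p2.eval (-1) * Real.sin k| ≤ |p2.eval (-1)| := by
    rw [abs_mul]; exact mul_le_of_le_one_right (abs_nonneg _) (Real.abs_sin_le_one _)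
  have heq : ∫ s in (-1 : ℝ)..1, p.eval s * Real.cos (k * s) =
      -(p2.eval 1 * Real.sin k) / k ^ 3 - (p2.eval (-1) * Real.sin k) / k ^ 3 +
        ∫ s in (-1 : ℝ)..1, p3.eval s * Real.sin (k * s) / k ^ 3 := by
    field_simp at hFTC ⊢
    linarith
  rw [heq]
  calc _ ≤ |-(p2.eval 1 * Real.sin k) / k ^ 3| + |(p2.eval (-1) * Real.sin k) / k ^ 3| +
        |∫ s in (-1 : ℝ)..1, p3.eval s * Real.sin (k * s) / k ^ 3| :=
        (abs_add_le _ _).trans (add_le_add_left (abs_sub _ _) _)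
    _ ≤ |p2.eval 1| / k ^ 3 + |p2.eval (-1)| / k ^ 3 + (∫ s in (-1 : ℝ)..1, |p3.eval s|) / k ^ 3 := by
        refine add_le_add (add_le_add ?_ ?_) hb
        · rw [abs_div, abs_neg, abs_of_pos (pow_pos hk 3)]; gcongr
        · rw [abs_div, abs_of_pos (pow_pos hk 3)]; gcongr
    _ = _ := by ring

end PowerProfile

/-! ### Cubic decay for the part with a 3/2-power singularity -/

section SmoothPart

theorem exists_fourier_decay {f : ℂ → ℂ} (hf : ContDiff ℝ 3 f) (hc : HasCompactSupport f) :
    ∃ C : ℝ, ∀ w : ℂ, ‖w‖ ^ 3 * ‖𝓕 f w‖ ≤ C := by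
  have hf' : ContDiff ℝ ((3 : ℕ∞) : WithTop ℕ∞) f := hf
  refine ⟨(2 * Real.pi) ^ 0 * (2 * (0 : ℕ) + 2) ^ 3 *
    ∑ p ∈ Finset.range (0 + 1) ×ˢ Finset.range (3 + 1), ∫ v, ‖v‖ ^ p.1 * ‖iteratedFDeriv ℝ p.2 f v‖,
    fun w => ?_⟩
  have h := Real.pow_mul_norm_iteratedFDeriv_fourier_le (K := 0) (N := 3) hf' ?_
    (k := 0) (n := 3) le_rfl le_rfl w
  · rw [norm_iteratedFDeriv_zero] at h
    exact h
  · intro k n _ hn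
    have hcont : Continuous (fun v => iteratedFDeriv ℝ n f v) :=
      hf'.continuous_iteratedFDeriv (by exact_mod_cast hn)
    refine Continuous.integrable_of_hasCompactSupport (by fun_prop) ?_
    exact ((hc.iteratedFDeriv (𝕜 := ℝ) n).norm).mul_left

/-- The auxiliary factor in the expansion of `√2 - √(1 + n)` at `n = 1`. -/
noncomputable def remainderFactor (n : ℝ) : ℝ :=
  ((1 / (√2 + √(1 + n))) ^ 2 / 8 + (1 / (√2 + √(1 + n))) ^ 3 / (2 * √2)) / √2

/-- The part of the ball profile which is singular only to order `3/2` at the boundary. -/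
noncomputable def smootherProfile (n : ℝ) : ℝ := 2 * √(1 - n) * (√2 - √(1 + n))

/-- Expansion in half-integral powers of 1 - n at the boundary. The first two powers have explicit
transforms; the last is of order 7/2, hence already C³. -/
theorem smootherProfile_eq {n : ℝ} (hn : 0 ≤ n) :
    smootherProfile n = truncPow (3 / 2) (1 - n) / √2 + truncPow (5 / 2) (1 - n) / (8 * √2) +
      (1 - n) ^ (7 / 2 : ℝ) * remainderFactor n := by
  rcases le_total 1 n with h | h
  -- By convention a real power of a negative base carries the factor cos(7π/2) = 0, so this power
  -- truncates itself past n = 1.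
  · have h72 : (1 - n) ^ (7 / 2 : ℝ) = 0 := by
      have hcos : Real.cos (7 / 2 * Real.pi) = 0 :=
        Real.cos_eq_zero_iff.2 ⟨3, by push_cast; ring⟩
      rw [Real.rpow_def_of_nonpos (by linarith), hcos]
      norm_num
    rw [truncPow_of_nonpos (by norm_num) (by linarith), truncPow_of_nonpos (by norm_num) (by linarith),
      h72, smootherProfile, Real.sqrt_eq_zero_of_nonpos (by linarith)]
    simp
  · have hy : 0 ≤ 1 - n := by linarith
    have e1 : (1 - n) ^ (3 / 2 : ℝ) = √(1 - n) * (1 - n) := by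
      rw [Real.sqrt_eq_rpow, show (3 / 2 : ℝ) = 1 / 2 + (1 : ℕ) by norm_num,
        Real.rpow_add_natCast' hy (by norm_num), pow_one]
    have e2 : (1 - n) ^ (5 / 2 : ℝ) = √(1 - n) * (1 - n) ^ 2 := by
      rw [Real.sqrt_eq_rpow, show (5 / 2 : ℝ) = 1 / 2 + (2 : ℕ) by norm_num,
        Real.rpow_add_natCast' hy (by norm_num)]
    have e3 : (1 - n) ^ (7 / 2 : ℝ) = √(1 - n) * (1 - n) ^ 3 := by
      rw [Real.sqrt_eq_rpow, show (7 / 2 : ℝ) = 1 / 2 + (3 : ℕ) by norm_num,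
        Real.rpow_add_natCast' hy (by norm_num)]
    rw [truncPow_of_nonneg _ hy, truncPow_of_nonneg _ hy, e1, e2, e3, smootherProfile,
      remainderFactor]
    set a := √2 with ha
    set w := √(1 + n) with hw
    have ha2 : a ^ 2 = 2 := Real.sq_sqrt (by norm_num)
    have hw2 : w ^ 2 = 1 + n := Real.sq_sqrt (by linarith)
    have hapos : 0 < a := Real.sqrt_pos.2 (by norm_num)
    have hwpos : 0 < w := Real.sqrt_pos.2 (by linarith)
    have hn' : 1 - n = a ^ 2 - w ^ 2 := by rw [ha2, hw2]; ring
    set q := 1 / (a + w) with hq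
    have hq1 : a - w = (1 - n) * q := by rw [hn', hq]; field_simp; ring
    -- From 1/q = a + w = 2a - (a - w) = 2a - (1 - n)q. Iterating this identity generates the
    -- expansion.
    have hq2 : q = 1 / (2 * a) + (1 - n) * q ^ 2 / (2 * a) := by
      rw [hn', hq]; field_simp; ring
    have hq3 : q ^ 2 = 1 / 8 + (1 - n) * q ^ 2 / 8 + (1 - n) * q ^ 3 / (2 * a) := by
      have e : q ^ 2 = q / (2 * a) + (1 - n) * q ^ 3 / (2 * a) := by
        calc q ^ 2 = q * q := sq q
          _ = q * (1 / (2 * a) + (1 - n) * q ^ 2 / (2 * a)) := by rw [← hq2]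
          _ = _ := by ring
      have e' : q / (2 * a) = 1 / (4 * a ^ 2) + (1 - n) * q ^ 2 / (4 * a ^ 2) := by
        calc q / (2 * a) = (1 / (2 * a) + (1 - n) * q ^ 2 / (2 * a)) / (2 * a) := by rw [← hq2]
          _ = _ := by field_simp; ring
      rw [ha2] at e'
      norm_num at e'
      linarith
    have key : 2 * (a - w) = (1 - n) / a + (1 - n) ^ 2 / (8 * a) +
        (1 - n) ^ 3 * ((q ^ 2 / 8 + q ^ 3 / (2 * a)) / a) := by
      calc 2 * (a - w) = 2 * (1 - n) * q := by rw [hq1]; ring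
        _ = 2 * (1 - n) * (1 / (2 * a) + (1 - n) * q ^ 2 / (2 * a)) := by rw [← hq2]
        _ = (1 - n) / a + (1 - n) ^ 2 / a * q ^ 2 := by field_simp
        _ = (1 - n) / a + (1 - n) ^ 2 / a *
            (1 / 8 + (1 - n) * q ^ 2 / 8 + (1 - n) * q ^ 3 / (2 * a)) := by rw [← hq3]
        _ = _ := by field_simp; ring
    calc 2 * √(1 - n) * (a - w) = √(1 - n) * (2 * (a - w)) := by ring
      _ = _ := by rw [key]; ring

theorem continuous_smootherProfile : Continuous smootherProfile := by
  unfold smootherProfile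
  fun_prop

theorem smootherProfile_of_one_le {n : ℝ} (hn : 1 ≤ n) : smootherProfile n = 0 := by
  rw [smootherProfile, Real.sqrt_eq_zero_of_nonpos (by linarith)]
  simp

theorem contDiff_radial_remainder :
    ContDiff ℝ 3 (radial fun n => (1 - n) ^ (7 / 2 : ℝ) * remainderFactor n) := by
  have hns : ContDiff ℝ 3 (fun z : ℂ => Complex.normSq z) := by
    simp only [Complex.normSq_apply]
    have h1 : ContDiff ℝ 3 Complex.re := Complex.reCLM.contDiff
    have h2 : ContDiff ℝ 3 Complex.im := Complex.imCLM.contDiff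
    fun_prop
  have h1 : ContDiff ℝ 3 (fun z : ℂ => (1 - Complex.normSq z) ^ (7 / 2 : ℝ)) := by
    have h := Real.contDiff_rpow_const_of_le (p := 7 / 2) (n := 3) (by norm_num)
    exact h.comp (contDiff_const.sub hns)
  have hsq : ContDiff ℝ 3 (fun z : ℂ => √(1 + Complex.normSq z)) :=
    (contDiff_const.add hns).sqrt fun z => by have := Complex.normSq_nonneg z; positivity
  have hq : ContDiff ℝ 3 (fun z : ℂ => 1 / (√2 + √(1 + Complex.normSq z))) :=
    contDiff_const.div (contDiff_const.add hsq) fun z => by positivity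
  have h2 : ContDiff ℝ 3 (fun z : ℂ => remainderFactor (Complex.normSq z)) := by
    unfold remainderFactor
    exact (((hq.pow 2).div_const _).add ((hq.pow 3).div_const _)).div_const _
  exact Complex.ofRealCLM.contDiff.comp (h1.mul h2)

/-- The one-dimensional integrand is (1 - s²)^j, and j ≥ 2 supplies the double zeros at ±1 that
three integrations by parts need. -/
theorem exists_radialFourier_truncPow_decay {j : ℕ} (hj : 2 ≤ j) :
    ∃ C : ℝ, 0 ≤ C ∧ ∀ r : ℝ, 0 < r →
      |radialFourier (fun n => truncPow (j - 1 / 2) (1 - n)) r| ≤ C / r ^ 3 := by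
  set p : Polynomial ℝ := (1 - Polynomial.X ^ 2) ^ j with hp
  have hj2 : (2 : ℝ) ≤ j := by exact_mod_cast hj
  obtain ⟨C, hC0, hC⟩ := abs_integral_polynomial_cos_le p
    (by simp [hp]; omega) (by simp [hp]; omega)
    (by simp [hp, Polynomial.derivative_pow]; omega) (by simp [hp, Polynomial.derivative_pow]; omega)
  refine ⟨|truncPowConst (j - 1 / 2)| * C, by positivity, fun r hr => ?_⟩
  have h := radialFourier_truncPow (α := j - 1 / 2) (by linarith) zero_le_one r
  rw [one_pow] at h
  rw [h, abs_mul, mul_div_assoc]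
  gcongr
  have heq : ∀ s : ℝ, (1 - s ^ 2) ^ ((j : ℝ) - 1 / 2 + 1 / 2) = p.eval s := by
    intro s
    rw [sub_add_cancel, Real.rpow_natCast, hp]
    simp
  simp only [heq]
  refine (hC _ (by have := Real.pi_pos; positivity)).trans ?_
  gcongr
  have := Real.two_le_pi
  nlinarith

theorem radialFourier_congr {G₁ G₂ : ℝ → ℝ} (h : ∀ n, 0 ≤ n → G₁ n = G₂ n) (r : ℝ) :
    radialFourier G₁ r = radialFourier G₂ r := by
  unfold radialFourier
  congr 1
  funext s
  congr 2
  funext u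
  exact h _ (by positivity)

theorem integrable_radialFourier {G : ℝ → ℝ} {R : ℝ} (hG : Continuous G) (hR : ∀ t, R ≤ t → G t = 0)
    (r : ℝ) : Integrable (fun s : ℝ => (∫ u : ℝ, G (s ^ 2 + u ^ 2)) * Real.cos (2 * Real.pi * r * s)) :=
  (integrable_radial hG hR).integral_prod_left.mul_bdd (c := 1) (by fun_prop)
    (Filter.Eventually.of_forall fun s => Real.abs_cos_le_one _)

theorem integrable_radial_slice {G : ℝ → ℝ} {R : ℝ} (hG : Continuous G) (hR : ∀ t, R ≤ t → G t = 0)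
    (s : ℝ) : Integrable (fun u : ℝ => G (s ^ 2 + u ^ 2)) := by
  refine Continuous.integrable_of_hasCompactSupport (by fun_prop) ?_
  refine HasCompactSupport.of_support_subset_isCompact
    (isCompact_Icc (a := -(|R| + 1)) (b := |R| + 1)) fun u hu => ?_
  have h' : s ^ 2 + u ^ 2 < R := by
    by_contra hc
    exact hu (hR _ (not_lt.1 hc))
  have h0 : R ≤ |R| := le_abs_self R
  have hp : 0 ≤ |R| := abs_nonneg R
  exact abs_le.1 (abs_le_of_sq_le_sq (by nlinarith [sq_nonneg s]) (by linarith))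

theorem radialFourier_add {G₁ G₂ : ℝ → ℝ} {R₁ R₂ : ℝ} (h₁ : Continuous G₁) (h₂ : Continuous G₂)
    (hR₁ : ∀ t, R₁ ≤ t → G₁ t = 0) (hR₂ : ∀ t, R₂ ≤ t → G₂ t = 0) (r : ℝ) :
    radialFourier (fun n => G₁ n + G₂ n) r = radialFourier G₁ r + radialFourier G₂ r := by
  unfold radialFourier
  rw [← integral_add (integrable_radialFourier h₁ hR₁ r) (integrable_radialFourier h₂ hR₂ r)]
  congr 1
  funext s
  rw [integral_add (integrable_radial_slice h₁ hR₁ s) (integrable_radial_slice h₂ hR₂ s), add_mul]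

theorem radialFourier_const_mul (c : ℝ) (G : ℝ → ℝ) (r : ℝ) :
    radialFourier (fun n => c * G n) r = c * radialFourier G r := by
  unfold radialFourier
  rw [← integral_const_mul]
  congr 1
  funext s
  rw [integral_const_mul, mul_assoc]

theorem radialFourier_scale {x : ℝ} (hx : 0 < x) (G : ℝ → ℝ) (r : ℝ) :
    radialFourier (fun n => G (n / x ^ 2)) r = x ^ 2 * radialFourier G (x * r) := by
  unfold radialFourier
  set P : ℝ → ℝ := fun s => ∫ u : ℝ, G (s ^ 2 + u ^ 2) with hP
  have h1 : ∀ s : ℝ, ∫ u : ℝ, G ((s ^ 2 + u ^ 2) / x ^ 2) = x * P (s / x) := by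
    intro s
    have h := Measure.integral_comp_div (fun u : ℝ => G ((s / x) ^ 2 + u ^ 2)) x
    rw [abs_of_pos hx, smul_eq_mul] at h
    rw [hP]
    simp only
    rw [← h]
    congr 1
    funext u
    congr 1
    field_simp
  have h2 := Measure.integral_comp_div (fun s : ℝ => P s * Real.cos (2 * Real.pi * (x * r) * s)) x
  rw [abs_of_pos hx, smul_eq_mul] at h2
  simp only [h1, mul_assoc]
  rw [integral_const_mul, sq, mul_assoc]
  congr 1
  simp only [mul_assoc] at h2
  rw [← h2]
  congr 1
  funext s
  congr 2
  field_simp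

theorem exists_radialFourier_smootherProfile_decay :
    ∃ C : ℝ, 0 ≤ C ∧ ∀ r : ℝ, 0 < r → |radialFourier smootherProfile r| ≤ C / r ^ 3 := by
  obtain ⟨C₁, hC₁0, hC₁⟩ := exists_radialFourier_truncPow_decay (j := 2) le_rfl
  obtain ⟨C₂, hC₂0, hC₂⟩ := exists_radialFourier_truncPow_decay (j := 3) (by norm_num)
  set G₁ : ℝ → ℝ := fun n => truncPow (3 / 2) (1 - n) with hG₁
  set G₂ : ℝ → ℝ := fun n => truncPow (5 / 2) (1 - n) with hG₂
  have e1 : (fun n => truncPow ((2 : ℕ) - 1 / 2) (1 - n)) = G₁ := by rw [hG₁]; norm_num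
  have e2 : (fun n => truncPow ((3 : ℕ) - 1 / 2) (1 - n)) = G₂ := by rw [hG₂]; norm_num
  rw [e1] at hC₁
  rw [e2] at hC₂
  have hc1 : Continuous G₁ := (continuous_truncPow (by norm_num)).comp (by fun_prop)
  have hc2 : Continuous G₂ := (continuous_truncPow (by norm_num)).comp (by fun_prop)
  have hz1 : ∀ t, 1 ≤ t → G₁ t = 0 := fun t ht => truncPow_of_nonpos (by norm_num) (by linarith)
  have hz2 : ∀ t, 1 ≤ t → G₂ t = 0 := fun t ht => truncPow_of_nonpos (by norm_num) (by linarith)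
  have hz0 : ∀ t, 1 ≤ t → smootherProfile t = 0 := fun t ht => smootherProfile_of_one_le ht
  -- As a difference, the remainder is visibly continuous on ℝ and zero past 1; it agrees with the
  -- C³ formula for n ≥ 0, and |z|² takes no other values.
  set G₃ : ℝ → ℝ := fun n => smootherProfile n + ((-(1 / √2)) * G₁ n + (-(1 / (8 * √2))) * G₂ n) with hG₃
  have hc3 : Continuous G₃ := by
    have := continuous_smootherProfile
    fun_prop
  have hz3 : ∀ t, 1 ≤ t → G₃ t = 0 := by
    intro t ht
    simp [hG₃, hz1 t ht, hz2 t ht, hz0 t ht]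
  have hG₃eq : ∀ n, 0 ≤ n → G₃ n = (1 - n) ^ (7 / 2 : ℝ) * remainderFactor n := by
    intro n hn
    simp only [hG₃, smootherProfile_eq hn, hG₁, hG₂]
    ring
  have hrad : radial G₃ = radial fun n => (1 - n) ^ (7 / 2 : ℝ) * remainderFactor n := by
    funext z
    simp only [radial]
    rw [hG₃eq _ (Complex.normSq_nonneg z)]
  have hcs : HasCompactSupport (radial G₃) := by
    refine HasCompactSupport.of_support_subset_isCompact (isCompact_closedBall (0 : ℂ) 1) fun z hz => ?_
    rw [mem_closedBall_zero_iff]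
    by_contra h
    refine hz ?_
    have : 1 ≤ Complex.normSq z := by
      rw [Complex.normSq_eq_norm_sq]
      exact one_le_pow₀ (not_le.1 h).le
    simp [radial, hz3 _ this]
  obtain ⟨C₃, hC₃⟩ := exists_fourier_decay (hrad ▸ contDiff_radial_remainder) hcs
  have hG3bd : ∀ r : ℝ, 0 < r → |radialFourier G₃ r| ≤ |C₃| / r ^ 3 := by
    intro r hr
    have h := hC₃ (r : ℂ)
    rw [fourier_radial_real hc3 hz3, Complex.norm_real, Complex.norm_real, Real.norm_eq_abs,
      Real.norm_eq_abs, abs_of_pos hr] at h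
    rw [le_div_iff₀ (by positivity), mul_comm]
    exact h.trans (le_abs_self _)
  refine ⟨|C₃| + 1 / √2 * C₁ + 1 / (8 * √2) * C₂, by positivity, fun r hr => ?_⟩
  have hsplit : radialFourier G₃ r = radialFourier smootherProfile r +
      (-(1 / √2) * radialFourier G₁ r + -(1 / (8 * √2)) * radialFourier G₂ r) := by
    rw [hG₃, radialFourier_add (R₁ := 1) (R₂ := 1) continuous_smootherProfile (by fun_prop) hz0
      (fun t ht => by simp [hz1 t ht, hz2 t ht]),
      radialFourier_add (R₁ := 1) (R₂ := 1) (by fun_prop) (by fun_prop)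
      (fun t ht => by simp [hz1 t ht]) (fun t ht => by simp [hz2 t ht]),
      radialFourier_const_mul, radialFourier_const_mul]
  have hsol : radialFourier smootherProfile r = radialFourier G₃ r +
      (1 / √2 * radialFourier G₁ r + 1 / (8 * √2) * radialFourier G₂ r) := by
    rw [hsplit]; ring
  rw [hsol, add_div, add_div, add_assoc]
  refine (abs_add_le _ _).trans (add_le_add (hG3bd r hr) ((abs_add_le _ _).trans (add_le_add ?_ ?_)))
  · rw [abs_mul, abs_of_pos (by positivity : 0 < 1 / √2), mul_div_assoc]
    exact mul_le_mul_of_nonneg_left (hC₁ r hr) (by positivity)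
  · rw [abs_mul, abs_of_pos (by positivity : 0 < 1 / (8 * √2)), mul_div_assoc]
    exact mul_le_mul_of_nonneg_left (hC₂ r hr) (by positivity)

end SmoothPart

end CyganKoranyi

namespace CyganKoranyi

open MeasureTheory Set intervalIntegral

/-! ### First-derivative test for oscillating integrals -/

section Oscillation

/-- A first-derivative estimate for an oscillating integral with nonnegative antitone amplitude. -/
theorem abs_integral_antitone_mul_sin_le {φ φ' : ℝ → ℝ} {a b k : ℝ} (θ : ℝ) (hab : a ≤ b) (hk : 0 < k)
    (hd : ∀ v ∈ Icc a b, HasDerivAt φ (φ' v) v) (hneg : ∀ v ∈ Icc a b, φ' v ≤ 0)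
    (hc : ContinuousOn φ' (Icc a b)) (hb : 0 ≤ φ b) :
    |∫ v in a..b, φ v * Real.sin (k * v + θ)| ≤ 2 * φ a / k := by
  have hu : uIcc a b = Icc a b := uIcc_of_le hab
  have hφc : ContinuousOn φ (Icc a b) := fun v hv => (hd v hv).continuousAt.continuousWithinAt
  have hi' : IntervalIntegrable φ' volume a b := (hu ▸ hc : ContinuousOn φ' (uIcc a b)).intervalIntegrable
  have hi1 : IntervalIntegrable (fun v => φ v * Real.sin (k * v + θ)) volume a b := by
    apply ContinuousOn.intervalIntegrable
    rw [hu]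
    exact hφc.mul (by fun_prop)
  have hi2 : IntervalIntegrable (fun v => φ' v * (-Real.cos (k * v + θ) / k)) volume a b := by
    apply ContinuousOn.intervalIntegrable
    rw [hu]
    exact hc.mul (by fun_prop)
  have hder : ∀ v ∈ uIcc a b, HasDerivAt (fun v => φ v * (-Real.cos (k * v + θ) / k))
      (φ' v * (-Real.cos (k * v + θ) / k) + φ v * Real.sin (k * v + θ)) v := by
    intro v hv
    have hkv : HasDerivAt (fun v : ℝ => k * v + θ) k v := by
      simpa using ((hasDerivAt_id v).const_mul k).add_const θ
    refine ((hd v (hu ▸ hv)).mul (hkv.cos.neg.div_const k)).congr_deriv ?_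
    simp only [Pi.neg_apply]
    field_simp
  have hFTC := integral_eq_sub_of_hasDerivAt hder (hi2.add hi1)
  rw [integral_add hi2 hi1] at hFTC
  have hφ' : ∫ v in a..b, φ' v = φ b - φ a := integral_eq_sub_of_hasDerivAt (hu ▸ hd) hi'
  have hanti : φ b ≤ φ a := by
    have : ∫ v in a..b, φ' v ≤ ∫ v in a..b, (0 : ℝ) :=
      integral_mono_on hab hi' intervalIntegrable_const hneg
    rw [hφ', intervalIntegral.integral_zero] at this
    linarith
  have hbd : |∫ v in a..b, φ' v * (-Real.cos (k * v + θ) / k)| ≤ (φ a - φ b) / k := by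
    have : (φ a - φ b) / k = ∫ v in a..b, -φ' v / k := by
      rw [intervalIntegral.integral_div, intervalIntegral.integral_neg, hφ']
      ring
    rw [this]
    refine (abs_integral_le_integral_abs hab).trans ?_
    refine integral_mono_on hab hi2.abs (hi'.neg.div_const k) fun v hv => ?_
    rw [abs_mul, abs_of_nonpos (hneg v hv), abs_div, abs_neg, abs_of_pos hk, mul_div_assoc']
    gcongr
    exact mul_le_of_le_one_right (by linarith [hneg v hv]) (Real.abs_cos_le_one _)
  have e1 : |φ b * (-Real.cos (k * b + θ) / k)| ≤ φ b / k := by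
    rw [abs_mul, abs_of_nonneg hb, abs_div, abs_neg, abs_of_pos hk, mul_div_assoc']
    gcongr
    exact mul_le_of_le_one_right hb (Real.abs_cos_le_one _)
  have e2 : |φ a * (-Real.cos (k * a + θ) / k)| ≤ φ a / k := by
    rw [abs_mul, abs_of_nonneg (hb.trans hanti), abs_div, abs_neg, abs_of_pos hk, mul_div_assoc']
    gcongr
    exact mul_le_of_le_one_right (hb.trans hanti) (Real.abs_cos_le_one _)
  have e3 : 2 * φ a / k = φ b / k + φ a / k + (φ a - φ b) / k := by ring
  rw [e3, abs_le]
  rw [abs_le] at hbd e1 e2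
  constructor <;> linarith

theorem abs_integral_antitone_mul_cos_le {φ φ' : ℝ → ℝ} {a b k : ℝ} (hab : a ≤ b) (hk : 0 < k)
    (hd : ∀ v ∈ Icc a b, HasDerivAt φ (φ' v) v) (hneg : ∀ v ∈ Icc a b, φ' v ≤ 0)
    (hc : ContinuousOn φ' (Icc a b)) (hb : 0 ≤ φ b) :
    |∫ v in a..b, φ v * Real.cos (k * v)| ≤ 2 * φ a / k := by
  have h := abs_integral_antitone_mul_sin_le (Real.pi / 2) hab hk hd hneg hc hb
  simpa only [Real.sin_add_pi_div_two] using h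

end Oscillation

/-! ### The Fejér-type transform of the triangle function -/

section TriangleTransform

/-- The Fourier transform of the triangle function `(1 - |ρ|)₊`. -/
noncomputable def triangleHat (v : ℝ) : ℝ :=
  ∫ ρ in (-1 : ℝ)..1, (1 - |ρ|) * Real.cos (2 * Real.pi * v * ρ)

theorem integral_symm_of_even {f : ℝ → ℝ} (hf : Continuous f) (he : ∀ ρ, f (-ρ) = f ρ) :
    ∫ ρ in (-1 : ℝ)..1, f ρ = 2 * ∫ ρ in (0 : ℝ)..1, f ρ := by
  rw [← integral_add_adjacent_intervals (hf.intervalIntegrable (-1) 0) (hf.intervalIntegrable 0 1)]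
  have h := intervalIntegral.integral_comp_neg (a := 0) (b := 1) f
  simp only [he, neg_zero] at h
  rw [← h]
  ring

theorem integral_symm_of_odd {f : ℝ → ℝ} (ho : ∀ ρ, f (-ρ) = -f ρ) :
    ∫ ρ in (-1 : ℝ)..1, f ρ = 0 := by
  have h := intervalIntegral.integral_comp_neg (a := -1) (b := 1) f
  simp only [ho, neg_neg, intervalIntegral.integral_neg] at h
  linarith

theorem continuous_triangleHat : Continuous triangleHat :=
  intervalIntegral.continuous_parametric_intervalIntegral_of_continuous' (by fun_prop) _ _

theorem triangleHat_neg (v : ℝ) : triangleHat (-v) = triangleHat v := by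
  simp [triangleHat]

theorem triangleHat_eq {v : ℝ} (hv : v ≠ 0) :
    triangleHat v = (1 - Real.cos (2 * Real.pi * v)) / (2 * Real.pi ^ 2 * v ^ 2) := by
  rw [triangleHat, integral_symm_of_even (by fun_prop) (by simp)]
  set k := 2 * Real.pi * v with hk
  have hk0 : k ≠ 0 := by have := Real.pi_ne_zero; positivity
  have hcongr : ∫ ρ in (0 : ℝ)..1, (1 - |ρ|) * Real.cos (k * ρ) =
      ∫ ρ in (0 : ℝ)..1, (1 - ρ) * Real.cos (k * ρ) := by
    refine integral_congr fun ρ hρ => ?_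
    rw [uIcc_of_le zero_le_one] at hρ
    simp only [abs_of_nonneg hρ.1]
  have hd : ∀ ρ ∈ uIcc (0 : ℝ) 1, HasDerivAt (fun ρ => (1 - ρ) * Real.sin (k * ρ) / k - Real.cos (k * ρ) / k ^ 2)
      ((1 - ρ) * Real.cos (k * ρ)) ρ := by
    intro ρ _
    have hkv : HasDerivAt (fun v : ℝ => k * v) k ρ := by
      simpa using (hasDerivAt_id ρ).const_mul k
    have h1 : HasDerivAt (fun v : ℝ => 1 - v) (-1) ρ := by simpa using (hasDerivAt_id ρ).const_sub 1
    refine (((h1.mul hkv.sin).div_const k).sub (hkv.cos.div_const (k ^ 2))).congr_deriv ?_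
    field_simp
    ring
  rw [hcongr, integral_eq_sub_of_hasDerivAt hd
    ((by fun_prop : Continuous fun ρ => (1 - ρ) * Real.cos (k * ρ)).intervalIntegrable _ _)]
  have hkk : k ^ 2 = 2 * (2 * Real.pi ^ 2 * v ^ 2) := by rw [hk]; ring
  simp only [sub_self, zero_mul, zero_div, mul_one, mul_zero, Real.sin_zero, Real.cos_zero]
  rw [hkk]
  have := Real.pi_ne_zero
  field_simp
  ring

theorem triangleHat_nonneg (v : ℝ) : 0 ≤ triangleHat v := by
  rcases eq_or_ne v 0 with rfl | hv
  · refine integral_nonneg (by norm_num) fun ρ hρ => ?_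
    have : |ρ| ≤ 1 := abs_le.2 hρ
    simp [this]
  · rw [triangleHat_eq hv]
    have := Real.cos_le_one (2 * Real.pi * v)
    exact div_nonneg (by linarith) (by positivity)

theorem triangleHat_le_one (v : ℝ) : triangleHat v ≤ 1 := by
  have h : triangleHat v ≤ ∫ ρ in (-1 : ℝ)..1, (1 - |ρ|) := by
    refine integral_mono_on (by norm_num)
      ((by fun_prop : Continuous fun ρ : ℝ => (1 - |ρ|) * Real.cos (2 * Real.pi * v * ρ)).intervalIntegrable _ _)
      ((by fun_prop : Continuous fun ρ : ℝ => (1 - |ρ|)).intervalIntegrable _ _) fun ρ hρ => ?_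
    have : |ρ| ≤ 1 := abs_le.2 hρ
    exact mul_le_of_le_one_right (by linarith) (Real.cos_le_one _)
  refine h.trans (le_of_eq ?_)
  rw [integral_symm_of_even (by fun_prop) (by simp)]
  have hcongr : ∫ ρ in (0 : ℝ)..1, (1 - |ρ|) = ∫ ρ in (0 : ℝ)..1, (1 - ρ) := by
    refine integral_congr fun ρ hρ => ?_
    rw [uIcc_of_le zero_le_one] at hρ
    simp only [abs_of_nonneg hρ.1]
  rw [hcongr, intervalIntegral.integral_sub intervalIntegrable_const intervalIntegrable_id,
    integral_id]
  norm_num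

theorem triangleHat_mul_sq_le (v : ℝ) : triangleHat v * v ^ 2 ≤ 1 := by
  rcases eq_or_ne v 0 with rfl | hv
  · simp
  · have h1 := Real.neg_one_le_cos (2 * Real.pi * v)
    have h2 := Real.two_le_pi
    have hv2 : 0 < v ^ 2 := by positivity
    rw [triangleHat_eq hv, div_mul_eq_mul_div, div_le_one (by positivity)]
    have h3 : 4 ≤ Real.pi ^ 2 := by nlinarith
    have h4 : (1 - Real.cos (2 * Real.pi * v)) * v ^ 2 ≤ 2 * v ^ 2 := by gcongr; linarith
    have h5 : 4 * v ^ 2 ≤ Real.pi ^ 2 * v ^ 2 := by gcongr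
    linarith

theorem triangleHat_le (v : ℝ) : triangleHat v ≤ 2 / (1 + v ^ 2) := by
  rw [le_div_iff₀ (by positivity)]
  linarith [triangleHat_le_one v, triangleHat_mul_sq_le v]

theorem triangleHat_le_abs (v : ℝ) : triangleHat v ≤ 2 / (1 + |v|) := by
  rw [le_div_iff₀ (by positivity)]
  have h1 := triangleHat_le_one v
  have h2 := triangleHat_mul_sq_le v
  have h0 := triangleHat_nonneg v
  rw [← sq_abs] at h2
  nlinarith [abs_nonneg v, sq_nonneg (|v| - 1), mul_nonneg h0 (sq_nonneg (|v| - 1))]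

/-- Here 0 < 2πv ≤ π, where cos y ≤ 1 - 2y²/π². The bound keeps the mass κ of the smoothing kernel
away from 0. -/
theorem le_triangleHat {v : ℝ} (h1 : 1 / 4 ≤ v) (h2 : v ≤ 1 / 2) : 4 / Real.pi ^ 2 ≤ triangleHat v := by
  have hv : 0 < v := by linarith
  have hpi := Real.pi_pos
  rw [triangleHat_eq hv.ne', div_le_div_iff₀ (by positivity) (by positivity)]
  have h := Real.cos_le_one_sub_mul_cos_sq (x := 2 * Real.pi * v)
    (by rw [abs_of_pos (by positivity)]; nlinarith)
  have h3 : 2 / Real.pi ^ 2 * (2 * Real.pi * v) ^ 2 = 8 * v ^ 2 := by field_simp; ring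
  rw [h3] at h
  have h4 : 8 * v ^ 2 * Real.pi ^ 2 ≤ (1 - Real.cos (2 * Real.pi * v)) * Real.pi ^ 2 := by
    gcongr; linarith
  linarith

theorem integral_triangleHat_nonneg {a b : ℝ} (hab : a ≤ b) : 0 ≤ ∫ v in a..b, triangleHat v :=
  integral_nonneg hab fun v _ => triangleHat_nonneg v

theorem integral_triangleHat_le_two_pi {a b : ℝ} (hab : a ≤ b) :
    ∫ v in a..b, triangleHat v ≤ 2 * Real.pi := by
  have hc : Continuous fun v : ℝ => 2 * (1 + v ^ 2)⁻¹ := by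
    refine continuous_const.mul (Continuous.inv₀ (by fun_prop) fun v => by positivity)
  have h : ∫ v in a..b, triangleHat v ≤ ∫ v in a..b, 2 * (1 + v ^ 2)⁻¹ := by
    refine integral_mono_on hab (continuous_triangleHat.intervalIntegrable _ _)
      (hc.intervalIntegrable _ _) fun v _ => ?_
    rw [← div_eq_mul_inv]
    exact triangleHat_le v
  rw [intervalIntegral.integral_const_mul, integral_inv_one_add_sq] at h
  linarith [Real.arctan_lt_pi_div_two b, Real.neg_pi_div_two_lt_arctan a]

theorem integral_triangleHat_le_inv {a b : ℝ} (ha : 0 < a) (hab : a ≤ b) :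
    ∫ v in a..b, triangleHat v ≤ 1 / a := by
  have hd : ∀ v ∈ uIcc a b, HasDerivAt (fun v : ℝ => -v⁻¹) ((v ^ 2)⁻¹) v := by
    intro v hv
    rw [uIcc_of_le hab] at hv
    have hv0 : v ≠ 0 := (ha.trans_le hv.1).ne'
    exact (hasDerivAt_inv hv0).neg.congr_deriv (by simp)
  have hi : IntervalIntegrable (fun v : ℝ => (v ^ 2)⁻¹) volume a b := by
    apply ContinuousOn.intervalIntegrable
    rw [uIcc_of_le hab]
    exact ContinuousOn.inv₀ (by fun_prop) fun v hv => pow_ne_zero 2 (ha.trans_le hv.1).ne'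
  have h : ∫ v in a..b, triangleHat v ≤ ∫ v in a..b, (v ^ 2)⁻¹ := by
    refine integral_mono_on hab (continuous_triangleHat.intervalIntegrable _ _) hi fun v hv => ?_
    have hv0 : 0 < v := ha.trans_le hv.1
    rw [← one_div, le_div_iff₀ (by positivity)]
    exact triangleHat_mul_sq_le v
  rw [integral_eq_sub_of_hasDerivAt hd hi] at h
  have : 0 < b⁻¹ := inv_pos.2 (ha.trans_le hab)
  rw [one_div]
  linarith

end TriangleTransform

/-! ### The smoothing kernel and its cosine transform -/

section Kernel

/-- The smoothing kernel `(1 - |ρ|) sin (2πXρ) / (πρ)`. -/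
noncomputable def kernel (X ρ : ℝ) : ℝ := (1 - |ρ|) * (2 * X * Real.sinc (2 * Real.pi * X * ρ))

variable {X : ℝ}

theorem continuous_kernel (X : ℝ) : Continuous (kernel X) := by
  unfold kernel
  have := Real.continuous_sinc
  fun_prop

theorem kernel_neg (X ρ : ℝ) : kernel X (-ρ) = kernel X ρ := by
  simp [kernel]

theorem mul_kernel (X ρ : ℝ) : ρ * kernel X ρ = (1 - |ρ|) * Real.sin (2 * Real.pi * X * ρ) / Real.pi := by
  have hpi := Real.pi_ne_zero
  rcases eq_or_ne (2 * Real.pi * X * ρ) 0 with h | h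
  · rcases eq_or_ne ρ 0 with rfl | hρ
    · simp
    · have hX : X = 0 := by simpa [hpi, hρ] using h
      simp [kernel, hX]
  · rw [kernel, Real.sinc_of_ne_zero h]
    have hX : X ≠ 0 := by rintro rfl; simp at h
    have hρ : ρ ≠ 0 := by rintro rfl; simp at h
    field_simp

theorem kernel_eq_integral (X ρ : ℝ) :
    kernel X ρ = ∫ u in (-X)..X, (1 - |ρ|) * Real.cos (2 * Real.pi * u * ρ) := by
  rw [intervalIntegral.integral_const_mul, kernel]
  congr 1
  rcases eq_or_ne ρ 0 with rfl | hρ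
  · simp [two_mul]
  · have hpi := Real.pi_ne_zero
    have hc : 2 * Real.pi * ρ ≠ 0 := by positivity
    have hd : ∀ u ∈ uIcc (-X) X, HasDerivAt (fun u => Real.sin (2 * Real.pi * u * ρ) / (2 * Real.pi * ρ))
        (Real.cos (2 * Real.pi * u * ρ)) u := by
      intro u _
      have hkv : HasDerivAt (fun u : ℝ => 2 * Real.pi * u * ρ) (2 * Real.pi * ρ) u := by
        simpa using ((hasDerivAt_id u).const_mul (2 * Real.pi)).mul_const ρ
      refine (hkv.sin.div_const _).congr_deriv ?_
      field_simp
    rw [integral_eq_sub_of_hasDerivAt hd ((by fun_prop : Continuous _).intervalIntegrable _ _)]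
    have e : 2 * Real.pi * -X * ρ = -(2 * Real.pi * X * ρ) := by ring
    rw [e, Real.sin_neg]
    rcases eq_or_ne X 0 with rfl | hX
    · simp
    · rw [Real.sinc_of_ne_zero (by positivity)]
      field_simp
      ring

/-- The cosine transform of the smoothing kernel. -/
noncomputable def kernelHat (X r : ℝ) : ℝ :=
  ∫ ρ in (-1 : ℝ)..1, kernel X ρ * Real.cos (2 * Real.pi * r * ρ)

/-- The factor sin(2πXρ)/(πρ) is the integral of cos(2πuρ) over |u| ≤ X, so the transform is the
triangle transform convolved with the indicator of [-X, X]. -/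
theorem kernelHat_eq (X r : ℝ) : kernelHat X r = ∫ v in (r - X)..(r + X), triangleHat v := by
  have h1 : kernelHat X r = ∫ ρ in (-1 : ℝ)..1, ∫ u in (-X)..X,
      (1 - |ρ|) * Real.cos (2 * Real.pi * u * ρ) * Real.cos (2 * Real.pi * r * ρ) := by
    unfold kernelHat
    refine integral_congr fun ρ _ => ?_
    rw [kernel_eq_integral, intervalIntegral.integral_mul_const]
  rw [h1, intervalIntegral_intervalIntegral_swap]
  · have h2 : ∀ u : ℝ, ∫ ρ in (-1 : ℝ)..1,
        (1 - |ρ|) * Real.cos (2 * Real.pi * u * ρ) * Real.cos (2 * Real.pi * r * ρ) =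
        triangleHat (r + u) / 2 + triangleHat (r - u) / 2 := by
      intro u
      rw [triangleHat, triangleHat, ← intervalIntegral.integral_div, ← intervalIntegral.integral_div,
        ← integral_add ((by fun_prop : Continuous _).intervalIntegrable _ _)
          ((by fun_prop : Continuous _).intervalIntegrable _ _)]
      refine integral_congr fun ρ _ => ?_
      have e1 : 2 * Real.pi * (r + u) * ρ = 2 * Real.pi * r * ρ + 2 * Real.pi * u * ρ := by ring
      have e2 : 2 * Real.pi * (r - u) * ρ = 2 * Real.pi * r * ρ - 2 * Real.pi * u * ρ := by ring
      rw [e1, e2, Real.cos_add, Real.cos_sub]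
      ring
    simp only [h2]
    have hc := continuous_triangleHat
    rw [integral_add ((by fun_prop : Continuous _).intervalIntegrable _ _)
        ((by fun_prop : Continuous _).intervalIntegrable _ _),
      intervalIntegral.integral_div, intervalIntegral.integral_div,
      intervalIntegral.integral_comp_add_left (fun v => triangleHat v) r,
      intervalIntegral.integral_comp_sub_left (fun v => triangleHat v) r]
    have e : r + -X = r - X := by ring
    have e' : r - -X = r + X := by ring
    rw [e, e']
    ring
  · have hcont : Continuous (Function.uncurry fun ρ u : ℝ =>
        (1 - |ρ|) * Real.cos (2 * Real.pi * u * ρ) * Real.cos (2 * Real.pi * r * ρ)) := by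
      unfold Function.uncurry
      fun_prop
    exact (hcont.continuousOn.integrableOn_compact (isCompact_uIcc.prod isCompact_uIcc)).mono_set
      (prod_mono uIoc_subset_uIcc uIoc_subset_uIcc)

theorem kernelHat_nonneg (hX : 0 ≤ X) (r : ℝ) : 0 ≤ kernelHat X r := by
  rw [kernelHat_eq]
  exact integral_triangleHat_nonneg (by linarith)

theorem kernelHat_le (hX : 0 ≤ X) (r : ℝ) : kernelHat X r ≤ 2 * Real.pi := by
  rw [kernelHat_eq]
  exact integral_triangleHat_le_two_pi (by linarith)

/-- The kernel is not normalized to mass 1; a lower bound uniform in X suffices to divide by its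
mass. It comes from the subinterval [1/4, 1/2] alone. -/
theorem le_kernelHat_zero (hX : 1 ≤ X) : 1 / Real.pi ^ 2 ≤ kernelHat X 0 := by
  have hi : ∀ a b : ℝ, IntervalIntegrable triangleHat volume a b :=
    fun a b => continuous_triangleHat.intervalIntegrable a b
  have hmid : 1 / Real.pi ^ 2 ≤ ∫ v in (1 / 4 : ℝ)..(1 / 2), triangleHat v := by
    have h := integral_mono_on (by norm_num : (1 / 4 : ℝ) ≤ 1 / 2)
      (intervalIntegrable_const (c := 4 / Real.pi ^ 2)) (hi _ _)
      fun v hv => le_triangleHat hv.1 hv.2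
    rw [intervalIntegral.integral_const, smul_eq_mul] at h
    refine le_trans (le_of_eq ?_) h
    ring
  rw [kernelHat_eq, ← integral_add_adjacent_intervals (hi _ (1 / 4)) (hi _ _),
    ← integral_add_adjacent_intervals (hi (1 / 4) (1 / 2)) (hi _ _)]
  have h1 := integral_triangleHat_nonneg (by linarith : 0 - X ≤ 1 / 4)
  have h2 := integral_triangleHat_nonneg (by linarith : 1 / 2 ≤ 0 + X)
  linarith

/-- The cosine transform of the kernel is close to a multiple of the indicator of `[0, X]`. -/
theorem abs_kernelHat_sub_le (hX : 1 ≤ X) {r : ℝ} (hr : 0 ≤ r) :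
    |kernelHat X r - (if r ≤ X then kernelHat X 0 else 0)| ≤ 8 / (1 + |r - X|) := by
  have hX0 : 0 ≤ X := by linarith
  have hpi := Real.pi_lt_d2
  have hi : ∀ a b : ℝ, IntervalIntegrable triangleHat volume a b :=
    fun a b => continuous_triangleHat.intervalIntegrable a b
  have hk0 := kernelHat_nonneg hX0 r
  have hk1 := kernelHat_le hX0 r
  have hz0 := kernelHat_nonneg hX0 0
  have hz1 := kernelHat_le hX0 0
  rw [le_div_iff₀ (by positivity), mul_add, mul_one]
  -- The constant 8 majorizes 2π + 1: the trivial bound plus the bound on the product with |r - X|.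
  have htriv : |kernelHat X r - (if r ≤ X then kernelHat X 0 else 0)| ≤ 2 * Real.pi := by
    rw [abs_le]
    split_ifs <;> constructor <;> linarith
  have hmul : |kernelHat X r - (if r ≤ X then kernelHat X 0 else 0)| * |r - X| ≤ 1 := by
    split_ifs with h
    · rcases h.eq_or_lt with rfl | hlt
      · simp
      -- The windows around r and around 0 differ by two intervals which, after reflecting one of
      -- them, lie in [X - r, ∞), where the integral of v⁻² is at most 1/(X - r).
      have hdiff : kernelHat X r - kernelHat X 0 =
          (∫ v in X..(r + X), triangleHat v) - ∫ v in (X - r)..X, triangleHat v := by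
        have hsymm : ∫ v in (-X)..(r - X), triangleHat v = ∫ v in (X - r)..X, triangleHat v := by
          have := intervalIntegral.integral_comp_neg (a := -X) (b := r - X) triangleHat
          simp only [triangleHat_neg, neg_neg, neg_sub] at this
          exact this
        rw [← hsymm, kernelHat_eq, kernelHat_eq, zero_sub, zero_add,
          ← integral_add_adjacent_intervals (hi (r - X) X) (hi X (r + X)),
          ← integral_add_adjacent_intervals (hi (-X) (r - X)) (hi (r - X) X)]
        ring
      have a1 := integral_triangleHat_nonneg (by linarith : X ≤ r + X)
      have a2 := integral_triangleHat_nonneg (by linarith : X - r ≤ X)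
      have a3 := integral_triangleHat_le_inv (by linarith) (by linarith : X ≤ r + X)
      have a4 := integral_triangleHat_le_inv (by linarith) (by linarith : X - r ≤ X)
      have a5 : 1 / X ≤ 1 / (X - r) := one_div_le_one_div_of_le (by linarith) (by linarith)
      have hle : |kernelHat X r - kernelHat X 0| ≤ 1 / (X - r) := by
        rw [hdiff, abs_le]
        constructor <;> linarith
      rw [abs_sub_comm r X, abs_of_pos (by linarith : 0 < X - r)]
      calc _ ≤ 1 / (X - r) * (X - r) := by gcongr
        _ = 1 := by field_simp
    · have hlt : 0 < r - X := by linarith [not_le.1 h]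
      have a1 := integral_triangleHat_le_inv hlt (by linarith : r - X ≤ r + X)
      rw [← kernelHat_eq] at a1
      rw [sub_zero, abs_of_nonneg hk0, abs_of_pos hlt]
      calc _ ≤ 1 / (r - X) * (r - X) := by gcongr
        _ = 1 := by field_simp
  linarith

/-- The sine transform of `ρ ↦ ρ * kernel X ρ`. -/
theorem integral_mul_kernel_mul_sin (X r : ℝ) :
    ∫ ρ in (-1 : ℝ)..1, ρ * kernel X ρ * Real.sin (2 * Real.pi * r * ρ) =
      (triangleHat (r - X) - triangleHat (r + X)) / (2 * Real.pi) := by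
  rw [triangleHat, triangleHat, ← integral_sub ((by fun_prop : Continuous _).intervalIntegrable _ _)
    ((by fun_prop : Continuous _).intervalIntegrable _ _), ← intervalIntegral.integral_div]
  refine integral_congr fun ρ _ => ?_
  simp only [mul_kernel]
  have e1 : 2 * Real.pi * (r + X) * ρ = 2 * Real.pi * r * ρ + 2 * Real.pi * X * ρ := by ring
  have e2 : 2 * Real.pi * (r - X) * ρ = 2 * Real.pi * r * ρ - 2 * Real.pi * X * ρ := by ring
  rw [e1, e2, Real.cos_add, Real.cos_sub]
  field_simp
  ring

theorem abs_integral_mul_kernel_mul_sin_le (hX : 0 ≤ X) {r : ℝ} (hr : 0 ≤ r) :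
    |∫ ρ in (-1 : ℝ)..1, ρ * kernel X ρ * Real.sin (2 * Real.pi * r * ρ)| ≤ 1 / (1 + |r - X|) := by
  rw [integral_mul_kernel_mul_sin, abs_div, abs_of_pos (by have := Real.pi_pos; positivity : 0 < 2 * Real.pi)]
  have h1 := triangleHat_nonneg (r - X)
  have h2 := triangleHat_nonneg (r + X)
  have h3 := triangleHat_le_abs (r - X)
  have h4 := triangleHat_le_abs (r + X)
  have h5 : 2 / (1 + |r + X|) ≤ 2 / (1 + |r - X|) := by
    have : |r - X| ≤ |r + X| := by
      rw [abs_of_nonneg (by linarith : 0 ≤ r + X), abs_le]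
      constructor <;> linarith
    gcongr
  have h6 : |triangleHat (r - X) - triangleHat (r + X)| ≤ 2 / (1 + |r - X|) := by
    rw [abs_le]; constructor <;> linarith
  have hpi := Real.two_le_pi
  calc _ ≤ 2 / (1 + |r - X|) / 2 := by gcongr; linarith
    _ = _ := by ring

/-- On [0, 1] the amplitude ρ(1 - ρ) is the difference (1 - ρ) - (1 - ρ)² of decreasing functions,
and the first-derivative test applies to each. This moment enters the average of (x + ρ)³. -/
theorem abs_integral_sq_mul_kernel_le (hX : 0 < X) :
    |∫ ρ in (-1 : ℝ)..1, ρ ^ 2 * kernel X ρ| ≤ 1 / X := by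
  have hpi := Real.pi_pos
  have hK := continuous_kernel X
  rw [integral_symm_of_even (by fun_prop) fun ρ => by rw [kernel_neg, neg_sq]]
  set k := 2 * Real.pi * X with hk
  have hk0 : 0 < k := by positivity
  have h1 := abs_integral_antitone_mul_sin_le (φ := fun v => 1 - v) (φ' := fun _ => -1)
    (a := 0) (b := 1) 0 zero_le_one hk0 (fun v _ => by simpa using (hasDerivAt_id v).const_sub 1)
    (fun _ _ => by norm_num) (by fun_prop) (by norm_num)
  have h2 := abs_integral_antitone_mul_sin_le (φ := fun v => (1 - v) ^ 2) (φ' := fun v => -(2 * (1 - v)))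
    (a := 0) (b := 1) 0 zero_le_one hk0
    (fun v _ => by
      have h : HasDerivAt (fun v : ℝ => 1 - v) (-1) v := by simpa using (hasDerivAt_id v).const_sub 1
      exact (h.pow 2).congr_deriv (by push_cast; ring))
    (fun v hv => by linarith [hv.2]) (by fun_prop) (by norm_num)
  simp only [add_zero] at h1 h2
  have e : ∫ ρ in (0 : ℝ)..1, ρ ^ 2 * kernel X ρ =
      ((∫ v in (0 : ℝ)..1, (1 - v) * Real.sin (k * v)) -
        ∫ v in (0 : ℝ)..1, (1 - v) ^ 2 * Real.sin (k * v)) / Real.pi := by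
    rw [← integral_sub ((by fun_prop : Continuous _).intervalIntegrable _ _)
      ((by fun_prop : Continuous _).intervalIntegrable _ _), ← intervalIntegral.integral_div]
    refine integral_congr fun ρ hρ => ?_
    rw [uIcc_of_le zero_le_one] at hρ
    simp only [sq ρ, mul_assoc, mul_kernel, abs_of_nonneg hρ.1]
    rw [hk, mul_assoc 2, mul_assoc 2, mul_assoc Real.pi]
    ring
  have h3 : |(∫ v in (0 : ℝ)..1, (1 - v) * Real.sin (k * v)) -
      ∫ v in (0 : ℝ)..1, (1 - v) ^ 2 * Real.sin (k * v)| ≤ 4 / k := by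
    refine (abs_sub _ _).trans ?_
    have : 4 / k = 2 * (1 - 0) / k + 2 * (1 - 0) ^ 2 / k := by ring
    linarith
  rw [e, abs_mul, abs_of_pos two_pos, abs_div, abs_of_pos hpi]
  have hpi3 := Real.pi_gt_three
  calc _ ≤ 2 * (4 / k / Real.pi) := by gcongr
    _ = 4 / Real.pi ^ 2 * (1 / X) := by rw [hk]; field_simp
    _ ≤ 1 * (1 / X) := by
        gcongr
        rw [div_le_one (by positivity)]
        nlinarith
    _ = 1 / X := one_mul _

end Kernel

end CyganKoranyi

namespace CyganKoranyi

open MeasureTheory Set intervalIntegral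

/-! ### Decay of the first and second primitives of the kernel -/

section KernelPrimitive

/-- The primitive of the smoothing kernel vanishing at `0`. -/
noncomputable def kernelPrim (X w : ℝ) : ℝ := ∫ ρ in (0 : ℝ)..w, kernel X ρ

/-- The odd function equal to the mass of the kernel on `[w, 1]` for `w > 0`. -/
noncomputable def kernelTail (X w : ℝ) : ℝ :=
  kernelPrim X 1 * (SignType.sign w : ℝ) - kernelPrim X w

/-- The primitive of `-kernelTail` vanishing at `±1`. -/
noncomputable def kernelTail₂ (X w : ℝ) : ℝ :=
  kernelPrim X 1 * (1 - |w|) - ∫ v in w..1, kernelPrim X v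

variable {X : ℝ}

theorem hasDerivAt_kernelPrim (X w : ℝ) : HasDerivAt (kernelPrim X) (kernel X w) w :=
  integral_hasDerivAt_right ((continuous_kernel X).intervalIntegrable _ _)
    ((continuous_kernel X).stronglyMeasurableAtFilter _ _) (continuous_kernel X).continuousAt

theorem continuous_kernelPrim (X : ℝ) : Continuous (kernelPrim X) :=
  continuous_iff_continuousAt.2 fun w => (hasDerivAt_kernelPrim X w).continuousAt

theorem kernelPrim_neg (X w : ℝ) : kernelPrim X (-w) = -kernelPrim X w := by
  have h := intervalIntegral.integral_comp_neg (a := 0) (b := w) (kernel X)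
  simp only [kernel_neg, neg_zero] at h
  rw [kernelPrim, kernelPrim, h, intervalIntegral.integral_symm]

theorem kernelTail_neg (X w : ℝ) : kernelTail X (-w) = -kernelTail X w := by
  rw [kernelTail, kernelTail, kernelPrim_neg, Left.sign_neg]
  push_cast
  ring

theorem kernelTail_of_pos {w : ℝ} (hw : 0 < w) : kernelTail X w = ∫ ρ in w..1, kernel X ρ := by
  have hi : ∀ a b : ℝ, IntervalIntegrable (kernel X) volume a b :=
    fun a b => (continuous_kernel X).intervalIntegrable a b
  rw [kernelTail, sign_pos hw, kernelPrim, kernelPrim,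
    ← integral_add_adjacent_intervals (hi 0 w) (hi w 1)]
  simp

theorem hasDerivAt_kernelTail {w : ℝ} (hw : w ≠ 0) :
    HasDerivAt (kernelTail X) (-kernel X w) w := by
  have hsign : ∀ᶠ v in nhds w, SignType.sign v = SignType.sign w := by
    rcases lt_or_gt_of_ne hw with h | h
    · filter_upwards [Iio_mem_nhds h] with v hv
      rw [sign_neg hv, sign_neg h]
    · filter_upwards [Ioi_mem_nhds h] with v hv
      rw [sign_pos hv, sign_pos h]
  have h := (hasDerivAt_kernelPrim X w).const_sub (kernelPrim X 1 * (SignType.sign w : ℝ))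
  refine h.congr_of_eventuallyEq ?_
  filter_upwards [hsign] with v hv
  rw [kernelTail, hv]

theorem kernelTail_one (X : ℝ) : kernelTail X 1 = 0 := by simp [kernelTail]

theorem kernelTail_neg_one (X : ℝ) : kernelTail X (-1) = 0 := by
  rw [kernelTail_neg, kernelTail_one, neg_zero]

theorem measurable_kernelTail (X : ℝ) : Measurable (kernelTail X) := by
  unfold kernelTail
  have hs : Measurable (fun w : ℝ => (SignType.sign w : ℝ)) := by
    have : (fun w : ℝ => (SignType.sign w : ℝ)) =
        fun w => if 0 < w then (1 : ℝ) else if w < 0 then -1 else 0 := by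
      funext w
      rcases lt_trichotomy w 0 with h | h | h
      · simp [sign_neg h, h, h.not_gt]
      · simp [h]
      · simp [sign_pos h, h]
    rw [this]
    exact Measurable.ite measurableSet_Ioi measurable_const
      (Measurable.ite measurableSet_Iio measurable_const measurable_const)
  exact (hs.const_mul _).sub (continuous_kernelPrim X).measurable

theorem abs_kernel_le (hX : 0 ≤ X) {ρ : ℝ} (hρ : |ρ| ≤ 1) : |kernel X ρ| ≤ 2 * X := by
  rw [kernel, abs_mul, abs_mul, abs_of_nonneg (by linarith : 0 ≤ 1 - |ρ|),
    abs_of_nonneg (by linarith : 0 ≤ 2 * X)]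
  have h1 := Real.abs_sinc_le_one (2 * Real.pi * X * ρ)
  have h2 := abs_nonneg ρ
  calc (1 - |ρ|) * (2 * X * |Real.sinc (2 * Real.pi * X * ρ)|) ≤ 1 * (2 * X * 1) := by
        gcongr; linarith
    _ = 2 * X := by ring

theorem hasDerivAt_inv_sub_one {v : ℝ} (hv : v ≠ 0) :
    HasDerivAt (fun v : ℝ => (v⁻¹ - 1) / Real.pi) (-(v ^ 2)⁻¹ / Real.pi) v :=
  ((hasDerivAt_inv hv).sub_const 1).div_const Real.pi

theorem kernel_of_pos {ρ : ℝ} (hρ : 0 < ρ) :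
    kernel X ρ = (ρ⁻¹ - 1) / Real.pi * Real.sin (2 * Real.pi * X * ρ) := by
  have h := mul_kernel X ρ
  rw [abs_of_pos hρ] at h
  have hpi := Real.pi_ne_zero
  field_simp at h ⊢
  linarith

theorem continuousOn_neg_inv_sq {w : ℝ} (hw : 0 < w) :
    ContinuousOn (fun v : ℝ => -(v ^ 2)⁻¹ / Real.pi) (Icc w 1) :=
  ((ContinuousOn.inv₀ (by fun_prop) fun v hv => pow_ne_zero 2 (hw.trans_le hv.1).ne').neg).div_const _

/-- For ρ > 0 the kernel is the decreasing amplitude (1/ρ - 1)/π times sin(2πXρ), so the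
first-derivative test gives a tail of size 1/(Xw). -/
theorem mul_abs_kernelTail_le (hX : 1 ≤ X) {w : ℝ} (hw : 0 < w) (hw1 : w ≤ 1) :
    X * w * |kernelTail X w| ≤ 1 := by
  have hpi := Real.two_le_pi
  have hk : 0 < 2 * Real.pi * X := by positivity
  have h := abs_integral_antitone_mul_sin_le (φ := fun v : ℝ => (v⁻¹ - 1) / Real.pi) 0 hw1 hk
    (fun v hv => hasDerivAt_inv_sub_one (hw.trans_le hv.1).ne')
    (fun v _ => by
      rw [neg_div]
      exact neg_nonpos.2 (by positivity)) (continuousOn_neg_inv_sq hw) (by simp)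
  have heq : kernelTail X w =
      ∫ v in w..1, (v⁻¹ - 1) / Real.pi * Real.sin (2 * Real.pi * X * v + 0) := by
    rw [kernelTail_of_pos hw]
    refine integral_congr fun v hv => ?_
    rw [uIcc_of_le hw1] at hv
    simp only [add_zero]
    exact kernel_of_pos (hw.trans_le hv.1)
  rw [← heq] at h
  have h2 : 2 * ((w⁻¹ - 1) / Real.pi) / (2 * Real.pi * X) ≤ 1 / (X * w) := by
    rw [div_le_div_iff₀ hk (by positivity)]
    have e : 2 * ((w⁻¹ - 1) / Real.pi) * (X * w) = 2 * X * (1 - w) / Real.pi := by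
      field_simp
    rw [e, div_le_iff₀ (by positivity)]
    have : 0 < X * w := by positivity
    nlinarith [mul_pos Real.pi_pos Real.pi_pos]
  calc X * w * |kernelTail X w| ≤ X * w * (1 / (X * w)) := by
        gcongr; exact h.trans h2
    _ = 1 := by field_simp

/-- Below 1/X the kernel is at most 2X on an interval shorter than 1/X, costing 2; the tail from 1/X
on is at most 1. -/
theorem abs_kernelTail_le_three (hX : 1 ≤ X) {w : ℝ} (hw : 0 < w) (hw1 : w ≤ 1) :
    |kernelTail X w| ≤ 3 := by
  have hX0 : 0 < X := by linarith
  have hinv : X⁻¹ ≤ 1 := inv_le_one_of_one_le₀ hX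
  have hinv0 : 0 < X⁻¹ := inv_pos.2 hX0
  have hXi : X * X⁻¹ = 1 := mul_inv_cancel₀ hX0.ne'
  rcases le_total X⁻¹ w with h | h
  · have h1 := mul_abs_kernelTail_le hX hw hw1
    have : 1 ≤ X * w := by rw [← hXi]; gcongr
    nlinarith [abs_nonneg (kernelTail X w)]
  · have h1 := mul_abs_kernelTail_le hX hinv0 hinv
    rw [hXi, one_mul] at h1
    have hi : ∀ a b : ℝ, IntervalIntegrable (kernel X) volume a b :=
      fun a b => (continuous_kernel X).intervalIntegrable a b
    have hsplit : kernelTail X w = (∫ ρ in w..X⁻¹, kernel X ρ) + kernelTail X X⁻¹ := by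
      rw [kernelTail_of_pos hw, kernelTail_of_pos hinv0, integral_add_adjacent_intervals (hi _ _) (hi _ _)]
    have h2 : ‖∫ ρ in w..X⁻¹, kernel X ρ‖ ≤ 2 * X * |X⁻¹ - w| := by
      refine intervalIntegral.norm_integral_le_of_norm_le_const fun ρ hρ => ?_
      rw [uIoc_of_le h] at hρ
      exact abs_kernel_le hX0.le (abs_le.2 ⟨by linarith [hρ.1], by linarith [hρ.2]⟩)
    rw [Real.norm_eq_abs, abs_of_nonneg (by linarith : 0 ≤ X⁻¹ - w)] at h2
    have h3 : 2 * X * (X⁻¹ - w) ≤ 2 := by nlinarith [mul_pos hX0 hw]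
    rw [hsplit]
    exact (abs_add_le _ _).trans (by linarith)

theorem abs_kernelTail_le (hX : 1 ≤ X) {w : ℝ} (hw : |w| ≤ 1) :
    |kernelTail X w| ≤ 4 / (1 + X * |w|) := by
  have hpos : ∀ w : ℝ, 0 < w → w ≤ 1 → |kernelTail X w| ≤ 4 / (1 + X * w) := by
    intro w h0 h1
    rw [le_div_iff₀ (by positivity)]
    linarith [mul_abs_kernelTail_le hX h0 h1, abs_kernelTail_le_three hX h0 h1]
  rcases lt_trichotomy w 0 with h | h | h
  · rw [abs_of_neg h] at hw ⊢
    have := hpos (-w) (by linarith) hw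
    rwa [kernelTail_neg, abs_neg] at this
  · simp [h, kernelTail, kernelPrim]
  · rw [abs_of_pos h] at hw ⊢
    exact hpos w h hw

theorem continuous_kernelTail₂ (X : ℝ) : Continuous (kernelTail₂ X) := by
  have hi : ∀ a b : ℝ, IntervalIntegrable (kernelPrim X) volume a b :=
    fun a b => (continuous_kernelPrim X).intervalIntegrable a b
  have h1 : Continuous fun w => ∫ v in w..1, kernelPrim X v := by
    have : (fun w => ∫ v in w..1, kernelPrim X v) = fun w => -∫ v in (1 : ℝ)..w, kernelPrim X v := by
      funext w
      rw [intervalIntegral.integral_symm]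
    rw [this]
    exact (continuous_primitive hi 1).neg
  unfold kernelTail₂
  fun_prop

theorem hasDerivAt_kernelTail₂ {w : ℝ} (hw : w ≠ 0) :
    HasDerivAt (kernelTail₂ X) (-kernelTail X w) w := by
  have h1 : HasDerivAt (fun w => ∫ v in w..1, kernelPrim X v) (-kernelPrim X w) w :=
    integral_hasDerivAt_left ((continuous_kernelPrim X).intervalIntegrable _ _)
      ((continuous_kernelPrim X).stronglyMeasurableAtFilter _ _) (continuous_kernelPrim X).continuousAt
  have h2 := (((hasDerivAt_abs hw).const_sub 1).const_mul (kernelPrim X 1)).sub h1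
  refine h2.congr_deriv ?_
  rw [kernelTail]
  ring

theorem kernelTail₂_neg (X w : ℝ) : kernelTail₂ X (-w) = kernelTail₂ X w := by
  have hi : ∀ a b : ℝ, IntervalIntegrable (kernelPrim X) volume a b :=
    fun a b => (continuous_kernelPrim X).intervalIntegrable a b
  have h0 : ∫ v in (-w)..w, kernelPrim X v = 0 := by
    have h := intervalIntegral.integral_comp_neg (a := -w) (b := w) (kernelPrim X)
    simp only [kernelPrim_neg, neg_neg, intervalIntegral.integral_neg] at h
    linarith
  rw [kernelTail₂, kernelTail₂, abs_neg, ← integral_add_adjacent_intervals (hi (-w) w) (hi w 1), h0,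
    zero_add]

theorem kernelTail₂_one (X : ℝ) : kernelTail₂ X 1 = 0 := by simp [kernelTail₂]

theorem kernelTail₂_neg_one (X : ℝ) : kernelTail₂ X (-1) = 0 := by
  rw [kernelTail₂_neg, kernelTail₂_one]

theorem kernelTail₂_sub {a b : ℝ} (ha : 0 < a) (hab : a ≤ b) :
    kernelTail₂ X a - kernelTail₂ X b = ∫ v in a..b, kernelTail X v := by
  have hne : ∀ v ∈ uIcc a b, v ≠ 0 := by
    intro v hv
    rw [uIcc_of_le hab] at hv
    exact (ha.trans_le hv.1).ne'
  have hc : ContinuousOn (kernelTail X) (uIcc a b) := fun v hv =>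
    (hasDerivAt_kernelTail (hne v hv)).continuousAt.continuousWithinAt
  have h := integral_eq_sub_of_hasDerivAt (fun v hv => hasDerivAt_kernelTail₂ (X := X) (hne v hv))
    hc.intervalIntegrable.neg
  rw [intervalIntegral.integral_neg] at h
  linarith

/-- Two integrations by parts in the tail of the kernel. -/
theorem abs_kernelTail_sub_le (hX : 1 ≤ X) {w : ℝ} (hw : 0 < w) (hw1 : w ≤ 1) :
    |kernelTail X w - (w⁻¹ - 1) / Real.pi * Real.cos (2 * Real.pi * X * w) / (2 * Real.pi * X)| ≤
      (w ^ 2)⁻¹ / (2 * X ^ 2) := by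
  have hpi := Real.two_le_pi
  have hk : 0 < 2 * Real.pi * X := by positivity
  set k := 2 * Real.pi * X with hkdef
  have hne : ∀ v ∈ uIcc w 1, v ≠ 0 := by
    intro v hv
    rw [uIcc_of_le hw1] at hv
    exact (hw.trans_le hv.1).ne'
  have hd : ∀ v ∈ uIcc w 1, HasDerivAt
      (fun v => -((v⁻¹ - 1) / Real.pi * Real.cos (k * v) / k))
      ((v ^ 2)⁻¹ * Real.cos (k * v) / (Real.pi * k) + kernel X v) v := by
    intro v hv
    have hkv : HasDerivAt (fun v : ℝ => k * v) k v := by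
      simpa using (hasDerivAt_id v).const_mul k
    have hv0 : 0 < v := by
      rw [uIcc_of_le hw1] at hv
      exact hw.trans_le hv.1
    refine (((hasDerivAt_inv_sub_one (hne v hv)).mul hkv.cos).div_const k).neg.congr_deriv ?_
    rw [kernel_of_pos hv0, ← hkdef]
    field_simp
    ring
  have hi1 : IntervalIntegrable (fun v : ℝ => (v ^ 2)⁻¹ * Real.cos (k * v) / (Real.pi * k)) volume w 1 := by
    apply ContinuousOn.intervalIntegrable
    exact ((ContinuousOn.inv₀ (by fun_prop) fun v hv => pow_ne_zero 2 (hne v hv)).mul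
      (by fun_prop)).div_const _
  have h := integral_eq_sub_of_hasDerivAt hd (hi1.add ((continuous_kernel X).intervalIntegrable _ _))
  rw [integral_add hi1 ((continuous_kernel X).intervalIntegrable _ _), ← kernelTail_of_pos hw,
    intervalIntegral.integral_div] at h
  have heq : kernelTail X w - (w⁻¹ - 1) / Real.pi * Real.cos (k * w) / k =
      -((∫ v in w..1, (v ^ 2)⁻¹ * Real.cos (k * v)) / (Real.pi * k)) := by
    simp only [inv_one, sub_self, zero_div, zero_mul, neg_zero, zero_sub, neg_neg] at h
    linarith
  have hdd : ∀ v ∈ Icc w 1, HasDerivAt (fun v : ℝ => (v ^ 2)⁻¹) (-(2 * v) / (v ^ 2) ^ 2) v := by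
    intro v hv
    have hv0 : v ≠ 0 := (hw.trans_le hv.1).ne'
    have := (hasDerivAt_pow 2 v).inv (pow_ne_zero 2 hv0)
    exact this.congr_deriv (by simp)
  have hosc := abs_integral_antitone_mul_cos_le hw1 hk hdd
    (fun v hv => by
      have : 0 < v := hw.trans_le hv.1
      rw [neg_div]
      exact neg_nonpos.2 (by positivity))
    (ContinuousOn.div (by fun_prop) (by fun_prop)
      fun v hv => pow_ne_zero 2 (pow_ne_zero 2 (hw.trans_le hv.1).ne')) (by norm_num)
  rw [heq, abs_neg, abs_div, abs_of_pos (by positivity : 0 < Real.pi * k)]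
  calc _ ≤ (2 * (w ^ 2)⁻¹ / k) / (Real.pi * k) := by gcongr
    _ = (w ^ 2)⁻¹ / (2 * X ^ 2) * (1 / Real.pi ^ 3) := by
        rw [hkdef]; field_simp
    _ ≤ (w ^ 2)⁻¹ / (2 * X ^ 2) * 1 := by
        gcongr
        rw [div_le_one (by positivity)]
        exact one_le_pow₀ (by linarith)
    _ = _ := mul_one _

/-- The leading term of `abs_kernelTail_sub_le` still oscillates, so integrating it gains a second
factor 1/X; its remainder is integrated absolutely. Each accounts for half of the bound. -/
theorem mul_abs_kernelTail₂_le (hX : 1 ≤ X) {w : ℝ} (hw : 0 < w) (hw1 : w ≤ 1) :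
    X ^ 2 * w * |kernelTail₂ X w| ≤ 1 := by
  have hpi := Real.two_le_pi
  have hX0 : 0 < X := by linarith
  have hk : 0 < 2 * Real.pi * X := by positivity
  set k := 2 * Real.pi * X with hkdef
  have hne : ∀ v ∈ uIcc w 1, v ≠ 0 := by
    intro v hv
    rw [uIcc_of_le hw1] at hv
    exact (hw.trans_le hv.1).ne'
  have hct : IntervalIntegrable (kernelTail X) volume w 1 := by
    apply ContinuousOn.intervalIntegrable
    exact fun v hv => (hasDerivAt_kernelTail (hne v hv)).continuousAt.continuousWithinAt
  have hinvc : ContinuousOn (fun v : ℝ => (v⁻¹ - 1) / Real.pi) (uIcc w 1) :=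
    ((ContinuousOn.inv₀ continuousOn_id hne).sub continuousOn_const).div_const _
  have hcm : IntervalIntegrable (fun v => (v⁻¹ - 1) / Real.pi * Real.cos (k * v)) volume w 1 := by
    apply ContinuousOn.intervalIntegrable
    exact hinvc.mul (by fun_prop)
  have hmain := abs_integral_antitone_mul_cos_le (φ := fun v : ℝ => (v⁻¹ - 1) / Real.pi) hw1 hk
    (fun v hv => hasDerivAt_inv_sub_one (hw.trans_le hv.1).ne')
    (fun v _ => by
      rw [neg_div]
      exact neg_nonpos.2 (by positivity)) (continuousOn_neg_inv_sq hw) (by simp)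
  have hsq : IntervalIntegrable (fun v : ℝ => (v ^ 2)⁻¹) volume w 1 := by
    apply ContinuousOn.intervalIntegrable
    exact ContinuousOn.inv₀ (by fun_prop) fun v hv => pow_ne_zero 2 (hne v hv)
  have hsqint : ∫ v in w..1, (v ^ 2)⁻¹ = w⁻¹ - 1 := by
    have hd : ∀ v ∈ uIcc w 1, HasDerivAt (fun v : ℝ => -v⁻¹) ((v ^ 2)⁻¹) v :=
      fun v hv => (hasDerivAt_inv (hne v hv)).neg.congr_deriv (by simp)
    rw [integral_eq_sub_of_hasDerivAt hd hsq, inv_one]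
    ring
  have hrem : |∫ v in w..1, (kernelTail X v - (v⁻¹ - 1) / Real.pi * Real.cos (k * v) / k)| ≤
      (w⁻¹ - 1) / (2 * X ^ 2) := by
    rw [← hsqint, ← intervalIntegral.integral_div]
    refine (abs_integral_le_integral_abs hw1).trans ?_
    exact integral_mono_on hw1 (hct.sub (hcm.div_const k)).abs (hsq.div_const _)
      fun v hv => abs_kernelTail_sub_le hX (hw.trans_le hv.1) hv.2
  rw [integral_sub hct (hcm.div_const k), intervalIntegral.integral_div] at hrem
  have hT : kernelTail₂ X w = ∫ v in w..1, kernelTail X v := by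
    rw [← kernelTail₂_sub hw hw1, kernelTail₂_one, sub_zero]
  rw [← hT] at hrem
  have hmain' : |(∫ v in w..1, (v⁻¹ - 1) / Real.pi * Real.cos (k * v)) / k| ≤ (w⁻¹ - 1) / (2 * X ^ 2) := by
    rw [abs_div, abs_of_pos hk]
    have hw' : 0 ≤ w⁻¹ - 1 := by linarith [(one_le_inv₀ hw).2 hw1]
    calc _ ≤ 2 * ((w⁻¹ - 1) / Real.pi) / k / k := by gcongr
      _ = (w⁻¹ - 1) / (2 * X ^ 2) * (1 / Real.pi ^ 3) := by rw [hkdef]; field_simp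
      _ ≤ (w⁻¹ - 1) / (2 * X ^ 2) * 1 := by
        gcongr
        rw [div_le_one (by positivity)]
        exact one_le_pow₀ (by linarith)
      _ = _ := mul_one _
  have htot : |kernelTail₂ X w| ≤ (w⁻¹ - 1) / X ^ 2 := by
    have e : (w⁻¹ - 1) / X ^ 2 = (w⁻¹ - 1) / (2 * X ^ 2) + (w⁻¹ - 1) / (2 * X ^ 2) := by
      field_simp; ring
    rw [e, abs_le]
    rw [abs_le] at hrem hmain'
    constructor <;> linarith
  calc X ^ 2 * w * |kernelTail₂ X w| ≤ X ^ 2 * w * ((w⁻¹ - 1) / X ^ 2) := by gcongr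
    _ = 1 - w := by field_simp
    _ ≤ 1 := by linarith

theorem mul_abs_kernelTail₂_le_four (hX : 1 ≤ X) {w : ℝ} (hw : 0 < w) (hw1 : w ≤ 1) :
    X * |kernelTail₂ X w| ≤ 4 := by
  have hX0 : 0 < X := by linarith
  have hinv : X⁻¹ ≤ 1 := inv_le_one_of_one_le₀ hX
  have hinv0 : 0 < X⁻¹ := inv_pos.2 hX0
  have hXi : X * X⁻¹ = 1 := mul_inv_cancel₀ hX0.ne'
  rcases le_total X⁻¹ w with h | h
  · have h1 := mul_abs_kernelTail₂_le hX hw hw1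
    have h2 : 1 ≤ X * w := by rw [← hXi]; gcongr
    have h3 : 0 ≤ X * |kernelTail₂ X w| := by positivity
    nlinarith
  · have h1 := mul_abs_kernelTail₂_le hX hinv0 hinv
    have e : X ^ 2 * X⁻¹ = X := by field_simp
    rw [e] at h1
    have hsplit := kernelTail₂_sub (X := X) hw h
    have h2 : ‖∫ ρ in w..X⁻¹, kernelTail X ρ‖ ≤ 3 * |X⁻¹ - w| := by
      refine intervalIntegral.norm_integral_le_of_norm_le_const fun ρ hρ => ?_
      rw [uIoc_of_le h] at hρ
      exact abs_kernelTail_le_three hX (hw.trans hρ.1) (hρ.2.trans hinv)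
    rw [Real.norm_eq_abs, abs_of_nonneg (by linarith : 0 ≤ X⁻¹ - w), ← hsplit] at h2
    have h3 : |kernelTail₂ X w| ≤ |kernelTail₂ X X⁻¹| + 3 * (X⁻¹ - w) := by
      have := abs_sub_abs_le_abs_sub (kernelTail₂ X w) (kernelTail₂ X X⁻¹)
      linarith
    have h4 : X * (|kernelTail₂ X X⁻¹| + 3 * (X⁻¹ - w)) ≤ 4 := by
      have : 0 < X * w := by positivity
      nlinarith
    exact (mul_le_mul_of_nonneg_left h3 hX0.le).trans h4

theorem abs_kernelTail₂_le (hX : 1 ≤ X) {w : ℝ} (hw : |w| ≤ 1) :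
    |kernelTail₂ X w| ≤ 5 / (X * (1 + X * |w|)) := by
  have hX0 : 0 < X := by linarith
  have hpos : ∀ w : ℝ, 0 < w → w ≤ 1 → |kernelTail₂ X w| ≤ 5 / (X * (1 + X * w)) := by
    intro w h0 h1
    rw [le_div_iff₀ (by positivity)]
    linarith [mul_abs_kernelTail₂_le hX h0 h1, mul_abs_kernelTail₂_le_four hX h0 h1]
  rcases lt_trichotomy w 0 with h | h | h
  · rw [abs_of_neg h] at hw ⊢
    have := hpos (-w) (by linarith) hw
    rwa [kernelTail₂_neg] at this
  · subst h
    -- The first primitive jumps at 0 but the second is continuous, so the bound passes to the limit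
    -- from the right.
    have hcont : ContinuousWithinAt (fun w => |kernelTail₂ X w|) (Ioi 0) 0 :=
      (continuous_kernelTail₂ X).abs.continuousWithinAt
    simp only [abs_zero, mul_zero, add_zero, mul_one]
    refine le_of_tendsto hcont ?_
    filter_upwards [Ioc_mem_nhdsGT zero_lt_one] with v hv
    refine (hpos v hv.1 hv.2).trans ?_
    have := hv.1
    gcongr
    nlinarith [mul_pos hX0 this]
  · rw [abs_of_pos h] at hw ⊢
    exact hpos w h hw

end KernelPrimitive

end CyganKoranyi

namespace CyganKoranyi

open MeasureTheory Set intervalIntegral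

/-! ### The change of a single lattice term under smoothing -/

section SmoothingError

/-- The slice profile `ρ ↦ √((x + ρ)² - n)`. -/
noncomputable def shifted (x n ρ : ℝ) : ℝ := √((x + ρ) ^ 2 - n)

/-- The effect of the smoothing kernel on the profile at `n`. -/
noncomputable def smoothingError (X x n : ℝ) : ℝ :=
  ∫ ρ in (-1 : ℝ)..1, (shifted x n ρ - shifted x n 0) * kernel X ρ

variable {X x n : ℝ}

theorem continuous_shifted (x n : ℝ) : Continuous (shifted x n) := by
  unfold shifted
  fun_prop

theorem monotoneOn_shifted (hx : 1 < x) (n : ℝ) : MonotoneOn (shifted x n) (Icc (-1) 1) := by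
  intro a ha b _ hab
  apply Real.sqrt_le_sqrt
  have := ha.1
  nlinarith

theorem hasDerivAt_shifted {ρ : ℝ} (h : 0 < (x + ρ) ^ 2 - n) :
    HasDerivAt (shifted x n) ((x + ρ) / √((x + ρ) ^ 2 - n)) ρ := by
  have h1 : HasDerivAt (fun ρ : ℝ => (x + ρ) ^ 2 - n) (2 * (x + ρ)) ρ := by
    have := (((hasDerivAt_id ρ).const_add x).pow 2).sub_const n
    simpa using this
  refine (h1.sqrt h.ne').congr_deriv ?_
  have : 0 < √((x + ρ) ^ 2 - n) := Real.sqrt_pos.2 h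
  field_simp

theorem hasDerivAt_shifted_of_neg {ρ : ℝ} (h : (x + ρ) ^ 2 - n < 0) :
    HasDerivAt (shifted x n) 0 ρ := by
  refine (hasDerivAt_const ρ (0 : ℝ)).congr_of_eventuallyEq ?_
  have hc : Continuous fun ρ : ℝ => (x + ρ) ^ 2 - n := by fun_prop
  filter_upwards [hc.continuousAt.eventually_lt_const h] with v hv
  exact Real.sqrt_eq_zero_of_nonpos hv.le

theorem hasDerivAt_shifted_deriv (hx : 1 < x) {ρ : ℝ} (h1 : -1 ≤ ρ) (h : ρ ≠ √n - x) :
    HasDerivAt (shifted x n) (deriv (shifted x n) ρ) ρ := by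
  have hne : (x + ρ) ^ 2 - n ≠ 0 := by
    intro h0
    apply h
    have : √n = x + ρ := by
      rw [show n = (x + ρ) ^ 2 by linarith, Real.sqrt_sq (by linarith)]
    linarith
  rcases lt_or_gt_of_ne hne with h' | h'
  · exact (hasDerivAt_shifted_of_neg h').differentiableAt.hasDerivAt
  · exact (hasDerivAt_shifted h').differentiableAt.hasDerivAt

/-- The derivative may have an inverse square root singularity at ρ = √n - x; monotonicity of the
profile gives integrability without a local analysis. -/
theorem intervalIntegrable_deriv_shifted (hx : 1 < x) (n : ℝ) {a b : ℝ} (ha : a ∈ Icc (-1 : ℝ) 1)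
    (hb : b ∈ Icc (-1 : ℝ) 1) : IntervalIntegrable (deriv (shifted x n)) volume a b :=
  ((monotoneOn_shifted hx n).mono (uIcc_subset_Icc ha hb)).intervalIntegrable_deriv

theorem intervalIntegrable_mul_kernelTail (hX : 1 ≤ X) {f : ℝ → ℝ} {a b : ℝ}
    (ha : a ∈ Icc (-1 : ℝ) 1) (hb : b ∈ Icc (-1 : ℝ) 1) (hf : IntervalIntegrable f volume a b) :
    IntervalIntegrable (fun ρ => f ρ * kernelTail X ρ) volume a b := by
  rw [intervalIntegrable_iff] at hf ⊢
  refine Integrable.mul_bdd (c := 4) hf (measurable_kernelTail X).aestronglyMeasurable ?_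
  filter_upwards [ae_restrict_mem measurableSet_uIoc] with ρ hρ
  have hρ' : ρ ∈ Icc (-1 : ℝ) 1 := uIcc_subset_Icc ha hb (uIoc_subset_uIcc hρ)
  have hρ1 : |ρ| ≤ 1 := abs_le.2 hρ'
  refine (abs_kernelTail_le hX hρ1).trans ?_
  apply div_le_self (by norm_num)
  have : 0 ≤ X * |ρ| := by positivity
  linarith

/-- Integration by parts. Boundary terms vanish because the tail is zero at ±1, and its jump at 0 is
cancelled by the factor `shifted x n ρ - shifted x n 0`. -/
theorem smoothingError_eq (hX : 1 ≤ X) (hx : 1 < x) (n : ℝ) :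
    smoothingError X x n = ∫ ρ in (-1 : ℝ)..1, deriv (shifted x n) ρ * kernelTail X ρ := by
  have hb := continuous_shifted x n
  set b := shifted x n with hbdef
  have hm1 : (-1 : ℝ) ∈ Icc (-1 : ℝ) 1 := by norm_num
  have hp1 : (1 : ℝ) ∈ Icc (-1 : ℝ) 1 := by norm_num
  have hi1 := intervalIntegrable_mul_kernelTail hX hm1 hp1 (intervalIntegrable_deriv_shifted hx n hm1 hp1)
  have hi2 : IntervalIntegrable (fun ρ => (b ρ - b 0) * kernel X ρ) volume (-1) 1 := by
    have := continuous_kernel X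
    exact (by fun_prop : Continuous _).intervalIntegrable _ _
  have hcont : ContinuousOn (fun ρ => (b ρ - b 0) * kernelTail X ρ) (uIcc (-1) 1) := by
    intro ρ hρ
    rw [uIcc_of_le (by norm_num)] at hρ ⊢
    rcases eq_or_ne ρ 0 with rfl | h0
    · apply ContinuousAt.continuousWithinAt
      have hz : Filter.Tendsto (fun ρ => |b ρ - b 0| * 4) (nhds 0) (nhds 0) := by
        have : Continuous fun ρ => |b ρ - b 0| * 4 := by fun_prop
        simpa using this.tendsto 0
      show Filter.Tendsto _ _ _
      simp only [sub_self, zero_mul]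
      refine squeeze_zero_norm' ?_ hz
      filter_upwards [Icc_mem_nhds (by norm_num : (-1 : ℝ) < 0) zero_lt_one] with v hv
      rw [norm_mul, Real.norm_eq_abs, Real.norm_eq_abs]
      gcongr
      refine (abs_kernelTail_le hX (abs_le.2 hv)).trans (div_le_self (by norm_num) ?_)
      have : 0 ≤ X * |v| := by positivity
      linarith
    · exact ((hb.continuousAt.sub continuousAt_const).mul
        (hasDerivAt_kernelTail h0).continuousAt).continuousWithinAt
  have hd : ∀ ρ ∈ Ioo (min (-1 : ℝ) 1) (max (-1) 1) \ {0, √n - x},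
      HasDerivAt (fun ρ => (b ρ - b 0) * kernelTail X ρ)
        (deriv b ρ * kernelTail X ρ - (b ρ - b 0) * kernel X ρ) ρ := by
    rintro ρ ⟨hρ, hs⟩
    rw [min_eq_left (by norm_num), max_eq_right (by norm_num)] at hρ
    simp only [mem_insert_iff, mem_singleton_iff, not_or] at hs
    refine (((hasDerivAt_shifted_deriv hx hρ.1.le hs.2).sub_const (b 0)).mul
      (hasDerivAt_kernelTail hs.1)).congr_deriv ?_
    rw [hbdef]
    ring
  have h := integral_eq_of_hasDerivAt_off_countable _ _ (Set.toFinite {0, √n - x}).countable hcont hd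
    (hi1.sub hi2)
  rw [integral_sub hi1 hi2, kernelTail_one, kernelTail_neg_one] at h
  rw [smoothingError]
  simp only [mul_zero, sub_zero] at h
  linarith

/-- The profile is increasing, so its derivative integrates to the total increase despite the
singularity; where (x + ρ)² < n it is constant and no bound on the tail is needed. -/
theorem abs_integral_left_le (hX : 1 ≤ X) (hx : 1 < x) {α S : ℝ} (hα : α ∈ Icc (-1 : ℝ) 1)
    (hS : ∀ ρ ∈ Ioc (-1) α, 0 < (x + ρ) ^ 2 - n → |kernelTail X ρ| ≤ S) :
    |∫ ρ in (-1 : ℝ)..α, deriv (shifted x n) ρ * kernelTail X ρ| ≤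
      S * (shifted x n α - shifted x n (-1)) := by
  have hm1 : (-1 : ℝ) ∈ Icc (-1 : ℝ) 1 := by norm_num
  have hi := intervalIntegrable_deriv_shifted hx n hm1 hα
  have hi1 := intervalIntegrable_mul_kernelTail hX hm1 hα hi
  have hFTC : ∫ ρ in (-1 : ℝ)..α, deriv (shifted x n) ρ = shifted x n α - shifted x n (-1) := by
    refine integral_eq_of_hasDerivAt_off_countable _ _ (countable_singleton (√n - x))
      (continuous_shifted x n).continuousOn ?_ hi
    rintro ρ ⟨hρ, hs⟩
    rw [min_eq_left hα.1] at hρ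
    exact hasDerivAt_shifted_deriv hx hρ.1.le hs
  rw [← hFTC, ← intervalIntegral.integral_const_mul]
  refine (abs_integral_le_integral_abs hα.1).trans ?_
  refine integral_mono_ae_restrict hα.1 hi1.abs (hi.const_mul S) ?_
  have hae : ∀ᵐ ρ : ℝ, ρ ≠ √n - x ∧ ρ ≠ -1 := by
    have h1 : ∀ c : ℝ, ∀ᵐ ρ : ℝ, ρ ≠ c := fun c => by simp [ae_iff, measure_singleton]
    exact (h1 _).and (h1 _)
  filter_upwards [ae_restrict_mem measurableSet_Icc, ae_restrict_of_ae hae] with ρ hρ hne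
  have hρ1 : ρ ∈ Ioc (-1) α := ⟨lt_of_le_of_ne hρ.1 (Ne.symm hne.2), hρ.2⟩
  have hσ : (x + ρ) ^ 2 - n ≠ 0 := by
    intro h0
    apply hne.1
    have : √n = x + ρ := by
      rw [show n = (x + ρ) ^ 2 by linarith, Real.sqrt_sq (by linarith [hρ.1])]
    linarith
  rcases lt_or_gt_of_ne hσ with h | h
  · rw [(hasDerivAt_shifted_of_neg h).deriv]
    simp
  · rw [(hasDerivAt_shifted h).deriv, abs_mul, mul_comm S]
    have hnn : 0 ≤ (x + ρ) / √((x + ρ) ^ 2 - n) :=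
      div_nonneg (by linarith [hρ.1]) (Real.sqrt_nonneg _)
    rw [abs_of_nonneg hnn]
    gcongr
    exact hS ρ hρ1 h

/-- Away from the singularity a second integration by parts is possible; with σ = (x + ρ)² - n, the
derivative of (x + ρ)/√σ is -n·σ^(-3/2). -/
theorem integral_right_eq (hX : 1 ≤ X) (hx : 1 < x) {α : ℝ} (hα : α ∈ Icc (-1 : ℝ) 1)
    (h1 : 1 ≤ (x + α) ^ 2 - n) :
    ∫ ρ in α..1, deriv (shifted x n) ρ * kernelTail X ρ =
      (x + α) / √((x + α) ^ 2 - n) * kernelTail₂ X α +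
        ∫ ρ in α..1, -n / (((x + ρ) ^ 2 - n) * √((x + ρ) ^ 2 - n)) * kernelTail₂ X ρ := by
  have hu : uIcc α 1 = Icc α 1 := uIcc_of_le hα.2
  have hpos : ∀ ρ ∈ Icc α 1, 1 ≤ (x + ρ) ^ 2 - n := by
    intro ρ hρ
    have := hα.1
    have := hρ.1
    nlinarith
  have hsq : ∀ ρ ∈ Icc α 1, 0 < √((x + ρ) ^ 2 - n) := fun ρ hρ =>
    Real.sqrt_pos.2 (by linarith [hpos ρ hρ])
  set g : ℝ → ℝ := fun ρ => (x + ρ) / √((x + ρ) ^ 2 - n) with hg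
  set g' : ℝ → ℝ := fun ρ => -n / (((x + ρ) ^ 2 - n) * √((x + ρ) ^ 2 - n)) with hg'
  have hgd : ∀ ρ ∈ Icc α 1, HasDerivAt g (g' ρ) ρ := by
    intro ρ hρ
    have hs := hsq ρ hρ
    have hp := hpos ρ hρ
    have e := Real.sq_sqrt (by linarith : 0 ≤ (x + ρ) ^ 2 - n)
    have hnum : HasDerivAt (fun ρ : ℝ => x + ρ) 1 ρ := (hasDerivAt_id ρ).const_add x
    have hden : HasDerivAt (fun ρ => √((x + ρ) ^ 2 - n)) ((x + ρ) / √((x + ρ) ^ 2 - n)) ρ :=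
      hasDerivAt_shifted (by linarith)
    refine (hnum.div hden hs.ne').congr_deriv ?_
    simp only [hg']
    set s := √((x + ρ) ^ 2 - n)
    have e' : -n = s ^ 2 - (x + ρ) ^ 2 := by rw [e]; ring
    rw [e', ← e]
    field_simp
  have hgc : ContinuousOn g (Icc α 1) := fun ρ hρ => (hgd ρ hρ).continuousAt.continuousWithinAt
  have hg'c : ContinuousOn g' (Icc α 1) := by
    refine ContinuousOn.div (by fun_prop) (by fun_prop) fun ρ hρ => ?_
    exact mul_ne_zero (by linarith [hpos ρ hρ]) (hsq ρ hρ).ne'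
  have hgi : IntervalIntegrable g volume α 1 := (hu ▸ hgc : ContinuousOn g (uIcc α 1)).intervalIntegrable
  have hp1 : (1 : ℝ) ∈ Icc (-1 : ℝ) 1 := by norm_num
  have hi1 := intervalIntegrable_mul_kernelTail hX hα hp1 hgi
  have hi2 : IntervalIntegrable (fun ρ => g' ρ * kernelTail₂ X ρ) volume α 1 := by
    apply ContinuousOn.intervalIntegrable
    rw [hu]
    exact hg'c.mul (continuous_kernelTail₂ X).continuousOn
  have hcont : ContinuousOn (fun ρ => g ρ * kernelTail₂ X ρ) (uIcc α 1) := by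
    rw [hu]
    exact hgc.mul (continuous_kernelTail₂ X).continuousOn
  have hd : ∀ ρ ∈ Ioo (min α 1) (max α 1) \ {0},
      HasDerivAt (fun ρ => g ρ * kernelTail₂ X ρ) (g' ρ * kernelTail₂ X ρ - g ρ * kernelTail X ρ) ρ := by
    rintro ρ ⟨hρ, hs⟩
    rw [min_eq_left hα.2, max_eq_right hα.2] at hρ
    refine ((hgd ρ ⟨hρ.1.le, hρ.2.le⟩).mul (hasDerivAt_kernelTail₂ hs)).congr_deriv ?_
    ring
  have h := integral_eq_of_hasDerivAt_off_countable _ _ (countable_singleton (0 : ℝ)) hcont hd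
    (hi2.sub hi1)
  rw [integral_sub hi2 hi1, kernelTail₂_one] at h
  have hcongr : ∫ ρ in α..1, deriv (shifted x n) ρ * kernelTail X ρ = ∫ ρ in α..1, g ρ * kernelTail X ρ := by
    refine integral_congr fun ρ hρ => ?_
    rw [hu] at hρ
    rw [(hasDerivAt_shifted (by linarith [hpos ρ hρ])).deriv]
  rw [hcongr]
  simp only [hg] at h ⊢
  linarith

/-- The weight `σ^{-3/2}` for `σ = (x + ρ)² - n ≥ 1`. -/
noncomputable def tailWeight (x n ρ : ℝ) : ℝ :=
  if 1 ≤ (x + ρ) ^ 2 - n then (((x + ρ) ^ 2 - n) * √((x + ρ) ^ 2 - n))⁻¹ else 0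

theorem tailWeight_nonneg (x n ρ : ℝ) : 0 ≤ tailWeight x n ρ := by
  unfold tailWeight
  split_ifs with h
  · have : 0 ≤ (x + ρ) ^ 2 - n := by linarith
    positivity
  · exact le_rfl

theorem tailWeight_le_one (x n ρ : ℝ) : tailWeight x n ρ ≤ 1 := by
  unfold tailWeight
  split_ifs with h
  · exact inv_le_one_of_one_le₀ (one_le_mul_of_one_le_of_one_le h (Real.one_le_sqrt.2 h))
  · exact zero_le_one

theorem measurable_tailWeight (x n : ℝ) : Measurable (tailWeight x n) := by
  unfold tailWeight
  refine Measurable.ite (measurableSet_le measurable_const (by fun_prop)) (by fun_prop) measurable_const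

theorem intervalIntegrable_tailWeight (hX : 0 ≤ X) (x n a b : ℝ) :
    IntervalIntegrable (fun ρ => tailWeight x n ρ / (1 + X * |ρ|)) volume a b := by
  have hc : Continuous fun ρ : ℝ => (1 + X * |ρ|)⁻¹ :=
    Continuous.inv₀ (by fun_prop) fun ρ => by positivity
  have hi := hc.intervalIntegrable (μ := volume) a b
  rw [intervalIntegrable_iff] at hi ⊢
  refine (Integrable.bdd_mul (c := 1) hi (measurable_tailWeight x n).aestronglyMeasurable ?_)
  filter_upwards with ρ
  rw [Real.norm_eq_abs, abs_of_nonneg (tailWeight_nonneg _ _ _)]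
  exact tailWeight_le_one _ _ _

/-- In the transition zone n is within 1 of (x + ρ)², which is within 5X|ρ| of x². Decay in X|ρ|
thus becomes decay in |n - x²|. -/
theorem one_add_abs_sub_le (hX : 2 ≤ X) (hx2 : x ≤ 2 * X) (hx1 : X ≤ x) {ρ : ℝ} (hρ : |ρ| ≤ 1)
    (h0 : 0 ≤ (x + ρ) ^ 2 - n) (h1 : (x + ρ) ^ 2 - n ≤ 1) :
    1 + |n - x ^ 2| ≤ 10 * (1 + X * |ρ|) := by
  have e : (x + ρ) ^ 2 - x ^ 2 = ρ * (2 * x + ρ) := by ring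
  have h2 : |(x + ρ) ^ 2 - x ^ 2| ≤ |ρ| * (5 * X) := by
    rw [e, abs_mul]
    gcongr
    rw [abs_le] at hρ
    rw [abs_le]
    constructor <;> linarith [hρ.1, hρ.2]
  have h3 : |n - x ^ 2| ≤ |(x + ρ) ^ 2 - x ^ 2| + 1 := by
    have : n - x ^ 2 = ((x + ρ) ^ 2 - x ^ 2) - ((x + ρ) ^ 2 - n) := by ring
    rw [this]
    refine (abs_sub _ _).trans ?_
    rw [abs_of_nonneg h0]
    linarith
  have : 0 ≤ X * |ρ| := by positivity
  nlinarith

/-- The range is split where σ = (x + ρ)² - n equals 1. To the left √σ grows by at most 1 and the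
first primitive is used (40 = 4·10); to the right the second primitive gives a boundary term (150 =
3·5·10) and the weighted integral (45 = 9·5). -/
theorem abs_smoothingError_le (hX : 2 ≤ X) (hx1 : X ≤ x) (hx2 : x ≤ 2 * X) (hn : 0 ≤ n) :
    |smoothingError X x n| ≤ 190 / (1 + |n - x ^ 2|) +
      45 * X * ∫ ρ in (-1 : ℝ)..1, tailWeight x n ρ / (1 + X * |ρ|) := by
  have hX1 : 1 ≤ X := by linarith
  have hx : 1 < x := by linarith
  have hm1 : (-1 : ℝ) ∈ Icc (-1 : ℝ) 1 := by norm_num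
  have hp1 : (1 : ℝ) ∈ Icc (-1 : ℝ) 1 := by norm_num
  have hint0 : ∀ a b : ℝ, a ≤ b → 0 ≤ ∫ ρ in a..b, tailWeight x n ρ / (1 + X * |ρ|) := fun a b hab =>
    integral_nonneg hab fun ρ _ => div_nonneg (tailWeight_nonneg _ _ _) (by positivity)
  have hT : ∀ ρ : ℝ, |ρ| ≤ 1 → 0 ≤ (x + ρ) ^ 2 - n → (x + ρ) ^ 2 - n ≤ 1 →
      1 / (1 + X * |ρ|) ≤ 10 / (1 + |n - x ^ 2|) := by
    intro ρ hρ h0 h1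
    rw [div_le_div_iff₀ (by positivity) (by positivity), one_mul]
    exact one_add_abs_sub_le hX hx2 hx1 hρ h0 h1
  have hleft : ∀ α ∈ Icc (-1 : ℝ) 1, (x + α) ^ 2 - n ≤ 1 →
      |∫ ρ in (-1 : ℝ)..α, deriv (shifted x n) ρ * kernelTail X ρ| ≤ 40 / (1 + |n - x ^ 2|) := by
    intro α hα hα1
    refine (abs_integral_left_le hX1 hx hα (S := 40 / (1 + |n - x ^ 2|)) ?_).trans ?_
    · intro ρ hρ hσ
      have hρ1 : |ρ| ≤ 1 := abs_le.2 ⟨hρ.1.le, hρ.2.trans hα.2⟩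
      have hσ1 : (x + ρ) ^ 2 - n ≤ 1 := by nlinarith [hρ.1, hρ.2]
      have h := hT ρ hρ1 hσ.le hσ1
      calc _ ≤ 4 / (1 + X * |ρ|) := abs_kernelTail_le hX1 hρ1
        _ = 4 * (1 / (1 + X * |ρ|)) := by ring
        _ ≤ 4 * (10 / (1 + |n - x ^ 2|)) := by gcongr
        _ = _ := by ring
    · apply mul_le_of_le_one_right (by positivity)
      have h1 : shifted x n α ≤ 1 := Real.sqrt_le_one.2 hα1
      have h2 : 0 ≤ shifted x n (-1) := Real.sqrt_nonneg _
      linarith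
  have hright : ∀ α ∈ Icc (-1 : ℝ) 1, 1 ≤ (x + α) ^ 2 - n →
      |∫ ρ in α..1, -n / (((x + ρ) ^ 2 - n) * √((x + ρ) ^ 2 - n)) * kernelTail₂ X ρ| ≤
        45 * X * ∫ ρ in (-1 : ℝ)..1, tailWeight x n ρ / (1 + X * |ρ|) := by
    intro α hα hα1
    have hn9 : n ≤ 9 * X ^ 2 := by nlinarith [hα.1, hα.2]
    have hsub : ∫ ρ in α..1, tailWeight x n ρ / (1 + X * |ρ|) ≤
        ∫ ρ in (-1 : ℝ)..1, tailWeight x n ρ / (1 + X * |ρ|) := by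
      rw [← integral_add_adjacent_intervals (intervalIntegrable_tailWeight (by linarith : 0 ≤ X) x n (-1) α)
        (intervalIntegrable_tailWeight (by linarith : 0 ≤ X) x n α 1)]
      linarith [hint0 (-1) α hα.1]
    refine le_trans ?_ (mul_le_mul_of_nonneg_left hsub (by positivity))
    rw [← intervalIntegral.integral_const_mul]
    rw [← Real.norm_eq_abs]
    refine norm_integral_le_of_norm_le hα.2 ?_
      ((intervalIntegrable_tailWeight (by linarith : 0 ≤ X) x n α 1).const_mul _)
    filter_upwards with ρ hρ
    have hρ1 : |ρ| ≤ 1 := abs_le.2 ⟨by linarith [hρ.1, hα.1], hρ.2⟩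
    have hσ : 1 ≤ (x + ρ) ^ 2 - n := by nlinarith [hρ.1, hα.1]
    have hσ0 : 0 < (x + ρ) ^ 2 - n := by linarith
    have hs : 0 < √((x + ρ) ^ 2 - n) := Real.sqrt_pos.2 hσ0
    rw [tailWeight, if_pos hσ, norm_mul, norm_div, norm_neg, Real.norm_eq_abs, Real.norm_eq_abs,
      Real.norm_eq_abs, abs_of_nonneg hn, abs_of_pos (mul_pos hσ0 hs)]
    calc n / (((x + ρ) ^ 2 - n) * √((x + ρ) ^ 2 - n)) * |kernelTail₂ X ρ|
        ≤ 9 * X ^ 2 / (((x + ρ) ^ 2 - n) * √((x + ρ) ^ 2 - n)) * (5 / (X * (1 + X * |ρ|))) := by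
          gcongr
          exact abs_kernelTail₂_le hX1 hρ1
      _ = _ := by
          have : 0 < 1 + X * |ρ| := by positivity
          field_simp
          ring
  rw [smoothingError_eq hX1 hx n]
  rcases le_or_gt ((x + 1) ^ 2 - n) 1 with hA | hA
  · have h := hleft 1 hp1 hA
    have h2 : 40 / (1 + |n - x ^ 2|) ≤ 190 / (1 + |n - x ^ 2|) := by gcongr; norm_num
    have h3 := mul_nonneg (by positivity : 0 ≤ 45 * X) (hint0 (-1) 1 (by norm_num))
    linarith
  · rcases le_or_gt 1 ((x + -1) ^ 2 - n) with hB | hB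
    · rw [integral_right_eq hX1 hx hm1 hB, kernelTail₂_neg_one, mul_zero, zero_add]
      have h := hright (-1) hm1 hB
      have h3 : 0 ≤ 190 / (1 + |n - x ^ 2|) := by positivity
      linarith
    -- The crossing point, where (x + α)² - n = 1.
    · set α := √(n + 1) - x with hαdef
      have hsq := Real.sq_sqrt (by linarith : 0 ≤ n + 1)
      have hσ : (x + α) ^ 2 - n = 1 := by
        rw [hαdef, show x + (√(n + 1) - x) = √(n + 1) by ring, hsq]; ring
      have hs0 := Real.sqrt_nonneg (n + 1)
      have hα : α ∈ Icc (-1 : ℝ) 1 := by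
        constructor
        · by_contra hc
          have : √(n + 1) < x + -1 := by rw [hαdef] at hc; linarith
          nlinarith
        · by_contra hc
          have : x + 1 < √(n + 1) := by rw [hαdef] at hc; linarith
          nlinarith
      rw [← integral_add_adjacent_intervals
        (intervalIntegrable_mul_kernelTail hX1 hm1 hα (intervalIntegrable_deriv_shifted hx n hm1 hα))
        (intervalIntegrable_mul_kernelTail hX1 hα hp1 (intervalIntegrable_deriv_shifted hx n hα hp1)),
        integral_right_eq hX1 hx hα hσ.ge]
      have h1 := hleft α hα hσ.le
      have h2 := hright α hα hσ.ge
      have h3 : |(x + α) / √((x + α) ^ 2 - n) * kernelTail₂ X α| ≤ 150 / (1 + |n - x ^ 2|) := by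
        have hα1 : |α| ≤ 1 := abs_le.2 hα
        rw [hσ, Real.sqrt_one, div_one, abs_mul, abs_of_nonneg (by linarith [hα.1])]
        have h := hT α hα1 (by linarith) hσ.le
        calc (x + α) * |kernelTail₂ X α| ≤ (3 * X) * (5 / (X * (1 + X * |α|))) := by
              gcongr
              · linarith [hα.2]
              · exact abs_kernelTail₂_le hX1 hα1
          _ = 15 * (1 / (1 + X * |α|)) := by
              have : 0 < 1 + X * |α| := by positivity
              field_simp
              ring
          _ ≤ 15 * (10 / (1 + |n - x ^ 2|)) := by gcongr
          _ = _ := by ring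
      have e : 190 / (1 + |n - x ^ 2|) = 40 / (1 + |n - x ^ 2|) + 150 / (1 + |n - x ^ 2|) := by ring
      rw [e]
      refine (abs_add_le _ _).trans ?_
      have := abs_add_le ((x + α) / √((x + α) ^ 2 - n) * kernelTail₂ X α)
        (∫ ρ in α..1, -n / (((x + ρ) ^ 2 - n) * √((x + ρ) ^ 2 - n)) * kernelTail₂ X ρ)
      linarith

end SmoothingError

end CyganKoranyi

namespace CyganKoranyi

open MeasureTheory Set intervalIntegral

/-! ### Summing the smoothing errors over the lattice -/

section ErrorSums

/-- Sums of `1 / (1 + |m - y|)` over integers within distance `L` of `y` are `O(L^δ)`. -/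
theorem exists_sum_inv_one_add_abs_le {δ : ℝ} (hδ : 0 < δ) :
    ∃ C : ℝ, 0 ≤ C ∧ ∀ (s : Finset ℕ) (y L : ℝ), 1 ≤ L → (∀ m ∈ s, |(m : ℝ) - y| ≤ L) →
      ∑ m ∈ s, 1 / (1 + |(m : ℝ) - y|) ≤ C * L ^ δ := by
  set f : ℤ → ℝ := fun m => 1 / (1 + |(m : ℝ)|) ^ (1 + δ) with hf
  have hf0 : ∀ m, 0 ≤ f m := fun m => by positivity
  have hsum : Summable f := by
    -- The shift by 1/2 keeps the base nonzero at every integer and below 1 + |m|.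
    have h := (Real.summable_one_div_int_add_rpow (1 / 2) (1 + δ)).2 (by linarith)
    refine Summable.of_nonneg_of_le hf0 (fun m => ?_) h
    have hne : (0 : ℝ) < |(m : ℝ) + 1 / 2| := by
      rw [abs_pos]
      intro h0
      have h2 : (2 * m + 1 : ℝ) = 0 := by linarith
      have h3 : (2 * m + 1 : ℤ) = 0 := by exact_mod_cast h2
      omega
    refine one_div_le_one_div_of_le (Real.rpow_pos_of_pos hne _) ?_
    refine Real.rpow_le_rpow hne.le ?_ (by linarith)
    refine (abs_add_le _ _).trans ?_
    rw [abs_of_pos (by norm_num : (0 : ℝ) < 1 / 2)]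
    linarith
  refine ⟨2 * 3 ^ δ * ∑' m, f m, by have : 0 ≤ ∑' m, f m := tsum_nonneg hf0; positivity, fun s y L hL hs => ?_⟩
  set k : ℤ := ⌊y⌋ with hk
  -- Giving up L^δ raises the exponent from 1 to 1 + δ; rounding y to an integer then makes the
  -- terms translates of one convergent series.
  have hterm : ∀ m ∈ s, 1 / (1 + |(m : ℝ) - y|) ≤ 2 * 3 ^ δ * L ^ δ * f ((m : ℤ) - k) := by
    intro m hm
    have h1 := Int.floor_le y
    have h2 := Int.lt_floor_add_one y
    have hd : |(m : ℝ) - k| ≤ |(m : ℝ) - y| + 1 := by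
      have e : (m : ℝ) - k = ((m : ℝ) - y) + (y - k) := by ring
      rw [e]
      refine (abs_add_le _ _).trans ?_
      rw [abs_of_nonneg (by linarith : 0 ≤ y - k)]
      linarith
    have hA : 1 / (1 + |(m : ℝ) - y|) ≤ 2 * (1 / (1 + |(m : ℝ) - k|)) := by
      rw [mul_one_div, div_le_div_iff₀ (by positivity) (by positivity)]
      linarith [abs_nonneg ((m : ℝ) - y)]
    have hB : 1 + |(m : ℝ) - k| ≤ 3 * L := by linarith [hs m hm]
    have hpos : 0 < 1 + |(m : ℝ) - k| := by positivity
    have hC : 1 / (1 + |(m : ℝ) - k|) ≤ (3 * L) ^ δ * (1 / (1 + |(m : ℝ) - k|) ^ (1 + δ)) := by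
      rw [mul_one_div, div_le_div_iff₀ hpos (Real.rpow_pos_of_pos hpos _), one_mul,
        Real.rpow_add hpos, Real.rpow_one, mul_comm]
      have := Real.rpow_le_rpow hpos.le hB hδ.le
      gcongr
    rw [Real.mul_rpow (by norm_num) (by linarith)] at hC
    have e : f ((m : ℤ) - k) = 1 / (1 + |(m : ℝ) - k|) ^ (1 + δ) := by
      simp [hf]
    rw [e]
    calc _ ≤ _ := hA
      _ ≤ 2 * (3 ^ δ * L ^ δ * (1 / (1 + |(m : ℝ) - k|) ^ (1 + δ))) := by gcongr
      _ = _ := by ring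
  refine (Finset.sum_le_sum hterm).trans ?_
  rw [← Finset.mul_sum]
  have hinj : Function.Injective fun m : ℕ => (m : ℤ) - k := by
    intro a b h
    simpa using h
  have hle : ∑ m ∈ s, f ((m : ℤ) - k) ≤ ∑' m, f m := by
    have e : ∑ m ∈ s, f ((m : ℤ) - k) = ∑ z ∈ s.map ⟨_, hinj⟩, f z := by
      rw [Finset.sum_map]
      rfl
    rw [e]
    exact hsum.sum_le_tsum _ fun z _ => hf0 z
  calc _ ≤ 2 * 3 ^ δ * L ^ δ * ∑' m, f m := by
        have : 0 ≤ L ^ δ := Real.rpow_nonneg (by linarith) _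
        gcongr
    _ = _ := by ring

/-- For fixed ρ the numbers (x + ρ)² - n are spaced by 1 and only those at least 1 count, so the sum
is at most that of j^(-3/2) over j ≥ 1, uniformly. -/
theorem exists_sum_tailWeight_le :
    ∃ C : ℝ, 0 ≤ C ∧ ∀ (N : ℕ) (x ρ : ℝ), ∑ n ∈ Finset.range N, tailWeight x n ρ ≤ C := by
  set w : ℕ → ℝ := fun j => (((j : ℝ) + 1) * √((j : ℝ) + 1))⁻¹ with hw
  have hw0 : ∀ j, 0 ≤ w j := fun j => by positivity
  have hsum : Summable w := by
    have h := (Real.summable_one_div_nat_rpow (p := 3 / 2)).2 (by norm_num)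
    rw [← summable_nat_add_iff 1] at h
    refine h.congr fun j => ?_
    rw [hw]
    simp only
    have hj : (0 : ℝ) < (j : ℝ) + 1 := by positivity
    rw [Real.sqrt_eq_rpow, ← Real.rpow_one_add' hj.le (by norm_num), one_div]
    push_cast
    norm_num
  refine ⟨∑' j, w j, tsum_nonneg hw0, fun N x ρ => ?_⟩
  set K := ⌊(x + ρ) ^ 2⌋₊ with hK
  have hKle : (K : ℝ) ≤ (x + ρ) ^ 2 := Nat.floor_le (sq_nonneg _)
  have hterm : ∀ n ∈ Finset.range N, tailWeight x n ρ ≤ if n < K then w (K - 1 - n) else 0 := by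
    intro n _
    unfold tailWeight
    by_cases h : 1 ≤ (x + ρ) ^ 2 - n
    · have hnK : n + 1 ≤ K := Nat.le_floor (by push_cast; linarith)
      rw [if_pos h, if_pos (by omega)]
      have e : ((K - 1 - n : ℕ) : ℝ) + 1 = (K : ℝ) - n := by
        have : K - 1 - n + 1 + n = K := by omega
        have h' : ((K - 1 - n + 1 + n : ℕ) : ℝ) = K := by rw [this]
        push_cast at h'
        linarith
      have hpos : (0 : ℝ) < (K : ℝ) - n := by rw [← e]; positivity
      simp only [hw]
      rw [e]
      gcongr
    · rw [if_neg h]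
      split_ifs
      · exact hw0 _
      · exact le_rfl
  refine (Finset.sum_le_sum hterm).trans ?_
  rw [← Finset.sum_filter]
  calc ∑ n ∈ Finset.range N with n < K, w (K - 1 - n) ≤ ∑ n ∈ Finset.range K, w (K - 1 - n) := by
        refine Finset.sum_le_sum_of_subset_of_nonneg (fun n hn => ?_) fun _ _ _ => hw0 _
        exact Finset.mem_range.2 (Finset.mem_filter.1 hn).2
    _ = ∑ n ∈ Finset.range K, w n := Finset.sum_range_reflect w K
    _ ≤ _ := hsum.sum_le_tsum _ fun _ _ => hw0 _

theorem integral_inv_one_add_mul_abs {X : ℝ} (hX : 0 < X) :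
    ∫ ρ in (-1 : ℝ)..1, 1 / (1 + X * |ρ|) = 2 * Real.log (1 + X) / X := by
  have hc : Continuous fun ρ : ℝ => 1 / (1 + X * |ρ|) :=
    continuous_const.div (by fun_prop) fun ρ => by positivity
  rw [integral_symm_of_even hc (by simp)]
  have hd : ∀ ρ ∈ uIcc (0 : ℝ) 1, HasDerivAt (fun ρ => Real.log (1 + X * ρ) / X) (1 / (1 + X * |ρ|)) ρ := by
    intro ρ hρ
    rw [uIcc_of_le zero_le_one] at hρ
    have h1 : HasDerivAt (fun ρ : ℝ => 1 + X * ρ) X ρ := by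
      simpa using ((hasDerivAt_id ρ).const_mul X).const_add 1
    have hpos : 0 < 1 + X * ρ := by have := hρ.1; positivity
    refine ((h1.log hpos.ne').div_const X).congr_deriv ?_
    rw [abs_of_nonneg hρ.1]
    field_simp
  rw [integral_eq_sub_of_hasDerivAt hd (hc.intervalIntegrable _ _)]
  simp
  ring

theorem exists_r2_le_succ_rpow {δ : ℝ} (hδ : 0 < δ) :
    ∃ C : ℝ, 0 < C ∧ ∀ m : ℕ, (r2 m : ℝ) ≤ C * ((m : ℝ) + 1) ^ δ := by
  obtain ⟨C, hC, h⟩ := exists_r2_le_rpow hδ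
  refine ⟨C + r2 0, by positivity, fun m => ?_⟩
  rcases Nat.eq_zero_or_pos m with rfl | hm
  · simp [hC.le]
  · refine (h m hm).trans ?_
    have h1 : (m : ℝ) ^ δ ≤ ((m : ℝ) + 1) ^ δ :=
      Real.rpow_le_rpow (by positivity) (by linarith) hδ.le
    have h2 : 0 ≤ (m : ℝ) ^ δ := by positivity
    have h3 : (0 : ℝ) ≤ r2 0 := by positivity
    exact mul_le_mul (by linarith) h1 h2 (by positivity)

/-- The total smoothing error over all lattice points is `O(X^δ)`. -/
theorem exists_sum_smoothingError_le {δ : ℝ} (hδ : 0 < δ) :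
    ∃ C : ℝ, 0 ≤ C ∧ ∀ X : ℝ, 2 ≤ X → ∀ x : ℝ, X ≤ x → x ≤ 2 * X → ∀ N : ℕ, (N : ℝ) ≤ 10 * X ^ 2 →
      ∑ n ∈ Finset.range N, (r2 n : ℝ) * |smoothingError X x n| ≤ C * X ^ δ := by
  -- One L^η is spent on r₂ and one on the sums, with L of order X²: altogether L^(2η), of order
  -- X^δ.
  set η := δ / 4 with hη
  have hη0 : 0 < η := by positivity
  obtain ⟨C₁, hC₁, hr⟩ := exists_r2_le_succ_rpow hη0
  obtain ⟨C₂, hC₂, hs⟩ := exists_sum_inv_one_add_abs_le hη0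
  obtain ⟨C₃, hC₃, ht⟩ := exists_sum_tailWeight_le
  refine ⟨C₁ * (190 * C₂ + 90 * C₃ / η) * 10 ^ (δ / 2), by positivity, fun X hX x hx1 hx2 N hN => ?_⟩
  have hX0 : 0 < X := by linarith
  set L := 10 * X ^ 2 with hL
  have hL1 : 1 ≤ L := by nlinarith
  have hL0 : 0 < L := by linarith
  have hr2 : ∀ n ∈ Finset.range N, (r2 n : ℝ) ≤ C₁ * L ^ η := by
    intro n hn
    refine (hr n).trans ?_
    have : (n : ℝ) + 1 ≤ L := by
      have : n + 1 ≤ N := Finset.mem_range.1 hn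
      have : ((n + 1 : ℕ) : ℝ) ≤ N := by exact_mod_cast this
      push_cast at this
      linarith
    gcongr
  have hdist : ∀ n ∈ Finset.range N, |(n : ℝ) - x ^ 2| ≤ L := by
    intro n hn
    have h1 : (n : ℝ) ≤ N := by exact_mod_cast (Finset.mem_range.1 hn).le
    have h2 : (0 : ℝ) ≤ n := Nat.cast_nonneg n
    have h3 : x ^ 2 ≤ L := by nlinarith
    rw [abs_le]
    constructor <;> nlinarith [sq_nonneg x]
  have hI := fun n : ℕ => intervalIntegrable_tailWeight hX0.le x n (-1) 1
  -- Summing over n before integrating leaves X times the integral of 1/(1 + X|ρ|), which is only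
  -- logarithmic in X.
  have htail : 45 * X * ∑ n ∈ Finset.range N, ∫ ρ in (-1 : ℝ)..1, tailWeight x n ρ / (1 + X * |ρ|) ≤
      90 * C₃ / η * L ^ η := by
    rw [← intervalIntegral.integral_finsetSum fun n _ => hI n]
    have hc : Continuous fun ρ : ℝ => 1 / (1 + X * |ρ|) :=
      continuous_const.div (by fun_prop) fun ρ => by positivity
    have hle : ∫ ρ in (-1 : ℝ)..1, ∑ n ∈ Finset.range N, tailWeight x n ρ / (1 + X * |ρ|) ≤
        ∫ ρ in (-1 : ℝ)..1, C₃ * (1 / (1 + X * |ρ|)) := by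
      refine integral_mono_on (by norm_num) ?_ ((hc.intervalIntegrable _ _).const_mul _) fun ρ _ => ?_
      · have := IntervalIntegrable.sum (Finset.range N) fun n _ => hI n
        simpa only [Finset.sum_fn] using this
      · rw [← Finset.sum_div, mul_one_div]
        have := ht N x ρ
        gcongr
    rw [intervalIntegral.integral_const_mul, integral_inv_one_add_mul_abs hX0] at hle
    have hlog : Real.log (1 + X) ≤ L ^ η / η := by
      refine (Real.log_le_rpow_div (by linarith) hη0).trans ?_
      have : 1 + X ≤ L := by nlinarith
      gcongr
    calc _ ≤ 45 * X * (C₃ * (2 * Real.log (1 + X) / X)) := by gcongr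
      _ = 90 * C₃ * Real.log (1 + X) := by field_simp; ring
      _ ≤ 90 * C₃ * (L ^ η / η) := by gcongr
      _ = _ := by ring
  have hsum1 := hs (Finset.range N) (x ^ 2) L hL1 hdist
  calc ∑ n ∈ Finset.range N, (r2 n : ℝ) * |smoothingError X x n|
      ≤ ∑ n ∈ Finset.range N, C₁ * L ^ η * (190 * (1 / (1 + |(n : ℝ) - x ^ 2|)) +
          45 * X * ∫ ρ in (-1 : ℝ)..1, tailWeight x n ρ / (1 + X * |ρ|)) := by
        refine Finset.sum_le_sum fun n hn => ?_
        refine mul_le_mul (hr2 n hn) ?_ (abs_nonneg _) (by positivity)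
        rw [mul_one_div]
        exact abs_smoothingError_le hX hx1 hx2 (Nat.cast_nonneg n)
    _ = C₁ * L ^ η * (190 * ∑ n ∈ Finset.range N, 1 / (1 + |(n : ℝ) - x ^ 2|) +
          45 * X * ∑ n ∈ Finset.range N, ∫ ρ in (-1 : ℝ)..1, tailWeight x n ρ / (1 + X * |ρ|)) := by
        rw [← Finset.mul_sum, Finset.sum_add_distrib, ← Finset.mul_sum, ← Finset.mul_sum]
    _ ≤ C₁ * L ^ η * (190 * (C₂ * L ^ η) + 90 * C₃ / η * L ^ η) := by gcongr
    _ = C₁ * (190 * C₂ + 90 * C₃ / η) * (L ^ η * L ^ η) := by ring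
    _ = C₁ * (190 * C₂ + 90 * C₃ / η) * 10 ^ (δ / 2) * X ^ δ := by
        rw [← Real.rpow_add hL0, hL, Real.mul_rpow (by norm_num) (by positivity),
          ← Real.rpow_natCast X 2, ← Real.rpow_mul hX0.le]
        rw [show η + η = δ / 2 by rw [hη]; ring, show ((2 : ℕ) : ℝ) * (δ / 2) = δ by push_cast; ring]
        ring

end ErrorSums

end CyganKoranyi

namespace CyganKoranyi

open MeasureTheory Set intervalIntegral

/-! ### The transform of the smoothed half-ball profile -/

section SmoothedProfile

/-- Averaging over a parameter commutes with the radial Fourier transform. -/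
theorem radialFourier_integral {F : ℝ → ℝ → ℝ} {R : ℝ} (hF : Continuous (Function.uncurry F))
    (hR : ∀ ρ ∈ Ioc (-1 : ℝ) 1, ∀ t, R ≤ t → F ρ t = 0) (r : ℝ) :
    radialFourier (fun n => ∫ ρ in (-1 : ℝ)..1, F ρ n) r =
      ∫ ρ in (-1 : ℝ)..1, radialFourier (F ρ) r := by
  have h11 : (-1 : ℝ) ≤ 1 := by norm_num
  have hF1 : ∀ ρ, Continuous (F ρ) := fun ρ => hF.uncurry_left ρ
  have hGc : Continuous fun n => ∫ ρ in (-1 : ℝ)..1, F ρ n :=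
    continuous_parametric_intervalIntegral_of_continuous' (f := fun n ρ => F ρ n)
      (hF.comp continuous_swap) _ _
  have hG0 : ∀ t, R ≤ t → ∫ ρ in (-1 : ℝ)..1, F ρ t = 0 := by
    intro t ht
    rw [integral_of_le h11]
    exact setIntegral_eq_zero_of_forall_eq_zero fun ρ hρ => hR ρ hρ t ht
  have key : ∀ G : ℝ → ℝ, Continuous G → (∀ t, R ≤ t → G t = 0) → radialFourier G r =
      ∫ p : ℝ × ℝ, G (p.1 ^ 2 + p.2 ^ 2) * Real.cos (2 * Real.pi * r * p.1) := by
    intro G hG hGR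
    have hi : Integrable fun p : ℝ × ℝ => G (p.1 ^ 2 + p.2 ^ 2) * Real.cos (2 * Real.pi * r * p.1) :=
      (integrable_radial hG hGR).mul_bdd (c := 1) (by fun_prop)
        (Filter.Eventually.of_forall fun s => Real.abs_cos_le_one _)
    rw [Measure.volume_eq_prod, integral_prod _ (by rwa [← Measure.volume_eq_prod])]
    simp only [MeasureTheory.integral_mul_const, radialFourier]
  rw [key _ hGc hG0, integral_of_le h11]
  have hr : ∫ ρ in Ioc (-1 : ℝ) 1, radialFourier (F ρ) r = ∫ ρ in Ioc (-1 : ℝ) 1,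
      ∫ p : ℝ × ℝ, F ρ (p.1 ^ 2 + p.2 ^ 2) * Real.cos (2 * Real.pi * r * p.1) :=
    setIntegral_congr_fun measurableSet_Ioc fun ρ hρ => key _ (hF1 ρ) (hR ρ hρ)
  rw [hr, integral_integral_swap]
  · congr 1
    funext p
    rw [integral_of_le h11, ← MeasureTheory.integral_mul_const]
  · have hcont : Continuous (Function.uncurry fun (ρ : ℝ) (p : ℝ × ℝ) =>
        F ρ (p.1 ^ 2 + p.2 ^ 2) * Real.cos (2 * Real.pi * r * p.1)) := by
      unfold Function.uncurry at hF ⊢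
      have : Continuous fun q : ℝ × ℝ × ℝ => F q.1 (q.2.1 ^ 2 + q.2.2 ^ 2) :=
        hF.comp (by fun_prop : Continuous fun q : ℝ × ℝ × ℝ => (q.1, q.2.1 ^ 2 + q.2.2 ^ 2))
      fun_prop
    set b := |R| + 1 with hb
    have hK := hcont.continuousOn.integrableOn_compact (μ := volume)
      ((isCompact_Icc (a := (-1 : ℝ)) (b := 1)).prod
        ((isCompact_Icc (a := -b) (b := b)).prod (isCompact_Icc (a := -b) (b := b))))
    have hres : (volume.restrict (Ioc (-1 : ℝ) 1)).prod (volume : Measure (ℝ × ℝ)) =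
        volume.restrict (Ioc (-1 : ℝ) 1 ×ˢ univ) := by
      rw [Measure.volume_eq_prod ℝ (ℝ × ℝ), ← Measure.prod_restrict, Measure.restrict_univ]
    rw [hres]
    refine IntegrableOn.of_forall_sdiff_eq_zero hK (measurableSet_Ioc.prod MeasurableSet.univ) ?_
    rintro ⟨ρ, s, u⟩ ⟨⟨hρ, -⟩, hn⟩
    have h0 : F ρ (s ^ 2 + u ^ 2) = 0 := by
      refine hR ρ hρ _ ?_
      by_contra hc
      apply hn
      have h0 : R ≤ |R| := le_abs_self R
      have hp : 0 ≤ |R| := abs_nonneg R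
      have h1 : |s| ≤ b := abs_le_of_sq_le_sq (by nlinarith [sq_nonneg u]) (by linarith)
      have h2 : |u| ≤ b := abs_le_of_sq_le_sq (by nlinarith [sq_nonneg s]) (by linarith)
      exact ⟨⟨hρ.1.le, hρ.2⟩, abs_le.1 h1, abs_le.1 h2⟩
    simp [Function.uncurry, h0]

/-- The average of the slice profiles against the smoothing kernel. -/
noncomputable def smoothed (X x n : ℝ) : ℝ := ∫ ρ in (-1 : ℝ)..1, shifted x n ρ * kernel X ρ

variable {X x r : ℝ}

theorem continuous_shifted_uncurry (x : ℝ) : Continuous fun p : ℝ × ℝ => shifted x p.2 p.1 := by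
  unfold shifted
  fun_prop

theorem continuous_smoothed (X x : ℝ) : Continuous (smoothed X x) := by
  refine continuous_parametric_intervalIntegral_of_continuous'
    (f := fun n ρ => shifted x n ρ * kernel X ρ) ?_ _ _
  have h1 : Continuous fun p : ℝ × ℝ => shifted x p.1 p.2 :=
    (continuous_shifted_uncurry x).comp continuous_swap
  exact h1.mul ((continuous_kernel X).comp continuous_snd)

theorem shifted_eq_zero (hx : 1 ≤ x) {n ρ : ℝ} (hn : (x + 1) ^ 2 ≤ n) (hρ : ρ ∈ Ioc (-1 : ℝ) 1) :
    shifted x n ρ = 0 := by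
  refine Real.sqrt_eq_zero_of_nonpos ?_
  have h0 : 0 ≤ x + ρ := by linarith [hρ.1]
  have : (x + ρ) ^ 2 ≤ (x + 1) ^ 2 := by gcongr; exact hρ.2
  linarith

theorem smoothed_eq_zero (hx : 1 ≤ x) {n : ℝ} (hn : (x + 1) ^ 2 ≤ n) : smoothed X x n = 0 := by
  rw [smoothed, integral_of_le (by norm_num)]
  refine setIntegral_eq_zero_of_forall_eq_zero fun ρ hρ => ?_
  rw [shifted_eq_zero hx hn hρ, zero_mul]

theorem smoothed_eq (X x n : ℝ) :
    smoothed X x n = kernelHat X 0 * shifted x n 0 + smoothingError X x n := by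
  have hK := continuous_kernel X
  have hS := continuous_shifted x n
  have h0 : kernelHat X 0 * shifted x n 0 = ∫ ρ in (-1 : ℝ)..1, shifted x n 0 * kernel X ρ := by
    rw [intervalIntegral.integral_const_mul, mul_comm]
    simp [kernelHat]
  rw [h0, smoothingError, ← integral_add ((by fun_prop : Continuous _).intervalIntegrable _ _)
    ((by fun_prop : Continuous _).intervalIntegrable _ _), smoothed]
  refine integral_congr fun ρ _ => ?_
  ring

theorem radialFourier_smoothed (hx : 1 ≤ x) (r : ℝ) : radialFourier (smoothed X x) r =
    ∫ ρ in (-1 : ℝ)..1, kernel X ρ * radialFourier (fun n => √((x + ρ) ^ 2 - n)) r := by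
  have h1 : smoothed X x = fun n => ∫ ρ in (-1 : ℝ)..1, kernel X ρ * √((x + ρ) ^ 2 - n) := by
    funext n
    simp only [smoothed, shifted, mul_comm]
  rw [h1, radialFourier_integral (F := fun ρ n => kernel X ρ * √((x + ρ) ^ 2 - n)) (R := (x + 1) ^ 2)]
  · simp only [radialFourier_const_mul]
  · have := continuous_kernel X
    unfold Function.uncurry
    fun_prop
  · intro ρ hρ t ht
    have := shifted_eq_zero hx ht hρ
    rw [shifted] at this
    simp only [this, mul_zero]

/-- The average of (x + ρ)³: odd powers of ρ integrate to zero against the even kernel. -/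
theorem radialFourier_smoothed_zero (hx : 1 ≤ x) : radialFourier (smoothed X x) 0 =
    2 * Real.pi / 3 * (x ^ 3 * kernelHat X 0 + 3 * x * ∫ ρ in (-1 : ℝ)..1, ρ ^ 2 * kernel X ρ) := by
  have hK := continuous_kernel X
  have h1 : radialFourier (smoothed X x) 0 = ∫ ρ in (-1 : ℝ)..1, (2 * Real.pi / 3 *
      (x ^ 3 * (kernel X ρ * Real.cos (2 * Real.pi * 0 * ρ)) + 3 * x * (ρ ^ 2 * kernel X ρ)) +
      2 * Real.pi / 3 * (3 * x ^ 2 * ρ + ρ ^ 3) * kernel X ρ) := by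
    rw [radialFourier_smoothed hx]
    refine integral_congr fun ρ hρ => ?_
    rw [uIcc_of_le (by norm_num)] at hρ
    simp only [radialFourier_sqrt_zero (by linarith [hρ.1] : 0 ≤ x + ρ), mul_zero, zero_mul, Real.cos_zero]
    ring
  rw [h1, integral_add ((by fun_prop : Continuous _).intervalIntegrable _ _)
    ((by fun_prop : Continuous _).intervalIntegrable _ _), integral_symm_of_odd (f := fun ρ =>
      2 * Real.pi / 3 * (3 * x ^ 2 * ρ + ρ ^ 3) * kernel X ρ) (fun ρ => by rw [kernel_neg]; ring),
    intervalIntegral.integral_const_mul,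
    integral_add ((by fun_prop : Continuous _).intervalIntegrable _ _)
    ((by fun_prop : Continuous _).intervalIntegrable _ _), intervalIntegral.integral_const_mul,
    intervalIntegral.integral_const_mul]
  simp only [kernelHat, add_zero]

/-- The addition formulas separate x from ρ in the explicit transform at radius x + ρ, and the parts
odd in ρ drop out. -/
theorem radialFourier_smoothed_eq (hx : 1 ≤ x) (hr : 0 < r) : radialFourier (smoothed X x) r =
    -(x * Real.cos (2 * Real.pi * r * x)) * kernelHat X r / (2 * Real.pi * r ^ 2) +
    Real.sin (2 * Real.pi * r * x) *
      (∫ ρ in (-1 : ℝ)..1, ρ * kernel X ρ * Real.sin (2 * Real.pi * r * ρ)) / (2 * Real.pi * r ^ 2) +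
    Real.sin (2 * Real.pi * r * x) * kernelHat X r / (4 * Real.pi ^ 2 * r ^ 3) := by
  have hK := continuous_kernel X
  set a := 2 * Real.pi * r with ha
  set c₁ := 2 * Real.pi * r ^ 2 with hc₁
  set c₂ := 4 * Real.pi ^ 2 * r ^ 3 with hc₂
  have h1 : radialFourier (smoothed X x) r = ∫ ρ in (-1 : ℝ)..1,
      ((-(x * Real.cos (a * x)) / c₁ * (kernel X ρ * Real.cos (a * ρ)) +
        Real.sin (a * x) / c₁ * (ρ * kernel X ρ * Real.sin (a * ρ)) +
        Real.sin (a * x) / c₂ * (kernel X ρ * Real.cos (a * ρ))) +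
      kernel X ρ * (x * Real.sin (a * x) * Real.sin (a * ρ) / c₁ - ρ * Real.cos (a * x) * Real.cos (a * ρ) / c₁ +
        Real.cos (a * x) * Real.sin (a * ρ) / c₂)) := by
    rw [radialFourier_smoothed hx]
    refine integral_congr fun ρ hρ => ?_
    rw [uIcc_of_le (by norm_num)] at hρ
    simp only [radialFourier_sqrt (by linarith [hρ.1] : 0 ≤ x + ρ) hr]
    rw [← ha, ← hc₁, ← hc₂, mul_add a, Real.cos_add, Real.sin_add]
    ring
  rw [h1, integral_add ((by fun_prop : Continuous _).intervalIntegrable _ _)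
    ((by fun_prop : Continuous _).intervalIntegrable _ _), integral_symm_of_odd (f := fun ρ =>
      kernel X ρ * (x * Real.sin (a * x) * Real.sin (a * ρ) / c₁ - ρ * Real.cos (a * x) * Real.cos (a * ρ) / c₁ +
        Real.cos (a * x) * Real.sin (a * ρ) / c₂))
      (fun ρ => by rw [kernel_neg, mul_neg, Real.sin_neg, Real.cos_neg]; ring),
    integral_add ((by fun_prop : Continuous _).intervalIntegrable _ _)
    ((by fun_prop : Continuous _).intervalIntegrable _ _),
    integral_add ((by fun_prop : Continuous _).intervalIntegrable _ _)
    ((by fun_prop : Continuous _).intervalIntegrable _ _), intervalIntegral.integral_const_mul,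
    intervalIntegral.integral_const_mul, intervalIntegral.integral_const_mul]
  simp only [kernelHat, add_zero, ← ha]
  ring

/-- The transform of the smoothed profile is a truncated cosine, up to a small error. -/
theorem abs_radialFourier_smoothed_add_le (hX : 1 ≤ X) (hx : 1 ≤ x) (hr : 0 < r) :
    |radialFourier (smoothed X x) r + (if r ≤ X then kernelHat X 0 else 0) * x / (2 * Real.pi) *
      (Real.cos (2 * Real.pi * r * x) / r ^ 2)| ≤ 2 * x * (1 / r ^ 2 / (1 + |r - X|)) + 1 / r ^ 3 := by
  have hpi := Real.pi_gt_three
  have hpi0 := Real.pi_pos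
  rw [radialFourier_smoothed_eq hx hr]
  set κ := (if r ≤ X then kernelHat X 0 else 0) with hκ
  set I := ∫ ρ in (-1 : ℝ)..1, ρ * kernel X ρ * Real.sin (2 * Real.pi * r * ρ) with hI
  have h1 : |kernelHat X r - κ| ≤ 8 / (1 + |r - X|) := abs_kernelHat_sub_le hX hr.le
  have h2 : |I| ≤ 1 / (1 + |r - X|) := abs_integral_mul_kernel_mul_sin_le (by linarith) hr.le
  have h3 := kernelHat_le (by linarith : 0 ≤ X) r
  have h4 := kernelHat_nonneg (by linarith : 0 ≤ X) r
  have hc := Real.abs_cos_le_one (2 * Real.pi * r * x)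
  have hs := Real.abs_sin_le_one (2 * Real.pi * r * x)
  set c := Real.cos (2 * Real.pi * r * x)
  set s := Real.sin (2 * Real.pi * r * x)
  set w := 1 + |r - X| with hw
  have hw0 : 0 < w := by positivity
  have e : -(x * c) * kernelHat X r / (2 * Real.pi * r ^ 2) + s * I / (2 * Real.pi * r ^ 2) +
      s * kernelHat X r / (4 * Real.pi ^ 2 * r ^ 3) + κ * x / (2 * Real.pi) * (c / r ^ 2) =
      (-(x * c * (kernelHat X r - κ)) + s * I) / (2 * Real.pi * r ^ 2) +
        s * kernelHat X r / (4 * Real.pi ^ 2 * r ^ 3) := by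
    field_simp
    ring
  rw [e]
  have b1 : |-(x * c * (kernelHat X r - κ)) + s * I| ≤ 9 * x / w := by
    refine (abs_add_le _ _).trans ?_
    rw [abs_neg, abs_mul, abs_mul, abs_mul, abs_of_nonneg (by linarith : 0 ≤ x)]
    calc _ ≤ x * 1 * (8 / w) + 1 * (1 / w) := by gcongr
      _ ≤ x * 1 * (8 / w) + x * (1 / w) := by gcongr
      _ = _ := by ring
  refine (abs_add_le _ _).trans (add_le_add ?_ ?_)
  · rw [abs_div, abs_of_pos (by positivity : 0 < 2 * Real.pi * r ^ 2)]
    calc _ ≤ 9 * x / w / (2 * 3 * r ^ 2) := by gcongr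
      _ = 3 / 2 * x * (1 / r ^ 2 / w) := by field_simp; norm_num
      _ ≤ 2 * x * (1 / r ^ 2 / w) := by gcongr; norm_num
  · rw [abs_div, abs_of_pos (by positivity : 0 < 4 * Real.pi ^ 2 * r ^ 3), abs_mul, abs_of_nonneg h4]
    calc _ ≤ 1 * (2 * Real.pi) / (4 * Real.pi ^ 2 * r ^ 3) := by gcongr
      _ = 1 / (2 * Real.pi) * (1 / r ^ 3) := by field_simp; norm_num
      _ ≤ 1 * (1 / r ^ 3) := by
          gcongr
          rw [div_le_one (by positivity)]
          linarith
      _ = _ := one_mul _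

end SmoothedProfile

end CyganKoranyi

namespace CyganKoranyi

open MeasureTheory Set

/-! ### Dual sums and the two Poisson expansions -/

section LatticeSums

theorem r2_zero : r2 0 = 1 := by
  have : {p : ℤ × ℤ | p.1 ^ 2 + p.2 ^ 2 = ((0 : ℕ) : ℤ)} = {(0, 0)} := by
    ext ⟨a, b⟩
    simp only [mem_ofPred_eq, mem_singleton_iff, Prod.mk.injEq, Nat.cast_zero]
    constructor
    · intro h
      have ha := sq_nonneg a
      have hb := sq_nonneg b
      exact ⟨pow_eq_zero_iff two_ne_zero |>.1 (by linarith), pow_eq_zero_iff two_ne_zero |>.1 (by linarith)⟩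
    · rintro ⟨rfl, rfl⟩
      norm_num
  rw [r2, this, ncard_singleton]

theorem exists_r2_mul_le {η : ℝ} (hη : 0 < η) : ∃ C : ℝ, 0 < C ∧ ∀ m : ℕ, 1 ≤ m → ∀ c : ℝ,
    (r2 m : ℝ) * ((m : ℝ) ^ c) ≤ C * (m : ℝ) ^ (η + c) := by
  obtain ⟨C, hC, h⟩ := exists_r2_le_rpow hη
  refine ⟨C, hC, fun m hm c => ?_⟩
  have hm0 : (0 : ℝ) < m := by exact_mod_cast hm
  rw [Real.rpow_add hm0, ← mul_assoc]
  have := h m hm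
  gcongr

theorem summable_r2_div_sqrt_pow : Summable fun m : ℕ => (r2 m : ℝ) * (1 / √(m : ℝ) ^ 3) := by
  obtain ⟨C, hC, h⟩ := exists_r2_mul_le (η := 1 / 4) (by norm_num)
  refine Summable.of_nonneg_of_le (fun m => by positivity) (fun m => ?_)
    ((Real.summable_nat_rpow.2 (by norm_num : (-5 / 4 : ℝ) < -1)).mul_left C)
  rcases Nat.eq_zero_or_pos m with rfl | hm
  · simp only [Nat.cast_zero, Real.sqrt_zero, zero_pow three_ne_zero, div_zero, mul_zero]
    positivity
  · have e : 1 / √(m : ℝ) ^ 3 = (m : ℝ) ^ (-3 / 2 : ℝ) := by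
      rw [Real.sqrt_eq_rpow, ← Real.rpow_natCast, ← Real.rpow_mul (by positivity), one_div,
        ← Real.rpow_neg (by positivity)]
      norm_num
    rw [e]
    refine (h m hm _).trans (le_of_eq ?_)
    norm_num

/-- Here |m - X²| ≤ 3X|√m - X|. If m ≥ X²/2, then 1/m is of order X⁻² and the weight is controlled
by 1/m and 1/(1 + |m - X²|); otherwise |√m - X| ≥ X/4 and 1/m alone suffices. -/
theorem weight_le_of_le {X : ℝ} (hX : 0 < X) {m : ℝ} (hm : 1 ≤ m) (h4 : m ≤ 4 * X ^ 2) :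
    X * (1 / √m ^ 2 / (1 + |√m - X|)) ≤ 12 * (1 / (1 + |m - 0|) + 1 / (1 + |m - X ^ 2|)) := by
  set r := √m with hr
  have hr2 : r ^ 2 = m := Real.sq_sqrt (by linarith)
  have hr0 : 0 ≤ r := Real.sqrt_nonneg _
  have hr2X : r ≤ 2 * X := (abs_le_of_sq_le_sq' (by nlinarith) (by linarith)).2
  have hd : |m - X ^ 2| ≤ 3 * X * |r - X| := by
    have : m - X ^ 2 = (r + X) * (r - X) := by rw [← hr2]; ring
    rw [this, abs_mul, abs_of_nonneg (by linarith : 0 ≤ r + X)]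
    gcongr
    linarith
  have hw : 0 < 1 + |r - X| := by positivity
  have h1 : 1 / m ≤ 2 * (1 / (1 + |m - 0|)) := by
    rw [sub_zero, abs_of_nonneg (by linarith), mul_one_div, div_le_div_iff₀ (by linarith) (by linarith)]
    linarith
  have h2 : 0 ≤ 1 / (1 + |m - X ^ 2|) := by positivity
  rw [hr2]
  have hm0 : 0 < m := by linarith
  rcases le_total (X ^ 2) (2 * m) with hc | hc
  · have h3 : X * (1 / m / (1 + |r - X|)) ≤ 6 * (1 / m + 1 / (1 + |m - X ^ 2|)) := by
      have e1 : X * (1 / m / (1 + |r - X|)) = X / (m * (1 + |r - X|)) := by field_simp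
      rw [e1, div_le_iff₀ (by positivity)]
      set D := |m - X ^ 2| with hD
      set d := |r - X| with hd'
      have hD0 : 0 ≤ D := abs_nonneg _
      have hd0 : 0 ≤ d := abs_nonneg _
      have e2 : 6 * (1 / m + 1 / (1 + D)) * (m * (1 + d)) = 6 * (1 + d) + 6 * m * (1 + d) / (1 + D) := by
        field_simp
      rw [e2]
      have h5 : X * (1 + D) ≤ 6 * (1 + d) * (1 + D) + 6 * m * (1 + d) := by
        have : X * D ≤ 3 * X ^ 2 * d := by nlinarith
        rcases le_total X 1 with hX1 | hX1
        · nlinarith [mul_nonneg hd0 hD0, mul_nonneg hm0.le hd0]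
        · nlinarith [mul_nonneg hd0 hD0, mul_nonneg hm0.le hd0]
      have h6 : (X - 6 * (1 + d)) ≤ 6 * m * (1 + d) / (1 + D) := by
        rw [le_div_iff₀ (by positivity)]
        linarith
      linarith
    linarith
  · have hrX : r ≤ X := (abs_le_of_sq_le_sq' (by nlinarith) (by linarith)).2
    have h5 : X / 4 ≤ |r - X| := by
      rw [abs_sub_comm, abs_of_nonneg (by linarith)]
      nlinarith
    have h3 : X / (1 + |r - X|) ≤ 4 := by
      rw [div_le_iff₀ hw]
      linarith
    calc X * (1 / m / (1 + |r - X|)) = X / (1 + |r - X|) * (1 / m) := by ring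
      _ ≤ 4 * (1 / m) := by gcongr
      _ ≤ _ := by linarith [(by positivity : (0 : ℝ) ≤ 1 / (1 + |m - 0|))]

theorem weight_le_of_lt {X : ℝ} (hX : 0 < X) {m : ℝ} (h4 : 4 * X ^ 2 < m) :
    1 / √m ^ 2 / (1 + |√m - X|) ≤ 2 * m ^ (-3 / 2 : ℝ) := by
  have hm0 : 0 < m := by nlinarith [sq_nonneg X]
  have hr0 : 0 < √m := Real.sqrt_pos.2 hm0
  have h2X : 2 * X ≤ √m := Real.le_sqrt_of_sq_le (by nlinarith)
  have e : m ^ (-3 / 2 : ℝ) = 1 / √m ^ 3 := by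
    rw [Real.sqrt_eq_rpow, ← Real.rpow_natCast, ← Real.rpow_mul (by positivity), one_div,
      ← Real.rpow_neg (by positivity)]
    norm_num
  have hw : 0 < 1 + (√m - X) := by linarith
  rw [e, div_div, mul_one_div, abs_of_nonneg (by linarith), div_le_div_iff₀ (by positivity) (by positivity)]
  have : 0 < √m ^ 2 := by positivity
  nlinarith

/-- The dual sum of the truncation errors. -/
theorem exists_tsum_r2_weight_le {δ : ℝ} (hδ : 0 < δ) : ∃ C : ℝ, 0 ≤ C ∧ ∀ X : ℝ, 1 ≤ X →
    Summable (fun m : ℕ => (r2 m : ℝ) * (1 / √(m : ℝ) ^ 2 / (1 + |√(m : ℝ) - X|))) ∧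
    ∑' m : ℕ, (r2 m : ℝ) * (1 / √(m : ℝ) ^ 2 / (1 + |√(m : ℝ) - X|)) ≤ C * (X ^ δ / X) := by
  -- The near range costs X^(4η), so 4η ≤ δ is needed; η ≤ 1/4 makes the exponent 2η - 1/2 in the
  -- far range nonpositive.
  set η := min (δ / 4) (1 / 4) with hη
  have hη0 : 0 < η := lt_min (by positivity) (by norm_num)
  have hη1 : η ≤ 1 / 4 := min_le_right _ _
  have hη2 : 4 * η ≤ δ := by linarith [min_le_left (δ / 4) (1 / 4 : ℝ)]
  obtain ⟨C₁, hC₁, hr⟩ := exists_r2_mul_le hη0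
  obtain ⟨C₂, hC₂, hs⟩ := exists_sum_inv_one_add_abs_le hη0
  have hS : Summable fun m : ℕ => (m : ℝ) ^ (-1 - η) := Real.summable_nat_rpow.2 (by linarith)
  set S := ∑' m : ℕ, (m : ℝ) ^ (-1 - η) with hSdef
  have hS0 : 0 ≤ S := tsum_nonneg fun m => by positivity
  refine ⟨C₁ * 12 * (2 * C₂) * 4 ^ (2 * η) + 2 * C₁ * S, by positivity, fun X hX => ?_⟩
  have hX0 : 0 < X := by linarith
  set L := 4 * X ^ 2 with hL
  have hL1 : 1 ≤ L := by nlinarith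
  have hL0 : 0 < L := by linarith
  set s := Finset.Icc 1 ⌊L⌋₊ with hs'
  set φ : ℕ → ℝ := fun m => C₁ * L ^ η * (12 * (1 / (1 + |(m : ℝ) - 0|) + 1 / (1 + |(m : ℝ) - X ^ 2|))) / X with hφ
  have hφ0 : ∀ m, 0 ≤ φ m := fun m => by positivity
  have hXe : X ^ (4 * η) / X ≤ X ^ δ / X := by gcongr
  have hmem : ∀ m : ℕ, m ∈ s ↔ 1 ≤ m ∧ (m : ℝ) ≤ L := by
    intro m
    rw [hs', Finset.mem_Icc, Nat.le_floor_iff hL0.le]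
  have hle : ∀ m : ℕ, (r2 m : ℝ) * (1 / √(m : ℝ) ^ 2 / (1 + |√(m : ℝ) - X|)) ≤
      (if m ∈ s then φ m else 0) + 2 * C₁ * (X ^ (4 * η) / X) * (m : ℝ) ^ (-1 - η) := by
    intro m
    rcases Nat.eq_zero_or_pos m with rfl | hm
    · simp only [Nat.cast_zero, Real.sqrt_zero, zero_pow two_ne_zero, div_zero, zero_div, mul_zero]
      have : 0 ≤ if 0 ∈ s then φ 0 else 0 := by split_ifs <;> simp [hφ0]
      positivity
    have hm1 : (1 : ℝ) ≤ m := by exact_mod_cast hm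
    have hm0 : (0 : ℝ) < m := by linarith
    by_cases hmL : (m : ℝ) ≤ L
    · rw [if_pos ((hmem m).2 ⟨hm, hmL⟩)]
      have h1 := weight_le_of_le hX0 hm1 hmL
      have h2 := hr m hm 0
      rw [Real.rpow_zero, mul_one, add_zero] at h2
      have h3 : (m : ℝ) ^ η ≤ L ^ η := by gcongr
      have h4 : (r2 m : ℝ) * (X * (1 / √(m : ℝ) ^ 2 / (1 + |√(m : ℝ) - X|))) ≤ C₁ * L ^ η * (12 * (1 / (1 + |(m : ℝ) - 0|) + 1 / (1 + |(m : ℝ) - X ^ 2|))) := by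
        have h5 : (r2 m : ℝ) ≤ C₁ * L ^ η := h2.trans (by gcongr)
        gcongr
      have h5 : 0 ≤ 2 * C₁ * (X ^ (4 * η) / X) * (m : ℝ) ^ (-1 - η) := by positivity
      refine le_add_of_le_of_nonneg ?_ h5
      rw [hφ, le_div_iff₀ hX0]
      linarith
    · rw [if_neg (fun h => hmL ((hmem m).1 h).2), zero_add]
      have h1 := weight_le_of_lt hX0 (not_le.1 hmL)
      have h2 := hr m hm (-3 / 2)
      have hXm : X ^ 2 ≤ m := by nlinarith [not_le.1 hmL, sq_nonneg X]
      -- The far terms m^(η - 3/2) are split as m^(2η - 1/2)·m^(-1 - η): the first factor gives the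
      -- saving, the second a convergent series.
      have h3 : (m : ℝ) ^ (2 * η - 1 / 2) ≤ X ^ (4 * η) / X := by
        calc (m : ℝ) ^ (2 * η - 1 / 2) ≤ (X ^ 2) ^ (2 * η - 1 / 2) :=
              Real.rpow_le_rpow_of_nonpos (by positivity) hXm (by linarith)
          _ = X ^ (4 * η - 1) := by
              rw [← Real.rpow_natCast X 2, ← Real.rpow_mul hX0.le]
              congr 1
              push_cast
              ring
          _ = _ := by rw [Real.rpow_sub hX0, Real.rpow_one]
      calc _ ≤ (r2 m : ℝ) * (2 * (m : ℝ) ^ (-3 / 2 : ℝ)) := by gcongr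
        _ = 2 * ((r2 m : ℝ) * (m : ℝ) ^ (-3 / 2 : ℝ)) := by ring
        _ ≤ 2 * (C₁ * (m : ℝ) ^ (η + -3 / 2)) := by gcongr
        _ = 2 * C₁ * (m : ℝ) ^ (2 * η - 1 / 2) * (m : ℝ) ^ (-1 - η) := by
            rw [mul_assoc _ ((m : ℝ) ^ (2 * η - 1 / 2)), ← Real.rpow_add hm0, mul_assoc]
            congr 3
            ring
        _ ≤ _ := by gcongr
  have hs1 : Summable fun m : ℕ => if m ∈ s then φ m else 0 :=
    summable_of_ne_finset_zero (s := s) fun m hm => if_neg hm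
  have hs2 := hS.mul_left (2 * C₁ * (X ^ (4 * η) / X))
  have hsum := Summable.of_nonneg_of_le (fun m => by positivity) hle (hs1.add hs2)
  refine ⟨hsum, (hsum.tsum_le_tsum hle (hs1.add hs2)).trans ?_⟩
  rw [hs1.tsum_add hs2, tsum_mul_left, ← hSdef, tsum_eq_sum (s := s) fun m hm => if_neg hm,
    Finset.sum_congr rfl fun m hm => if_pos hm]
  have hφs : ∑ m ∈ s, φ m ≤ C₁ * 12 * (2 * C₂) * 4 ^ (2 * η) * (X ^ (4 * η) / X) := by
    have ha := hs s 0 L hL1 fun m hm => by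
      rw [sub_zero, abs_of_nonneg (Nat.cast_nonneg m)]
      exact ((hmem m).1 hm).2
    have hb := hs s (X ^ 2) L hL1 fun m hm => by
      have := (hmem m).1 hm
      have h0 : (0 : ℝ) ≤ m := Nat.cast_nonneg m
      rw [abs_le]
      constructor <;> nlinarith [sq_nonneg X]
    have e1 : ∑ m ∈ s, φ m = C₁ * L ^ η * (12 * (∑ m ∈ s, 1 / (1 + |(m : ℝ) - 0|) +
        ∑ m ∈ s, 1 / (1 + |(m : ℝ) - X ^ 2|))) / X := by
      rw [← Finset.sum_add_distrib, Finset.mul_sum, Finset.mul_sum, Finset.sum_div]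
    rw [e1]
    calc _ ≤ C₁ * L ^ η * (12 * (C₂ * L ^ η + C₂ * L ^ η)) / X := by gcongr
      _ = C₁ * 12 * (2 * C₂) * (L ^ η * L ^ η) / X := by ring
      _ = _ := by
          rw [← Real.rpow_add hL0, hL, Real.mul_rpow (by norm_num) (by positivity),
            ← Real.rpow_natCast X 2, ← Real.rpow_mul hX0.le, ← two_mul,
            show ((2 : ℕ) : ℝ) * (2 * η) = 4 * η by push_cast; ring]
          ring
  calc _ ≤ C₁ * 12 * (2 * C₂) * 4 ^ (2 * η) * (X ^ (4 * η) / X) + 2 * C₁ * (X ^ (4 * η) / X) * S := by gcongr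
    _ = (C₁ * 12 * (2 * C₂) * 4 ^ (2 * η) + 2 * C₁ * S) * (X ^ (4 * η) / X) := by ring
    _ ≤ _ := by gcongr

/-- Poisson summation with an approximate, finitely supported dual side. -/
theorem abs_tsum_sub_sum_le {G : ℝ → ℝ} {R : ℝ} (hG : Continuous G) (hR : ∀ t, R ≤ t → G t = 0)
    {M b : ℕ → ℝ} {s : Finset ℕ} (hM : ∀ m ∉ s, M m = 0)
    (hb : ∀ m : ℕ, |radialFourier G (√m) - M m| ≤ b m) (hbs : Summable fun m => (r2 m : ℝ) * b m) :
    |∑' m : ℕ, (r2 m : ℝ) * G m - ∑ m ∈ s, (r2 m : ℝ) * M m| ≤ ∑' m, (r2 m : ℝ) * b m := by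
  have hMs : Summable fun m => (r2 m : ℝ) * M m :=
    summable_of_ne_finset_zero (s := s) fun m hm => by rw [hM m hm, mul_zero]
  have hd : Summable fun m : ℕ => (r2 m : ℝ) * (radialFourier G (√m) - M m) := by
    refine Summable.of_norm_bounded hbs fun m => ?_
    rw [norm_mul, Real.norm_eq_abs, Real.norm_eq_abs, abs_of_nonneg (Nat.cast_nonneg _)]
    exact mul_le_mul_of_nonneg_left (hb m) (Nat.cast_nonneg _)
  have hF : Summable fun m : ℕ => (r2 m : ℝ) * radialFourier G (√m) := by
    refine (hd.add hMs).congr fun m => ?_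
    ring
  have hF' : Summable fun m : ℕ => (r2 m : ℝ) * |radialFourier G (√m)| := by
    refine hF.abs.congr fun m => ?_
    rw [abs_mul, abs_of_nonneg (Nat.cast_nonneg _)]
  have hMsum : ∑ m ∈ s, (r2 m : ℝ) * M m = ∑' m, (r2 m : ℝ) * M m :=
    (tsum_eq_sum fun m hm => by rw [hM m hm, mul_zero]).symm
  rw [radial_poisson hG hR hF', hMsum, ← hF.tsum_sub hMs, ← Real.norm_eq_abs]
  refine tsum_of_norm_bounded hbs.hasSum fun m => ?_
  rw [← mul_sub, norm_mul, Real.norm_eq_abs, Real.norm_eq_abs, abs_of_nonneg (Nat.cast_nonneg _)]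
  exact mul_le_mul_of_nonneg_left (hb m) (Nat.cast_nonneg _)

/-- The lattice sum of the half-ball profile `√(x² - n)`. -/
theorem exists_sum_sqrt_sub_le {δ : ℝ} (hδ : 0 < δ) : ∃ C : ℝ, 0 ≤ C ∧ ∀ X : ℝ, 2 ≤ X → ∀ x : ℝ,
    X ≤ x → x ≤ 2 * X → |∑ n ∈ Finset.range ⌈(x + 1) ^ 2⌉₊, (r2 n : ℝ) * √(x ^ 2 - n) -
      2 * Real.pi / 3 * x ^ 3 + x / (2 * Real.pi) * ∑ m ∈ Finset.Icc 1 ⌊X ^ 2⌋₊,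
        (r2 m : ℝ) / m * Real.cos (2 * Real.pi * √m * x)| ≤ C * X ^ δ := by
  obtain ⟨C₁, hC₁, h₁⟩ := exists_sum_smoothingError_le hδ
  obtain ⟨C₂, hC₂, h₂⟩ := exists_tsum_r2_weight_le hδ
  set C₃ := ∑' m : ℕ, (r2 m : ℝ) * (1 / √(m : ℝ) ^ 3) with hC₃
  have hC₃0 : 0 ≤ C₃ := tsum_nonneg fun m => by positivity
  have hpi := Real.pi_pos
  refine ⟨Real.pi ^ 2 * (C₁ + 4 * C₂ + C₃ + 4 * Real.pi), by positivity, fun X hX x hx1 hx2 => ?_⟩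
  have hX0 : 0 < X := by linarith
  have hx0 : 0 < x := by linarith
  -- The range covers the supports of all shifted profiles, whose radii reach x + 1.
  set N := ⌈(x + 1) ^ 2⌉₊ with hN
  set κ := kernelHat X 0 with hκ
  set A := ∑ n ∈ Finset.range N, (r2 n : ℝ) * √(x ^ 2 - n) with hA
  set D := ∑ m ∈ Finset.Icc 1 ⌊X ^ 2⌋₊, (r2 m : ℝ) / m * Real.cos (2 * Real.pi * √m * x) with hD
  set J := ∫ ρ in (-1 : ℝ)..1, ρ ^ 2 * kernel X ρ with hJ
  set E := ∑ n ∈ Finset.range N, (r2 n : ℝ) * smoothingError X x n with hE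
  have hκ0 : 1 / Real.pi ^ 2 ≤ κ := le_kernelHat_zero (by linarith)
  have hNle : (N : ℝ) ≤ 10 * X ^ 2 := by
    have := (Nat.ceil_lt_add_one (by positivity : 0 ≤ (x + 1) ^ 2)).le
    nlinarith
  have hEle : |E| ≤ C₁ * X ^ δ := by
    refine (Finset.abs_sum_le_sum_abs _ _).trans ?_
    refine le_trans (le_of_eq (Finset.sum_congr rfl fun n _ => ?_)) (h₁ X hX x hx1 hx2 N hNle)
    rw [abs_mul, abs_of_nonneg (Nat.cast_nonneg _)]
  have hlhs : ∑' m : ℕ, (r2 m : ℝ) * smoothed X x m = κ * A + E := by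
    rw [tsum_eq_sum (s := Finset.range N), hA, hE, Finset.mul_sum, ← Finset.sum_add_distrib]
    · refine Finset.sum_congr rfl fun n _ => ?_
      rw [smoothed_eq, shifted, add_zero]
      ring
    · intro n hn
      rw [smoothed_eq_zero (by linarith) (Nat.le_of_ceil_le (by simpa [hN] using hn)), mul_zero]
  -- The model for the dual side: exact at frequency 0, the sharply truncated cosine elsewhere.
  set M : ℕ → ℝ := fun m => if m = 0 then radialFourier (smoothed X x) 0 else
    -((if √(m : ℝ) ≤ X then κ else 0) * x / (2 * Real.pi) *
      (Real.cos (2 * Real.pi * √m * x) / √(m : ℝ) ^ 2)) with hM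
  set s := insert 0 (Finset.Icc 1 ⌊X ^ 2⌋₊) with hs
  have hmem : ∀ m : ℕ, m ∈ Finset.Icc 1 ⌊X ^ 2⌋₊ ↔ 1 ≤ m ∧ √(m : ℝ) ≤ X := by
    intro m
    rw [Finset.mem_Icc, Nat.le_floor_iff (by positivity), Real.sqrt_le_left hX0.le]
  obtain ⟨hw, hw'⟩ := h₂ X (by linarith)
  have hbs : Summable fun m : ℕ => (r2 m : ℝ) *
      (2 * x * (1 / √(m : ℝ) ^ 2 / (1 + |√(m : ℝ) - X|)) + 1 / √(m : ℝ) ^ 3) := by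
    refine ((hw.mul_left (2 * x)).add summable_r2_div_sqrt_pow).congr fun m => ?_
    ring
  have hP := abs_tsum_sub_sum_le (continuous_smoothed X x)
    (fun t ht => smoothed_eq_zero (by linarith : 1 ≤ x) ht) (M := M) (s := s) ?_ ?_ hbs
  · have hbt : ∑' m : ℕ, (r2 m : ℝ) *
        (2 * x * (1 / √(m : ℝ) ^ 2 / (1 + |√(m : ℝ) - X|)) + 1 / √(m : ℝ) ^ 3) ≤ (4 * C₂ + C₃) * X ^ δ := by
      have e : ∑' m : ℕ, (r2 m : ℝ) *
          (2 * x * (1 / √(m : ℝ) ^ 2 / (1 + |√(m : ℝ) - X|)) + 1 / √(m : ℝ) ^ 3) =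
          2 * x * (∑' m : ℕ, (r2 m : ℝ) * (1 / √(m : ℝ) ^ 2 / (1 + |√(m : ℝ) - X|))) + C₃ := by
        rw [hC₃, ← tsum_mul_left, ← (hw.mul_left (2 * x)).tsum_add summable_r2_div_sqrt_pow]
        exact tsum_congr fun m => by ring
      rw [e]
      have h1 : 1 ≤ X ^ δ := Real.one_le_rpow (by linarith) hδ.le
      calc _ ≤ 2 * (2 * X) * (C₂ * (X ^ δ / X)) + C₃ * X ^ δ := by
            gcongr
            exact le_mul_of_one_le_right hC₃0 h1
        _ = _ := by field_simp; ring
    have hsM : ∑ m ∈ s, (r2 m : ℝ) * M m = radialFourier (smoothed X x) 0 - κ * x / (2 * Real.pi) * D := by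
      rw [hs, Finset.sum_insert (by simp), r2_zero, hD, Finset.mul_sum, sub_eq_add_neg,
        ← Finset.sum_neg_distrib]
      congr 1
      · simp [hM]
      · refine Finset.sum_congr rfl fun m hm => ?_
        have h := (hmem m).1 hm
        simp only [hM]
        rw [if_neg (by omega), if_pos h.2, Real.sq_sqrt (Nat.cast_nonneg m)]
        ring
    rw [hlhs, hsM, radialFourier_smoothed_zero (by linarith)] at hP
    have hJ1 : |J| ≤ 1 / X := abs_integral_sq_mul_kernel_le hX0
    have hJ2 : |2 * Real.pi * x * J| ≤ 4 * Real.pi * X ^ δ := by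
      have h1 : 1 ≤ X ^ δ := Real.one_le_rpow (by linarith) hδ.le
      rw [abs_mul, abs_of_pos (by positivity)]
      calc _ ≤ 2 * Real.pi * (2 * X) * (1 / X) := by gcongr
        _ = 4 * Real.pi := by field_simp; ring
        _ ≤ _ := le_mul_of_one_le_right (by positivity) h1
    -- Both main terms carry the same factor κ, so it is divided out at the end at the price of π².
    have hκB : κ * |A - 2 * Real.pi / 3 * x ^ 3 + x / (2 * Real.pi) * D| ≤
        (C₁ + 4 * C₂ + C₃ + 4 * Real.pi) * X ^ δ := by
      have hκ00 : 0 ≤ κ := le_trans (by positivity) hκ0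
      rw [← abs_of_nonneg hκ00, ← abs_mul]
      have e : κ * (A - 2 * Real.pi / 3 * x ^ 3 + x / (2 * Real.pi) * D) =
          (κ * A + E - (2 * Real.pi / 3 * (x ^ 3 * κ + 3 * x * J) - κ * x / (2 * Real.pi) * D)) - E +
            2 * Real.pi * x * J := by ring
      rw [e]
      have h3 := abs_add_le (κ * A + E - (2 * Real.pi / 3 * (x ^ 3 * κ + 3 * x * J) - κ * x / (2 * Real.pi) * D) - E)
        (2 * Real.pi * x * J)
      have h4 := abs_sub (κ * A + E - (2 * Real.pi / 3 * (x ^ 3 * κ + 3 * x * J) - κ * x / (2 * Real.pi) * D)) E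
      linarith
    set Y := |A - 2 * Real.pi / 3 * x ^ 3 + x / (2 * Real.pi) * D|
    have hY : 0 ≤ Y := abs_nonneg _
    calc Y = Real.pi ^ 2 * (1 / Real.pi ^ 2 * Y) := by field_simp
      _ ≤ Real.pi ^ 2 * (κ * Y) := by gcongr
      _ ≤ Real.pi ^ 2 * ((C₁ + 4 * C₂ + C₃ + 4 * Real.pi) * X ^ δ) := by gcongr
      _ = _ := by ring
  · intro m hm
    rw [hs, Finset.mem_insert, not_or, hmem, not_and] at hm
    have h := hm.2 (Nat.one_le_iff_ne_zero.2 hm.1)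
    simp only [hM]
    rw [if_neg hm.1, if_neg h]
    simp
  · intro m
    simp only [hM]
    split_ifs with h0 h1
    · simp [h0]
    all_goals
      have hm : 0 < √(m : ℝ) := Real.sqrt_pos.2 (by exact_mod_cast Nat.pos_of_ne_zero h0)
      have h := abs_radialFourier_smoothed_add_le (by linarith : 1 ≤ X) (by linarith : 1 ≤ x) hm
      first
        | rw [if_pos h1] at h
        | rw [if_neg h1] at h
      rw [sub_neg_eq_add]
      exact h

/-- The lattice sum of the smoother profile. -/
theorem exists_sum_smootherProfile_le : ∃ C : ℝ, 0 ≤ C ∧ ∀ x : ℝ, 0 < x →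
    |∑ n ∈ Finset.range ⌈(x + 1) ^ 2⌉₊, (r2 n : ℝ) * (x ^ 2 * smootherProfile (n / x ^ 2)) -
      x ^ 4 * radialFourier smootherProfile 0| ≤ C * x := by
  obtain ⟨C, hC, h⟩ := exists_radialFourier_smootherProfile_decay
  refine ⟨C * ∑' m : ℕ, (r2 m : ℝ) * (1 / √(m : ℝ) ^ 3),
    mul_nonneg hC (tsum_nonneg fun m => by positivity), fun x hx => ?_⟩
  set H : ℝ → ℝ := fun n => x ^ 2 * smootherProfile (n / x ^ 2) with hH
  have hHc : Continuous H := by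
    have := continuous_smootherProfile
    fun_prop
  have hH0 : ∀ t, x ^ 2 ≤ t → H t = 0 := by
    intro t ht
    simp only [hH]
    rw [smootherProfile_of_one_le ((one_le_div (by positivity)).2 ht), mul_zero]
  have hF : ∀ r, radialFourier H r = x ^ 4 * radialFourier smootherProfile (x * r) := by
    intro r
    rw [hH, radialFourier_const_mul, radialFourier_scale hx]
    ring
  have hbs : Summable fun m : ℕ => (r2 m : ℝ) * (C * x * (1 / √(m : ℝ) ^ 3)) := by
    refine (summable_r2_div_sqrt_pow.mul_left (C * x)).congr fun m => ?_
    ring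
  have hP := abs_tsum_sub_sum_le hHc hH0 (M := fun m => if m = 0 then x ^ 4 * radialFourier smootherProfile 0 else 0)
    (s := {0}) (fun m hm => if_neg (by simpa using hm)) ?_ hbs
  · have e1 : ∑' m : ℕ, (r2 m : ℝ) * H m = ∑ n ∈ Finset.range ⌈(x + 1) ^ 2⌉₊, (r2 n : ℝ) * H n := by
      refine tsum_eq_sum fun n hn => ?_
      have : (x + 1) ^ 2 ≤ (n : ℝ) := Nat.le_of_ceil_le (by simpa using hn)
      rw [hH0 n (by nlinarith), mul_zero]
    have e2 : ∑' m : ℕ, (r2 m : ℝ) * (C * x * (1 / √(m : ℝ) ^ 3)) =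
        (C * ∑' m : ℕ, (r2 m : ℝ) * (1 / √(m : ℝ) ^ 3)) * x := by
      rw [← tsum_mul_left, ← tsum_mul_right]
      exact tsum_congr fun m => by ring
    rw [e1, e2, Finset.sum_singleton, if_pos rfl, r2_zero, Nat.cast_one, one_mul] at hP
    exact hP
  · intro m
    rw [hF]
    split_ifs with h0
    · simp [h0]
    · have hm : 0 < √(m : ℝ) := Real.sqrt_pos.2 (by exact_mod_cast Nat.pos_of_ne_zero h0)
      rw [sub_zero, abs_mul, abs_of_pos (by positivity)]
      -- Dilation contributes x⁴ and the cubic decay takes back x³, leaving C·x·m^(-3/2).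
      calc _ ≤ x ^ 4 * (C / (x * √(m : ℝ)) ^ 3) := by gcongr; exact h _ (by positivity)
        _ = _ := by field_simp

end LatticeSums

end CyganKoranyi

namespace CyganKoranyi

open MeasureTheory Set

/-! ### From lattice points to a weighted sum of square roots -/

section Counting

variable {x : ℝ}

theorem cygNorm_le_iff (hx : 0 ≤ x) (u : Fin 3 → ℝ) :
    cygNorm u ≤ x ↔ (u 0 ^ 2 + u 1 ^ 2) ^ 2 + u 2 ^ 2 ≤ x ^ 4 := by
  rw [cygNorm, one_div, Real.rpow_inv_le_iff_of_pos (by positivity) hx (by norm_num)]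
  norm_cast

theorem neg_floor_le_and_le_floor_iff {m : ℝ} (hm : 0 ≤ m) (k : ℤ) :
    (m ≤ x ^ 2 ∧ -⌊√((x ^ 2) ^ 2 - m ^ 2)⌋ ≤ k ∧ k ≤ ⌊√((x ^ 2) ^ 2 - m ^ 2)⌋) ↔
      m ^ 2 + (k : ℝ) ^ 2 ≤ x ^ 4 := by
  have e : (x ^ 2) ^ 2 = x ^ 4 := by ring
  have h1 : (-⌊√((x ^ 2) ^ 2 - m ^ 2)⌋ ≤ k ∧ k ≤ ⌊√((x ^ 2) ^ 2 - m ^ 2)⌋) ↔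
      |(k : ℝ)| ≤ √((x ^ 2) ^ 2 - m ^ 2) := by
    rw [abs_le', Int.le_floor, neg_le, Int.le_floor, and_comm]
    push_cast
    rfl
  rw [h1]
  constructor
  · rintro ⟨hmx, hk⟩
    have h0 : 0 ≤ (x ^ 2) ^ 2 - m ^ 2 := by
      have : m ^ 2 ≤ (x ^ 2) ^ 2 := by gcongr
      linarith
    have := pow_le_pow_left₀ (abs_nonneg _) hk 2
    rw [Real.sq_sqrt h0, sq_abs] at this
    linarith
  · intro h
    refine ⟨(abs_le_of_sq_le_sq' (by nlinarith [sq_nonneg (k : ℝ)]) (by positivity)).2,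
      Real.le_sqrt_of_sq_le ?_⟩
    rw [sq_abs]
    linarith

/-- Counting lattice points along the vertical axis. -/
theorem N1_eq_sum (hx : 0 ≤ x) : (N1 x : ℝ) = ∑ m ∈ Finset.Icc 0 ⌊x ^ 2⌋₊,
    (r2 m : ℝ) * (2 * ⌊√((x ^ 2) ^ 2 - (m : ℝ) ^ 2)⌋ + 1) := by
  classical
  set P : ℕ → Finset (ℤ × ℤ) := fun m => (finite_sq_add_sq_eq m).toFinset with hP
  set K : ℕ → Finset ℤ := fun m =>
    Finset.Icc (-⌊√((x ^ 2) ^ 2 - (m : ℝ) ^ 2)⌋) ⌊√((x ^ 2) ^ 2 - (m : ℝ) ^ 2)⌋ with hK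
  set U := (Finset.Icc 0 ⌊x ^ 2⌋₊).biUnion fun m => P m ×ˢ K m with hU
  set f : (ℤ × ℤ) × ℤ → Fin 3 → ℤ := fun p => ![p.1.1, p.1.2, p.2] with hf
  have hfi : Function.Injective f := by
    rintro ⟨⟨a, b⟩, c⟩ ⟨⟨a', b'⟩, c'⟩ h
    have h0 := congrFun h 0
    have h1 := congrFun h 1
    have h2 := congrFun h 2
    simp [hf] at h0 h1 h2
    simp [h0, h1, h2]
  have hset : {z : Fin 3 → ℤ | cygNorm (fun i => (z i : ℝ)) ≤ x} = f '' (U : Set ((ℤ × ℤ) × ℤ)) := by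
    have hiff : ∀ a b c : ℤ, ((a, b), c) ∈ U ↔
        ((a : ℝ) ^ 2 + (b : ℝ) ^ 2) ^ 2 + (c : ℝ) ^ 2 ≤ x ^ 4 := by
      intro a b c
      have hcast : ∀ m : ℕ, a ^ 2 + b ^ 2 = (m : ℤ) → (m : ℝ) = (a : ℝ) ^ 2 + (b : ℝ) ^ 2 := by
        intro m h
        have : ((a ^ 2 + b ^ 2 : ℤ) : ℝ) = ((m : ℤ) : ℝ) := by rw [h]
        push_cast at this
        exact this.symm
      simp only [hU, hP, hK, Finset.mem_biUnion, Finset.mem_product, Finite.mem_toFinset, mem_ofPred_eq,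
        Finset.mem_Icc, zero_le, true_and, Nat.le_floor_iff (sq_nonneg x)]
      constructor
      · rintro ⟨m, hm, hab, hc⟩
        rw [← hcast m hab, ← neg_floor_le_and_le_floor_iff (Nat.cast_nonneg m)]
        exact ⟨hm, hc⟩
      · intro h
        have hab : a ^ 2 + b ^ 2 = (((a ^ 2 + b ^ 2).toNat : ℕ) : ℤ) :=
          (Int.toNat_of_nonneg (by positivity)).symm
        rw [← hcast _ hab, ← neg_floor_le_and_le_floor_iff (Nat.cast_nonneg _)] at h
        exact ⟨_, h.1, hab, h.2⟩
    ext z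
    rw [mem_ofPred_eq, cygNorm_le_iff hx, ← hiff, mem_image]
    constructor
    · intro h
      refine ⟨_, h, ?_⟩
      ext i
      fin_cases i <;> rfl
    · rintro ⟨⟨⟨a, b⟩, c⟩, h, rfl⟩
      exact h
  rw [N1, hset, ncard_image_of_injective _ hfi, ncard_coe_finset, hU, Finset.card_biUnion]
  · push_cast
    refine Finset.sum_congr rfl fun m _ => ?_
    rw [Finset.card_product]
    have h1 : (P m).card = r2 m := by rw [r2, ncard_eq_toFinset_card _ (finite_sq_add_sq_eq m)]
    have h0 : 0 ≤ ⌊√((x ^ 2) ^ 2 - (m : ℝ) ^ 2)⌋ := Int.floor_nonneg.2 (Real.sqrt_nonneg _)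
    have h2 : ((K m).card : ℤ) = 2 * ⌊√((x ^ 2) ^ 2 - (m : ℝ) ^ 2)⌋ + 1 := by
      rw [hK, Int.card_Icc, Int.toNat_of_nonneg (by linarith)]
      ring
    have h3 : ((K m).card : ℝ) = 2 * ⌊√((x ^ 2) ^ 2 - (m : ℝ) ^ 2)⌋ + 1 := by exact_mod_cast h2
    push_cast
    rw [h1, h3]
  · intro m _ m' _ hne
    refine Finset.disjoint_product.2 (Or.inl (Finset.disjoint_left.2 fun p hp hp' => hne ?_))
    simp only [hP, Finite.mem_toFinset, mem_ofPred_eq] at hp hp'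
    exact_mod_cast hp.symm.trans hp'

/-- For each m, (2⌊t⌋ + 1) + 2ψ(t) = 2t. The range may be enlarged because the square root of a
negative number is 0. -/
theorem N1_add_two_mul_T (hx : 0 ≤ x) : (N1 x : ℝ) + 2 * T (x ^ 2) =
    ∑ n ∈ Finset.range ⌈(x + 1) ^ 2⌉₊, (r2 n : ℝ) * (2 * √((x ^ 2) ^ 2 - (n : ℝ) ^ 2)) := by
  have h1 : ∑ n ∈ Finset.range ⌈(x + 1) ^ 2⌉₊, (r2 n : ℝ) * (2 * √((x ^ 2) ^ 2 - (n : ℝ) ^ 2)) =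
      ∑ n ∈ Finset.Icc 0 ⌊x ^ 2⌋₊, (r2 n : ℝ) * (2 * √((x ^ 2) ^ 2 - (n : ℝ) ^ 2)) := by
    refine (Finset.sum_subset (fun n hn => ?_) fun n _ hn => ?_).symm
    · rw [Finset.mem_Icc, Nat.le_floor_iff (sq_nonneg x)] at hn
      rw [Finset.mem_range, Nat.lt_ceil]
      nlinarith [hn.2]
    · rw [Finset.mem_Icc, Nat.le_floor_iff (sq_nonneg x), not_and] at hn
      have h := not_le.1 (hn (Nat.zero_le n))
      rw [Real.sqrt_eq_zero_of_nonpos (by nlinarith [sq_nonneg x]), mul_zero, mul_zero]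
  rw [h1, N1_eq_sum hx, T, Finset.mul_sum, ← Finset.sum_add_distrib]
  refine Finset.sum_congr rfl fun m _ => ?_
  rw [psi]
  ring

/-- Factor x⁴ - n² = (x² - n)(x² + n) and replace √(x² + n) by its value √2·x at n = x²; the
correction has one more zero at the boundary. -/
theorem two_mul_sqrt_eq (hx : 0 < x) {n : ℝ} (hn : 0 ≤ n) : 2 * √((x ^ 2) ^ 2 - n ^ 2) =
    2 * √2 * x * √(x ^ 2 - n) - x ^ 2 * smootherProfile (n / x ^ 2) := by
  have e1 : √(1 - n / x ^ 2) = √(x ^ 2 - n) / x := by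
    rw [show 1 - n / x ^ 2 = (x ^ 2 - n) / x ^ 2 by field_simp, Real.sqrt_div' _ (by positivity),
      Real.sqrt_sq hx.le]
  have e2 : √(1 + n / x ^ 2) = √(x ^ 2 + n) / x := by
    rw [show 1 + n / x ^ 2 = (x ^ 2 + n) / x ^ 2 by field_simp, Real.sqrt_div' _ (by positivity),
      Real.sqrt_sq hx.le]
  rw [show (x ^ 2) ^ 2 - n ^ 2 = (x ^ 2 + n) * (x ^ 2 - n) by ring, Real.sqrt_mul (by positivity),
    smootherProfile, e1, e2]
  field_simp
  ring

end Counting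

/-! ### The volume as a zero frequency -/

section Volume

theorem volume_setOf_sq_le (q : ℝ) :
    volume {k : ℝ | q ^ 2 + k ^ 2 ≤ 1} = ENNReal.ofReal (2 * √(1 - q ^ 2)) := by
  rcases le_or_gt (q ^ 2) 1 with hq | hq
  · have : {k : ℝ | q ^ 2 + k ^ 2 ≤ 1} = Icc (-√(1 - q ^ 2)) (√(1 - q ^ 2)) := by
      ext k
      rw [mem_ofPred_eq, mem_Icc, ← abs_le]
      constructor
      · intro h
        exact Real.le_sqrt_of_sq_le (by rw [sq_abs]; linarith)
      · intro h
        have := pow_le_pow_left₀ (abs_nonneg k) h 2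
        rw [Real.sq_sqrt (by linarith), sq_abs] at this
        linarith
    rw [this, Real.volume_Icc]
    congr 1
    ring
  · have : {k : ℝ | q ^ 2 + k ^ 2 ≤ 1} = ∅ := by
      ext k
      rw [mem_ofPred_eq]
      simp only [mem_empty_iff_false, iff_false, not_le]
      nlinarith [sq_nonneg k]
    rw [this, Real.sqrt_eq_zero_of_nonpos (by linarith)]
    simp

/-- Above a horizontal point of squared length n the ball is a segment of length 2√(1 - n²), or at
most a null set if n ≥ 1; Fubini gives the planar integral. -/
theorem volume_unitBall_eq_radialFourier :
    (volume unitBall).toReal = radialFourier (fun n => 2 * √(1 - (max n 0) ^ 2)) 0 := by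
  set g : ℝ → ℝ := fun n => 2 * √(1 - (max n 0) ^ 2) with hg
  have hgc : Continuous g := by fun_prop
  have hg0 : ∀ t, 1 ≤ t → g t = 0 := by
    intro t ht
    have : 1 ≤ max t 0 := ht.trans (le_max_left _ _)
    simp only [hg]
    rw [Real.sqrt_eq_zero_of_nonpos (by nlinarith), mul_zero]
  set B : Set (ℝ × (Fin 2 → ℝ)) := {p | (p.2 0 ^ 2 + p.2 1 ^ 2) ^ 2 + p.1 ^ 2 ≤ 1} with hB
  have hBm : MeasurableSet B := by
    refine IsClosed.measurableSet (isClosed_le (by fun_prop) continuous_const)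
  have hpre : unitBall = MeasurableEquiv.piFinSuccAbove (fun _ : Fin 3 => ℝ) 2 ⁻¹' B := by
    ext u
    rw [unitBall, mem_ofPred_eq, cygNorm_le_iff zero_le_one, one_pow]
    rfl
  have hgi : Integrable fun v : Fin 2 → ℝ => g (v 0 ^ 2 + v 1 ^ 2) :=
    ((volume_preserving_finTwoArrow ℝ).integrable_comp
      (g := fun p : ℝ × ℝ => g (p.1 ^ 2 + p.2 ^ 2)) (integrable_radial hgc hg0).aestronglyMeasurable).2
      (integrable_radial hgc hg0)
  have hvol : volume unitBall = ENNReal.ofReal (∫ v : Fin 2 → ℝ, g (v 0 ^ 2 + v 1 ^ 2)) := by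
    rw [hpre, (volume_preserving_piFinSuccAbove (fun _ : Fin 3 => ℝ) 2).measure_preimage
      hBm.nullMeasurableSet, Measure.volume_eq_prod, Measure.prod_apply_symm hBm,
      ofReal_integral_eq_lintegral_ofReal hgi (Filter.Eventually.of_forall fun v => by
        simp only [hg]; positivity)]
    refine lintegral_congr fun v => ?_
    have : (0 : ℝ) ≤ v 0 ^ 2 + v 1 ^ 2 := by positivity
    simp only [hg, max_eq_left this]
    exact volume_setOf_sq_le (v 0 ^ 2 + v 1 ^ 2)
  have hint : ∫ v : Fin 2 → ℝ, g (v 0 ^ 2 + v 1 ^ 2) = radialFourier g 0 := by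
    have h := (volume_preserving_finTwoArrow ℝ).integral_comp' (fun p : ℝ × ℝ => g (p.1 ^ 2 + p.2 ^ 2))
    refine Eq.trans h ?_
    rw [Measure.volume_eq_prod, integral_prod _ (by
        rw [← Measure.volume_eq_prod]; exact integrable_radial hgc hg0)]
    simp [radialFourier]
  rw [hvol, hint, ENNReal.toReal_ofReal]
  rw [← hint]
  exact integral_nonneg fun v => by simp only [hg]; positivity

/-- The decomposition of the profile at x = 1, so that vol·x⁴ matches the zero-frequency terms of
the two Poisson expansions exactly. -/
theorem volume_unitBall_eq : (volume unitBall).toReal =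
    2 * √2 * (2 * Real.pi / 3) - radialFourier smootherProfile 0 := by
  have h1 : radialFourier (fun n => 2 * √(1 - (max n 0) ^ 2)) 0 =
      radialFourier (fun n => 2 * √2 * √(1 ^ 2 - n) + (-1) * smootherProfile n) 0 := by
    refine radialFourier_congr (fun n hn => ?_) 0
    have := two_mul_sqrt_eq one_pos hn
    simp only [one_pow, div_one, mul_one, one_mul] at this ⊢
    rw [max_eq_left hn, this]
    ring
  rw [volume_unitBall_eq_radialFourier, h1, radialFourier_add (R₁ := 1) (R₂ := 1) (by fun_prop)
    (continuous_smootherProfile.const_mul _) (fun t ht => by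
      rw [Real.sqrt_eq_zero_of_nonpos (x := 1 ^ 2 - t) (by rw [one_pow]; linarith), mul_zero])
    (fun t ht => by rw [smootherProfile_of_one_le ht, mul_zero]),
    radialFourier_const_mul, radialFourier_const_mul, radialFourier_sqrt_zero zero_le_one]
  ring

end Volume

end CyganKoranyi

/-! ### Assembly of the expansion -/

theorem proposition1 :
    ∃ X₀ : ℝ, 0 < X₀ ∧ ∀ ε : ℝ, 0 < ε → ∃ C : ℝ, 0 < C ∧
      ∀ X : ℝ, X₀ ≤ X → ∀ x : ℝ, X ≤ x → x ≤ 2 * X →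
        |CyganKoranyi.E1 x / x ^ 2
            - (-(Real.sqrt 2 / Real.pi)
                  * ∑ m ∈ Finset.Icc 1 ⌊X ^ 2⌋₊,
                      (CyganKoranyi.r2 m : ℝ) / (m : ℝ)
                        * Real.cos (2 * Real.pi * Real.sqrt (m : ℝ) * x)
                - 2 / x ^ 2 * CyganKoranyi.T (x ^ 2))|
          ≤ C * X ^ (-1 + ε) := by
  refine ⟨2, two_pos, fun ε hε => ?_⟩
  obtain ⟨C₁, hC₁, h₁⟩ := CyganKoranyi.exists_sum_sqrt_sub_le hε
  obtain ⟨C₂, hC₂, h₂⟩ := CyganKoranyi.exists_sum_smootherProfile_le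
  -- The two error constants are only nonnegative; the 1 makes the final constant positive.
  refine ⟨2 * √2 * C₁ + C₂ + 1, by positivity, fun X hX x hx1 hx2 => ?_⟩
  have hX0 : 0 < X := by linarith
  have hx0 : 0 < x := by linarith
  have hA := h₁ X hX x hx1 hx2
  have hH := h₂ x hx0
  set N := ⌈(x + 1) ^ 2⌉₊
  set A := ∑ n ∈ Finset.range N, (CyganKoranyi.r2 n : ℝ) * √(x ^ 2 - n)
  set D := ∑ m ∈ Finset.Icc 1 ⌊X ^ 2⌋₊, (CyganKoranyi.r2 m : ℝ) / m *
    Real.cos (2 * Real.pi * √m * x)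
  set H := ∑ n ∈ Finset.range N, (CyganKoranyi.r2 n : ℝ) *
    (x ^ 2 * CyganKoranyi.smootherProfile (n / x ^ 2))
  have hcount : (CyganKoranyi.N1 x : ℝ) + 2 * CyganKoranyi.T (x ^ 2) = 2 * √2 * x * A - H := by
    rw [CyganKoranyi.N1_add_two_mul_T hx0.le, Finset.mul_sum, ← Finset.sum_sub_distrib]
    refine Finset.sum_congr rfl fun n _ => ?_
    rw [CyganKoranyi.two_mul_sqrt_eq hx0 (Nat.cast_nonneg n)]
    ring
  have hE : CyganKoranyi.E1 x = 2 * √2 * x * A - H - 2 * CyganKoranyi.T (x ^ 2) -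
      (2 * √2 * (2 * Real.pi / 3) - CyganKoranyi.radialFourier CyganKoranyi.smootherProfile 0) * x ^ 4 := by
    rw [CyganKoranyi.E1, CyganKoranyi.volume_unitBall_eq, ← hcount]
    ring
  set S := CyganKoranyi.radialFourier CyganKoranyi.smootherProfile 0
  have hpi := Real.pi_ne_zero
  -- The x⁴ terms and T cancel, and 2√2·x·x/(2π)/x² = √2/π is the coefficient of the cosine sum;
  -- only the two Poisson errors remain.
  have e : CyganKoranyi.E1 x / x ^ 2 - (-(√2 / Real.pi) * D - 2 / x ^ 2 * CyganKoranyi.T (x ^ 2)) =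
      (2 * √2 * x * (A - 2 * Real.pi / 3 * x ^ 3 + x / (2 * Real.pi) * D) - (H - x ^ 4 * S)) / x ^ 2 := by
    rw [hE]
    field_simp
    ring
  rw [e, abs_div, abs_of_pos (by positivity : 0 < x ^ 2), div_le_iff₀ (by positivity)]
  have hXε : 1 ≤ X ^ ε := Real.one_le_rpow (by linarith) hε.le
  calc _ ≤ |2 * √2 * x * (A - 2 * Real.pi / 3 * x ^ 3 + x / (2 * Real.pi) * D)| + |H - x ^ 4 * S| :=
        abs_sub _ _
    _ ≤ 2 * √2 * x * (C₁ * X ^ ε) + C₂ * x := by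
        rw [abs_mul, abs_of_nonneg (by positivity : 0 ≤ 2 * √2 * x)]
        gcongr
    _ ≤ 2 * √2 * x * (C₁ * X ^ ε) + C₂ * x * X ^ ε + x * X ^ ε := by
        have h1 : C₂ * x ≤ C₂ * x * X ^ ε := le_mul_of_one_le_right (by positivity) hXε
        have h2 : 0 ≤ x * X ^ ε := by positivity
        linarith
    _ = (2 * √2 * C₁ + C₂ + 1) * (X ^ ε / X) * (X * x) := by field_simp
    _ ≤ (2 * √2 * C₁ + C₂ + 1) * (X ^ ε / X) * x ^ 2 := by
        rw [sq]
        gcongr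
    _ = _ := by
        rw [Real.rpow_add hX0, Real.rpow_neg_one]
        ring
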